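/- Let $N\ge 1$, write $x=(x',x_N)\in\mathbb R^{N-1}\times\mathbb R$ and $\mathbb R^N_+=\{x_N>0\}$. For a function $f$ on $\mathbb R^N_+$ let $\widetilde f$ be its odd extension: $\widetilde f(x)=f(x)$ if $x_N>0$, $\widetilde f(x',x_N)=-f(x',-x_N)$ if $x_N<0$, and $\widetilde f=0$ on $x_N=0$. **Assumptions.** 1. *(Initial data)* $u_0\in L^1(\mathbb R^N_+)\cap L^\infty(\mathbb R^N_+)$, $u_0\ge 0$ a.e., $u_0\not\equiv 0$, and $m_1=\int_{\mathbb R^N_+}x_N u_0(x)\,dx<\infty$. 2. *(Symbol)* $J_0:\mathbb R^N\to\mathbb R$ is continuous, $J_0(\xi)=1-a|\xi|^\beta+o(|\xi|^\beta)$ as $\xi\to0$ for some $a>0$ and $0<\beta\le 2$, and $\sup_{|\xi|\ge r}J_0(\xi)<1$ for every $r>0$. 3. *(Kernel)* For each $t>0$, $G(t)$ is a Borel probability measure on $\mathbb R^N$, even with respect to $x_N$ and even with respect to $x'$ (that is, $\int\phi\,dG(t)=0$ for every bounded continuous $\phi$ with $\phi(x',-x_N)=-\phi(x',x_N)$, and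 for every bounded continuous $\phi$ with $\phi(-x',x_N)=-\phi(x',x_N)$); $t\mapsto G(t)$ is continuous on $(0,\infty)$ for the narrow topology; and $\int e^{-ix\cdot\xi}\,dG(t)(x)=e^{t(J_0(\xi)-1)}$ for all $t>0$, $\xi\in\mathbb R^N$. 4. *(Diffusion operator)* $A$ is a linear operator, given by its action $\mathcal S(\mathbb R^N)\to C_b(\mathbb R^N)$, such that for every bounded signed measure $v_0$ on $\mathbb R^N$ the unique solution of $\partial_t v=Av$ in $(0,\infty)\times\mathbb R^N$, $v(0)=v_0$, is $v(t)=G(t)*v_0$. Here a solution is a family $(v(t))_{t\ge0}$ of bounded signed measures with $v(0)=v_0$, continuous in $t\geq 0$ when tested against bounded continuous functions, with $$\int_0^S\!\!\int(\partial_t\phi+A\phi)\,dv(t)\,dt=\int\phi(S)\,dv(S)-\int\phi(0)\,dv_0\qquad\text{for all }S>0,\ \phi\in C^1([0,S];\mathcal S(\mathbb R^N)).$$ **Solutions.** For $\alpha>0$, a solution on $[0,S]$ of $$\partial_t u=Au+|u|^\alpha u\ \text{ in }(0,S)\times\mathbb R^N_+,\qquad u(0,\cdot)=u_0,\qquad u(t,x',0)=0\tag{P}$$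 is a function $u$ whose odd extension satisfies $\widetilde u(0)=\widetilde u_0$, $\widetilde u\in C^1((0,S);L^1(\mathbb R^N))\cap C([0,S];L^1\cap L^{\alpha+1}(\mathbb R^N))\cap L^\infty(0,S;L^\infty(\mathbb R^N))$ and, for all $\phi\in C^1([0,S];\mathcal S(\mathbb R^N))$, $$\int_0^S\!\!\int_{\mathbb R^N}\big[\widetilde u(\partial_t\phi+A\phi)+|\widetilde u|^\alpha\widetilde u\,\phi\big]dx\,dt=\int_{\mathbb R^N}\big[\widetilde u(S)\phi(S)-\widetilde u_0\phi(0)\big]dx .$$ For $0<T\le\infty$, $u$ is a solution on $[0,T)$ if it is a solution on $[0,S]$ for every $0<S<T$; it is maximal, with existence time $T$, if it is not the restriction to $[0,T)$ of a solution on some $[0,T')$ with $T'>T$. 5. *(Comparison principle)* Let $w_0\le z_0$ a.e. in $\mathbb R^N_+$ with $w_0,z_0\in L^1\cap L^\infty(\mathbb R^N_+)$. Then $G(t)*\widetilde w_0\le G(t)*\widetilde z_0$ a.e. in $\mathbb R^N_+$ for all $t>0$ (these are the solutions of the linear equation in $\mathbb R^N_+$ with Dirichlet condition). Moreover, if $w$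 and $z$ are solutions of (P) on $[0,S]$ with initial data $w_0$ and $z_0$, then $w(t)\le z(t)$ a.e. in $\mathbb R^N_+$ for all $t\in[0,S]$. **Theorem (Systematic blow-up).** Under Assumptions 1–5, let $0<\alpha<\beta/(N+1)$. Then every maximal solution $u$ of (P) with initial datum $u_0$ blows up in finite time: its existence time $T$ is finite and $\|u(t,\cdot)\|_{L^\infty(\mathbb R^N_+)}\to+\infty$ as $t\to T^-$. In particular (P) has no global solution. -/

import Mathlib

open MeasureTheory Filter Topology Set
open scoped SchwartzMap BoundedContinuousFunction ENNReal

noncomputable section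

namespace HalfSpaceBlowup

/-- The space `ℝ^N` with `N = d + 1 ≥ 1`; a point is `x = (x', x_N)`, where `x_N` is the last
coordinate. -/
abbrev Space (d : ℕ) : Type := EuclideanSpace ℝ (Fin (d + 1))

/-- The last coordinate `x_N`. -/
def lastCoord {d : ℕ} (x : Space d) : ℝ := x (Fin.last d)

/-- The reflection `(x', x_N) ↦ (x', -x_N)`. -/
def flipLast {d : ℕ} (x : Space d) : Space d :=
  WithLp.toLp 2 (fun i => if i = Fin.last d then -x i else x i)

/-- The reflection `(x', x_N) ↦ (-x', x_N)`. -/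
def flipFirst {d : ℕ} (x : Space d) : Space d :=
  WithLp.toLp 2 (fun i => if i = Fin.last d then x i else -x i)

/-- The open half-space `x_N > 0`. -/
def halfSpace (d : ℕ) : Set (Space d) := {x | 0 < lastCoord x}

/-- Lebesgue measure on the half-space. -/
def halfVolume (d : ℕ) : Measure (Space d) := volume.restrict (halfSpace d)

/-- The odd extension, with respect to `x_N`, of a function on the half-space. A function on the
half-space is represented by a function on the whole space whose values for `x_N ≤ 0` are never
used. The extension vanishes on the boundary `x_N = 0`. -/
def oddExt {d : ℕ} (f : Space d → ℝ) (x : Space d) : ℝ :=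
  if 0 < lastCoord x then f x else if lastCoord x < 0 then -f (flipLast x) else 0

/-! ### Initial data -/

/-- Initial data on the half-space: in `L¹ ∩ L^∞`, nonnegative, not identically zero, and with
finite first moment `∫ x_N u₀(x) dx`. -/
structure IsInitialDatum {d : ℕ} (u₀ : Space d → ℝ) : Prop where
  memLp_one : MemLp u₀ 1 (halfVolume d)
  memLp_top : MemLp u₀ ⊤ (halfVolume d)
  nonneg : ∀ᵐ x ∂halfVolume d, 0 ≤ u₀ x
  nontrivial : ¬ (u₀ =ᵐ[halfVolume d] 0)
  moment : Integrable (fun x => lastCoord x * u₀ x) (halfVolume d)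

/-! ### The symbol and the kernel -/

/-- The function `J₀` is continuous, `J₀(ξ) = 1 - a|ξ|^β + o(|ξ|^β)` as `ξ → 0` with `a > 0` and
`0 < β ≤ 2`, and `sup_{|ξ| ≥ r} J₀(ξ) < 1` for every `r > 0`. -/
structure IsSymbol {d : ℕ} (J₀ : Space d → ℝ) (a β : ℝ) : Prop where
  continuous : Continuous J₀
  a_pos : 0 < a
  β_pos : 0 < β
  β_le_two : β ≤ 2
  expansion : (fun ξ => J₀ ξ - (1 - a * ‖ξ‖ ^ β)) =o[𝓝 0] (fun ξ => ‖ξ‖ ^ β)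
  away : ∀ r : ℝ, 0 < r → ∃ c : ℝ, c < 1 ∧ ∀ ξ, r ≤ ‖ξ‖ → J₀ ξ ≤ c

/-- A measure is even with respect to the reflection `σ`: it annihilates every bounded continuous
function that is odd under `σ`. -/
def IsEvenMeasure {d : ℕ} (σ : Space d → Space d) (μ : Measure (Space d)) : Prop :=
  ∀ φ : Space d →ᵇ ℝ, (∀ x, φ (σ x) = -φ x) → ∫ x, φ x ∂μ = 0

/-- The kernel `G`: for `t > 0`, `G(t)` is a probability measure, it depends continuously on `t`
(for the narrow topology), it is even in `x_N` and in `x'`, and its Fourier transform is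
`e^{t(J₀(ξ)-1)}`. Only the values for `t > 0` matter. -/
structure IsKernel {d : ℕ} (J₀ : Space d → ℝ) (G : ℝ → ProbabilityMeasure (Space d)) : Prop where
  continuousOn : ContinuousOn G (Ioi 0)
  even_last : ∀ t : ℝ, 0 < t → IsEvenMeasure flipLast (G t : Measure (Space d))
  even_first : ∀ t : ℝ, 0 < t → IsEvenMeasure flipFirst (G t : Measure (Space d))
  fourier : ∀ t : ℝ, 0 < t → ∀ ξ : Space d,
    ∫ x, Complex.exp (-(Complex.I * ((inner ℝ x ξ : ℝ) : ℂ))) ∂(G t : Measure (Space d)) =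
      Complex.exp (((t * (J₀ ξ - 1) : ℝ) : ℂ))

/-! ### The linear diffusion equation in the whole space -/

/-- Convolution of a probability measure with a bounded signed measure. -/
def convSigned {d : ℕ} (μ : ProbabilityMeasure (Space d)) (ν : SignedMeasure (Space d)) :
    SignedMeasure (Space d) :=
  (Measure.conv (μ : Measure (Space d)) ν.toJordanDecomposition.posPart).toSignedMeasure -
    (Measure.conv (μ : Measure (Space d)) ν.toJordanDecomposition.negPart).toSignedMeasure

/-- Test functions: `φ ∈ C¹([0,S]; 𝓢(ℝ^N))` with time derivative `φ'`, the limit of the difference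
quotients in the topology of the Schwartz space (one-sided at the end points). -/
structure IsTestFunction {d : ℕ} (S : ℝ) (φ φ' : ℝ → 𝓢(Space d, ℝ)) : Prop where
  deriv : ∀ t ∈ Icc 0 S, Tendsto (slope φ t) (𝓝[Icc 0 S \ {t}] t) (𝓝 (φ' t))
  continuousOn : ContinuousOn φ' (Icc 0 S)

/-- `v` is a weak solution in `(0,∞) × ℝ^N` of `∂ₜ v = A v`, `v(0) = v₀`, where `v₀` and the `v(t)`
are bounded measures. The (self-adjoint) operator `A` is given by its action on Schwartz
functions. -/
structure IsLinearSolution {d : ℕ} (A : 𝓢(Space d, ℝ) →ₗ[ℝ] (Space d →ᵇ ℝ))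
    (v₀ : SignedMeasure (Space d)) (v : ℝ → SignedMeasure (Space d)) : Prop where
  initial : v 0 = v₀
  continuousOn : ∀ ψ : Space d →ᵇ ℝ, ContinuousOn (fun t => ∫ᵛ x, ψ x ∂<•(v t)) (Ici 0)
  weak : ∀ S : ℝ, 0 < S → ∀ φ φ' : ℝ → 𝓢(Space d, ℝ), IsTestFunction S φ φ' →
    ∫ t in (0 : ℝ)..S, (∫ᵛ x, (φ' t x + A (φ t) x) ∂<•(v t)) =
      (∫ᵛ x, φ S x ∂<•(v S)) - ∫ᵛ x, φ 0 x ∂<•v₀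

/-- `A` is the diffusion operator with kernel `G`: for every bounded measure `v₀`, the unique
solution of `∂ₜ v = A v`, `v(0) = v₀`, is `v(t) = G(t) * v₀`. -/
def IsDiffusionOperator {d : ℕ} (G : ℝ → ProbabilityMeasure (Space d))
    (A : 𝓢(Space d, ℝ) →ₗ[ℝ] (Space d →ᵇ ℝ)) : Prop :=
  ∀ (v₀ : SignedMeasure (Space d)) (v : ℝ → SignedMeasure (Space d)),
    IsLinearSolution A v₀ v ↔ (v 0 = v₀ ∧ ∀ t : ℝ, 0 < t → v t = convSigned (G t) v₀)

/-! ### The semilinear equation -/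

/-- `u ∈ C(I; L^p(ℝ^N))`. -/
def ContinuousInLp {d : ℕ} (p : ℝ≥0∞) (I : Set ℝ) (u : ℝ → Space d → ℝ) : Prop :=
  ∀ t ∈ I, MemLp (u t) p volume ∧
    Tendsto (fun s => eLpNorm (u s - u t) p volume) (𝓝[I] t) (𝓝 0)

/-- `u ∈ C¹((0,S); L¹(ℝ^N))`. -/
def IsC1InL1 {d : ℕ} (S : ℝ) (u : ℝ → Space d → ℝ) : Prop :=
  ∃ U : ℝ → Lp ℝ 1 (volume : Measure (Space d)),
    (∀ t ∈ Ioo 0 S, (U t : Space d → ℝ) =ᵐ[volume] u t) ∧ ContDiffOn ℝ 1 U (Ioo 0 S)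

/-- `u` is a bounded weak solution on `[0,S] × ℝ^N` of `∂ₜ u = A u + |u|^α u`, `u(0) = u₀`:
`u ∈ C¹((0,S); L¹) ∩ C([0,S]; L¹ ∩ L^{α+1}) ∩ L^∞(0,S; L^∞)` and the equation holds when tested
against `C¹([0,S]; 𝓢(ℝ^N))`. -/
structure IsWeakSolution {d : ℕ} (A : 𝓢(Space d, ℝ) →ₗ[ℝ] (Space d →ᵇ ℝ)) (α S : ℝ)
    (u₀ : Space d → ℝ) (u : ℝ → Space d → ℝ) : Prop where
  initial : u 0 =ᵐ[volume] u₀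
  c1 : IsC1InL1 S u
  continuous_L1 : ContinuousInLp 1 (Icc 0 S) u
  continuous_Lα : ContinuousInLp (ENNReal.ofReal (α + 1)) (Icc 0 S) u
  bounded : ∃ M : ℝ, ∀ t ∈ Icc 0 S, ∀ᵐ x, |u t x| ≤ M
  weak : ∀ φ φ' : ℝ → 𝓢(Space d, ℝ), IsTestFunction S φ φ' →
    ∫ t in (0 : ℝ)..S, (∫ x, (u t x * (φ' t x + A (φ t) x) + |u t x| ^ α * u t x * φ t x)) =
      ∫ x, (u S x * φ S x - u₀ x * φ 0 x)

/-- `u` solves on `[0,S]` the half-space Cauchy problem `∂ₜ u = A u + |u|^α u`, `u(0) = u₀`, with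
zero Dirichlet condition: its odd extension solves the equation in the whole space. -/
def IsHalfSpaceSolution {d : ℕ} (A : 𝓢(Space d, ℝ) →ₗ[ℝ] (Space d →ᵇ ℝ)) (α S : ℝ)
    (u₀ : Space d → ℝ) (u : ℝ → Space d → ℝ) : Prop :=
  IsWeakSolution A α S (oddExt u₀) (fun t => oddExt (u t))

/-- `u` solves the half-space Cauchy problem on `[0,T)`, where `0 < T ≤ ∞`. -/
def IsSolutionUpTo {d : ℕ} (A : 𝓢(Space d, ℝ) →ₗ[ℝ] (Space d →ᵇ ℝ)) (α : ℝ) (T : EReal)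
    (u₀ : Space d → ℝ) (u : ℝ → Space d → ℝ) : Prop :=
  0 < T ∧ ∀ S : ℝ, 0 < S → (S : EReal) < T → IsHalfSpaceSolution A α S u₀ u

/-- `u` is a maximal solution of the half-space Cauchy problem, with existence time `T ∈ (0,∞]`:
it solves the problem on `[0,T)` and cannot be continued as a solution beyond `T`. -/
def IsMaximalSolution {d : ℕ} (A : 𝓢(Space d, ℝ) →ₗ[ℝ] (Space d →ᵇ ℝ)) (α : ℝ) (T : EReal)
    (u₀ : Space d → ℝ) (u : ℝ → Space d → ℝ) : Prop :=
  IsSolutionUpTo A α T u₀ u ∧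
    ¬ ∃ (T' : EReal) (w : ℝ → Space d → ℝ), T < T' ∧ IsSolutionUpTo A α T' u₀ w ∧
      ∀ t : ℝ, 0 ≤ t → (t : EReal) < T → w t =ᵐ[halfVolume d] u t

/-- Blow-up in finite time of a solution `u` with maximal existence time `T`: `T < ∞` and
`‖u(t)‖_{L^∞} → ∞` as `t → T`. -/
def BlowsUpInFiniteTime {d : ℕ} (T : EReal) (u : ℝ → Space d → ℝ) : Prop :=
  ∃ S : ℝ, T = (S : EReal) ∧
    Tendsto (fun t => eLpNorm (u t) ⊤ (halfVolume d)) (𝓝[<] S) (𝓝 ⊤)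

/-! ### The comparison principle -/

/-- The solution `w(t) = G(t) * w̃₀` (for `x_N > 0`) of the linear half-space problem
`∂ₜ w = A w`, `w(0) = w₀`, with zero Dirichlet condition; `w̃₀` is the odd extension of `w₀`. -/
def linearHalfSpaceFlow {d : ℕ} (G : ℝ → ProbabilityMeasure (Space d)) (w₀ : Space d → ℝ)
    (t : ℝ) (x : Space d) : ℝ :=
  ∫ y, oddExt w₀ (x - y) ∂(G t : Measure (Space d))

/-- The comparison principle for the linear and for the semilinear half-space Cauchy problems, with
initial data in `L¹ ∩ L^∞`. -/
structure ComparisonPrinciple {d : ℕ} (G : ℝ → ProbabilityMeasure (Space d))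
    (A : 𝓢(Space d, ℝ) →ₗ[ℝ] (Space d →ᵇ ℝ)) (α : ℝ) : Prop where
  linear : ∀ w₀ z₀ : Space d → ℝ,
    MemLp w₀ 1 (halfVolume d) → MemLp w₀ ⊤ (halfVolume d) →
    MemLp z₀ 1 (halfVolume d) → MemLp z₀ ⊤ (halfVolume d) →
    w₀ ≤ᵐ[halfVolume d] z₀ → ∀ t : ℝ, 0 < t →
      linearHalfSpaceFlow G w₀ t ≤ᵐ[halfVolume d] linearHalfSpaceFlow G z₀ t
  semilinear : ∀ (S : ℝ) (w₀ z₀ : Space d → ℝ) (w z : ℝ → Space d → ℝ), 0 < S →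
    MemLp w₀ 1 (halfVolume d) → MemLp w₀ ⊤ (halfVolume d) →
    MemLp z₀ 1 (halfVolume d) → MemLp z₀ ⊤ (halfVolume d) →
    w₀ ≤ᵐ[halfVolume d] z₀ →
    IsHalfSpaceSolution A α S w₀ w → IsHalfSpaceSolution A α S z₀ z →
    ∀ t ∈ Icc 0 S, w t ≤ᵐ[halfVolume d] z t

end HalfSpaceBlowup

end

/-!
The blow-up is proved by a duality argument of Kaplan type. Suppose that `u` is global, and write
`U(t)` for its odd extension. Let `ψ` be an integrable bounded odd function, nonnegative on the
half-space, of mass `m = ∫ |ψ|`. The function `y(s) = ⟨U(s), G(t-s) * ψ⟩` on `[0,t]` satisfies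
`y'(s) = ⟨|U(s)|^α U(s), G(t-s) * ψ⟩`, because the linear parts cancel. By the comparison principle
`u ≥ 0` and `G(t-s) * ψ ≥ 0` on the half-space, and so `U(s) (G(t-s) * ψ) ≥ 0` everywhere; as the
mass of `G(t-s) * ψ` is at most `m`, Jensen's inequality gives `y^{1+α} ≤ m^α y'`, and hence
`α t y(0)^α ≤ m^α` (`IsStrongSolution.kaplan`). Now take `ψ(x) = x_N e^{-|x|²/(2λ²)}` and
`t = λ^β`. The mass of `ψ` is a multiple of `λ^{N+1}`, so that `y(0) = ⟨U(0), G(t) * ψ⟩` is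
`O(λ^{N+1-β/α})` and tends to `0` when `α < β/(N+1)`. On the other hand, the Fourier representation
of `G(t) * ψ` and the expansion of the symbol show that `G(t) * ψ → c x_N` pointwise, with `c > 0`
(`tendsto_bcfConv_scaledGauss`). By Fatou's lemma `∫ x_N u₀ = 0`, which contradicts `u₀ ≢ 0`
(`not_isSolutionUpTo_top`).

To differentiate `y`, and to obtain the blow-up alternative, the weak formulation has to be turned
into an evolution equation in `L¹`. The operators `f ↦ G(t) * f` form a contraction semigroup on
`L¹` (`isContractionSemigroup`): the semigroup law comes from the Fourier transform, and strong
continuity at `t = 0` from the linear equation with initial value a Dirac mass. As the solutions of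
the linear equation are convolutions, `A` commutes with translations, and therefore an `x ∈ L¹` with
`⟨x, A φ⟩ = ⟨y, φ⟩` for all Schwartz functions `φ` lies in the domain of the generator of this
semigroup, with value `y` (`IsWeakGenerator.semigroup_sub_eq`). Consequently a weak solution is a
strong solution, and satisfies the Duhamel formula.

The blow-up alternative (`IsMaximalSolution.tendsto_eLpNorm`): if `T < ∞` and `‖u(t)‖_{L^∞}` does
not tend to `∞`, there are times `t₀` arbitrarily close to `T` at which it is at most a fixed `M`.
From such a time the Duhamel equation, with the nonlinearity truncated to make it globally
Lipschitz, is solvable on an interval whose length depends only on `M` and `α`, and on which the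
solution stays below the truncation level (`exists_local_solution`). As `U(t₀)` belongs to the
domain of the generator, this mild solution is of class `C¹`: its derivative is the mild solution of
the linearized equation (`IsContractionSemigroup.mild_eq_integral`). It is therefore a strong and
hence a weak solution, and by uniqueness it continues `u` beyond `T` (`exists_continuation`).
-/

noncomputable section

namespace HalfSpaceBlowup

/-! ### Mild solutions of semilinear equations for a contraction semigroup -/

section Semigroup

variable {E : Type*} [NormedAddCommGroup E] [NormedSpace ℝ E]

/-- A strongly continuous semigroup of contractions. For convenience it is indexed by all real
times, and is the identity for `t ≤ 0`. -/
structure IsContractionSemigroup (P : ℝ → E →L[ℝ] E) : Prop where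
  of_nonpos : ∀ t ≤ 0, ∀ x, P t x = x
  norm_le : ∀ t x, ‖P t x‖ ≤ ‖x‖
  add : ∀ s t, 0 ≤ s → 0 ≤ t → ∀ x, P (s + t) x = P s (P t x)
  continuous : ∀ x, Continuous fun t => P t x

/-- `U` is on `[0,τ]` the mild solution with initial value `x` and forcing term `g`, given by the
Duhamel formula. -/
def IsMild (P : ℝ → E →L[ℝ] E) (τ : ℝ) (x : E) (g U : ℝ → E) : Prop :=
  ∀ t ∈ Icc 0 τ, U t = P t x + ∫ s in (0 : ℝ)..t, P (t - s) (g s)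

namespace IsContractionSemigroup

variable {P : ℝ → E →L[ℝ] E} (hP : IsContractionSemigroup P)

include hP

lemma continuous_uncurry : Continuous fun p : ℝ × E => P p.1 p.2 := by
  rw [continuous_iff_continuousAt]
  rintro ⟨t, x⟩
  rw [ContinuousAt, tendsto_iff_norm_sub_tendsto_zero]
  have h1 : Tendsto (fun p : ℝ × E => ‖p.2 - x‖ + ‖P p.1 x - P t x‖) (𝓝 (t, x)) (𝓝 0) := by
    have : Continuous fun p : ℝ × E => ‖p.2 - x‖ + ‖P p.1 x - P t x‖ :=
      (continuous_snd.sub continuous_const).norm.add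
        (((hP.continuous x).comp continuous_fst).sub continuous_const).norm
    simpa using this.tendsto (t, x)
  refine squeeze_zero (fun _ => norm_nonneg _) (fun p => ?_) h1
  calc ‖P p.1 p.2 - P t x‖ = ‖P p.1 (p.2 - x) + (P p.1 x - P t x)‖ := by
        rw [map_sub]; congr 1; abel
    _ ≤ _ := (norm_add_le _ _).trans (by gcongr; exact hP.norm_le _ _)

lemma comp_continuous {X : Type*} [TopologicalSpace X] {a : X → ℝ} {b : X → E}
    (ha : Continuous a) (hb : Continuous b) : Continuous fun x => P (a x) (b x) :=
  hP.continuous_uncurry.comp (ha.prodMk hb)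

lemma comp_continuousOn {X : Type*} [TopologicalSpace X] {a : X → ℝ} {b : X → E} {s : Set X}
    (ha : ContinuousOn a s) (hb : ContinuousOn b s) : ContinuousOn (fun x => P (a x) (b x)) s :=
  hP.continuous_uncurry.comp_continuousOn (ha.prodMk hb)

lemma apply_zero (x : E) : P 0 x = x := hP.of_nonpos 0 le_rfl x

lemma continuous_duhamel {g : ℝ → E} (hg : Continuous g) :
    Continuous fun t => ∫ s in (0 : ℝ)..t, P (t - s) (g s) := by
  refine intervalIntegral.continuous_parametric_intervalIntegral_of_continuous
    (f := fun t s => P (t - s) (g s)) ?_ continuous_id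
  exact hP.comp_continuous (continuous_fst.sub continuous_snd) (hg.comp continuous_snd)

lemma tendsto_duhamel_div [CompleteSpace E] {g : ℝ → E} (hg : Continuous g) :
    Tendsto (fun h : ℝ => h⁻¹ • ∫ s in (0 : ℝ)..h, P (h - s) (g s)) (𝓝[>] 0) (𝓝 (g 0)) := by
  have h1 : Continuous fun h : ℝ => ∫ s in (0 : ℝ)..1, P (h - h * s) (g (h * s)) :=
    intervalIntegral.continuous_parametric_intervalIntegral_of_continuous'
      (f := fun h s : ℝ => P (h - h * s) (g (h * s)))
      (hP.comp_continuous (by fun_prop) (hg.comp (by fun_prop))) 0 1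
  have h2 : Tendsto (fun h : ℝ => ∫ s in (0 : ℝ)..1, P (h - h * s) (g (h * s))) (𝓝[>] 0)
      (𝓝 (g 0)) := by
    refine (h1.tendsto' 0 (g 0) ?_).mono_left nhdsWithin_le_nhds
    simp [hP.apply_zero]
  refine h2.congr' ?_
  filter_upwards [self_mem_nhdsWithin] with h hh
  have hh' : h ≠ 0 := ne_of_gt hh
  have := intervalIntegral.smul_integral_comp_mul_left (a := 0) (b := 1)
    (fun s => P (h - s) (g s)) h
  rw [mul_zero, mul_one] at this
  rw [← this, inv_smul_smul₀ hh']

/-- A mild solution can be restarted at any time `a`. -/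
lemma mild_restart [CompleteSpace E] {τ : ℝ} {x : E} {g U : ℝ → E} (hg : ContinuousOn g (Icc 0 τ))
    (hU : IsMild P τ x g U) {a s : ℝ} (ha : 0 ≤ a) (hs : 0 ≤ s) (has : s + a ≤ τ) :
    U (s + a) = P s (U a) + ∫ σ in (0 : ℝ)..s, P (s - σ) (g (σ + a)) := by
  have hcont : ContinuousOn (fun σ => P (s + a - σ) (g σ)) (Icc 0 τ) :=
    hP.comp_continuousOn (by fun_prop) hg
  rw [hU (s + a) ⟨by linarith, has⟩, hU a ⟨ha, by linarith⟩, map_add, ← hP.add s a hs ha, add_assoc]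
  congr 1
  rw [← intervalIntegral.integral_add_adjacent_intervals (b := a)]
  · congr 1
    · rw [← ContinuousLinearMap.intervalIntegral_comp_comm]
      · refine intervalIntegral.integral_congr fun σ hσ => ?_
        rw [uIcc_of_le ha] at hσ
        change _ = P s (P (a - σ) (g σ))
        rw [← hP.add s (a - σ) hs (by linarith [hσ.2])]
        congr 2; ring
      · refine (hP.comp_continuousOn (by fun_prop) (hg.mono ?_)).intervalIntegrable
        rw [uIcc_of_le ha]
        exact Icc_subset_Icc le_rfl (by linarith)
    · have := intervalIntegral.integral_comp_add_right (a := 0) (b := s)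
        (fun σ => P (s + a - σ) (g σ)) a
      rw [zero_add] at this
      rw [← this]
      refine intervalIntegral.integral_congr fun σ _ => ?_
      congr 2; ring
  · refine (hcont.mono ?_).intervalIntegrable
    rw [uIcc_of_le ha]; exact Icc_subset_Icc le_rfl (by linarith)
  · refine (hcont.mono ?_).intervalIntegrable
    rw [uIcc_of_le (by linarith)]; exact Icc_subset_Icc ha has

/-- The difference quotients of a mild solution determine the value of the generator. -/
lemma tendsto_generator_of_mild [CompleteSpace E] {τ : ℝ} {x : E} {g U : ℝ → E} (hg : Continuous g)
    (hU : IsMild P τ x g U) {t : ℝ} (ht : 0 ≤ t) (htτ : t < τ) {y : E}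
    (hy : HasDerivWithinAt U y (Ici t) t) :
    Tendsto (fun h : ℝ => h⁻¹ • (P h (U t) - U t)) (𝓝[>] 0) (𝓝 (y - g t)) := by
  have h1 : Tendsto (fun h : ℝ => h⁻¹ • (U (t + h) - U t)) (𝓝[>] 0) (𝓝 y) := by
    have h2 := hasDerivWithinAt_iff_tendsto_slope.1 hy
    have h3 : Tendsto (fun h : ℝ => t + h) (𝓝[>] 0) (𝓝[Ici t \ {t}] t) := by
      refine tendsto_nhdsWithin_iff.2 ⟨?_, ?_⟩
      · exact ((continuous_const.add continuous_id).tendsto' 0 t (by simp)).mono_left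
          nhdsWithin_le_nhds
      · filter_upwards [self_mem_nhdsWithin] with h hh
        have : 0 < h := hh
        exact ⟨by simp only [mem_Ici]; linarith, by simp [this.ne']⟩
    refine (h2.comp h3).congr fun h => ?_
    simp [slope_def_module]
  have h2 := hP.tendsto_duhamel_div (g := fun σ => g (σ + t)) (hg.comp (by fun_prop))
  rw [zero_add] at h2
  refine (h1.sub h2).congr' ?_
  have h3 : ∀ᶠ h in 𝓝[>] (0 : ℝ), h < τ - t :=
    nhdsWithin_le_nhds (Iio_mem_nhds (by linarith))
  filter_upwards [self_mem_nhdsWithin, h3] with h hh hhτ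
  have hh' : 0 < h := hh
  rw [← smul_sub, add_comm t h, hP.mild_restart hg.continuousOn hU ht hh'.le (by linarith)]
  congr 1; abel

/-- If `x` is in the domain of the generator with value `z`, in the integrated sense, and `U` is
differentiable at `s`, then so is `σ ↦ P (t - σ) (U σ)`. -/
lemma hasDerivAt_duhamel [CompleteSpace E] {U : ℝ → E} {s t : ℝ} (hst : s < t) {y z : E}
    (hU : HasDerivAt U y s)
    (hz : ∀ h, 0 ≤ h → P h (U s) - U s = ∫ r in (0 : ℝ)..h, P r z) :
    HasDerivAt (fun σ => P (t - σ) (U σ)) (P (t - s) (y - z)) s := by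
  have h1 : HasDerivAt (fun r => P r (U s)) (P (t - s) z) (t - s) := by
    have h2 : HasDerivAt (fun r => U s + ∫ r in (0 : ℝ)..r, P r z) (P (t - s) z) (t - s) :=
      ((hP.continuous z).integral_hasStrictDerivAt 0 (t - s)).hasDerivAt.const_add _
    refine h2.congr_of_eventuallyEq ?_
    filter_upwards [Ioi_mem_nhds (show 0 < t - s by linarith)] with r hr
    rw [← hz r (le_of_lt hr)]; abel
  have h2 : HasDerivAt (fun σ => P (t - σ) (U s)) (-P (t - s) z) s := by
    have h3 : HasDerivAt (fun σ : ℝ => t - σ) (-1) s := by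
      simpa using (hasDerivAt_id s).const_sub t
    simpa [Function.comp_def] using HasDerivAt.scomp s h1 h3
  have h3 : HasDerivAt (fun σ => P (t - σ) (U σ - U s)) (P (t - s) y) s := by
    rw [hasDerivAt_iff_tendsto_slope] at hU ⊢
    have h4 : Tendsto (fun σ => P (t - σ) (slope U s σ)) (𝓝[≠] s) (𝓝 (P (t - s) y)) := by
      have h5 : Tendsto (fun σ => ((t - σ, slope U s σ) : ℝ × E)) (𝓝[≠] s) (𝓝 (t - s, y)) :=
        (((continuous_const.sub continuous_id).tendsto s).mono_left
          nhdsWithin_le_nhds).prodMk_nhds hU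
      exact (hP.continuous_uncurry.tendsto (t - s, y)).comp h5
    refine h4.congr fun σ => ?_
    simp [slope_def_module]
  convert! h3.add h2 using 1
  · ext σ; simp
  · simp [sub_eq_add_neg]

/-- A classical solution of the inhomogeneous equation is given by the Duhamel formula. -/
lemma mild_of_hasDerivAt [CompleteSpace E] {U U' g : ℝ → E} {τ : ℝ}
    (hUc : ContinuousOn U (Icc 0 τ)) (hU : ∀ s ∈ Ioo 0 τ, HasDerivAt U (U' s) s)
    (hg : ContinuousOn g (Icc 0 τ))
    (hgen : ∀ s ∈ Ioo 0 τ, ∀ h, 0 ≤ h → P h (U s) - U s = ∫ r in (0 : ℝ)..h, P r (U' s - g s)) :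
    IsMild P τ (U 0) g U := by
  intro t ht
  have hsub : Icc 0 t ⊆ Icc 0 τ := Icc_subset_Icc le_rfl ht.2
  have h1 := intervalIntegral.integral_eq_sub_of_hasDerivAt_of_le (a := 0) (b := t)
    (f := fun σ => P (t - σ) (U σ)) (f' := fun σ => P (t - σ) (g σ)) ht.1
    (hP.comp_continuousOn (by fun_prop) (hUc.mono hsub))
    (fun s hs => by
      have hs' : s ∈ Ioo 0 τ := ⟨hs.1, hs.2.trans_le ht.2⟩
      simpa using hP.hasDerivAt_duhamel hs.2 (hU s hs') (hgen s hs'))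
    (by
      refine ContinuousOn.intervalIntegrable ?_
      rw [uIcc_of_le ht.1]
      exact hP.comp_continuousOn (by fun_prop) (hg.mono hsub))
  rw [h1, sub_self, sub_zero, hP.apply_zero]
  abel

end IsContractionSemigroup

/-- Gronwall's lemma in integral form. -/
lemma le_mul_exp_of_le_integral {a : ℝ → ℝ} {τ ε K : ℝ} (hτ : 0 ≤ τ) (hK : 0 ≤ K)
    (ha : ContinuousOn a (Icc 0 τ))
    (h : ∀ t ∈ Icc 0 τ, a t ≤ ε + K * ∫ s in (0 : ℝ)..t, a s) : a τ ≤ ε * Real.exp (K * τ) := by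
  set b : ℝ → ℝ := IccExtend hτ ((Icc 0 τ).domRestrict a) with hb
  have hbc : Continuous b := (continuousOn_iff_continuous_domRestrict.1 ha).Icc_extend'
  have hba : ∀ t ∈ Icc 0 τ, b t = a t := fun t ht => IccExtend_of_mem _ _ ht
  set J : ℝ → ℝ := fun t => ∫ s in (0 : ℝ)..t, b s with hJ
  have hJd : ∀ t, HasDerivAt J (b t) t := fun t =>
    (hbc.integral_hasStrictDerivAt 0 t).hasDerivAt
  have hbJ : ∀ t ∈ Icc 0 τ, b t ≤ ε + K * J t := by
    intro t ht
    rw [hba t ht]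
    refine (h t ht).trans_eq ?_
    congr 2
    refine intervalIntegral.integral_congr fun s hs => (hba s ?_).symm
    rw [uIcc_of_le ht.1] at hs
    exact ⟨hs.1, hs.2.trans ht.2⟩
  -- The function `(ε + K J(t)) e^{-Kt}` is nonincreasing.
  set f : ℝ → ℝ := fun t => (ε + K * J t) * Real.exp (-(K * t)) with hf
  have hfd : ∀ t, HasDerivAt f ((K * b t) * Real.exp (-(K * t)) +
      (ε + K * J t) * (Real.exp (-(K * t)) * (-(K * 1)))) t := fun t =>
    (((hJd t).const_mul K).const_add ε).mul (((hasDerivAt_id t).const_mul K).neg.exp)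
  have hanti : AntitoneOn f (Icc 0 τ) := by
    refine antitoneOn_of_deriv_nonpos (convex_Icc 0 τ)
      (fun t _ => (hfd t).continuousAt.continuousWithinAt)
      (fun t _ => (hfd t).differentiableAt.differentiableWithinAt) fun t ht => ?_
    rw [interior_Icc] at ht
    rw [(hfd t).deriv]
    have h1 := hbJ t ⟨ht.1.le, ht.2.le⟩
    have h2 := mul_nonneg hK (Real.exp_pos (-(K * t))).le
    nlinarith
  have h1 := hanti (left_mem_Icc.2 hτ) (right_mem_Icc.2 hτ) hτ
  have h2 : f 0 = ε := by simp [hf, hJ]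
  have h3 : (ε + K * J τ) ≤ ε * Real.exp (K * τ) := by
    have h4 : f τ * Real.exp (K * τ) = ε + K * J τ := by
      simp only [hf]; rw [mul_assoc, ← Real.exp_add]; simp
    rw [← h4, ← h2]
    exact mul_le_mul_of_nonneg_right h1 (Real.exp_pos _).le
  rw [← hba τ (right_mem_Icc.2 hτ)]
  exact (hbJ τ (right_mem_Icc.2 hτ)).trans h3

namespace IsContractionSemigroup

variable {P : ℝ → E →L[ℝ] E} (hP : IsContractionSemigroup P)

include hP

/-- Uniqueness of mild solutions of `U' = A U + F(U)` with `F` Lipschitz. -/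
lemma mild_unique [CompleteSpace E] {τ K : ℝ} {F : E → E} {x : E} {U V : ℝ → E} (hK : 0 ≤ K)
    (hF : ∀ u v, ‖F u - F v‖ ≤ K * ‖u - v‖)
    (hUc : ContinuousOn U (Icc 0 τ)) (hVc : ContinuousOn V (Icc 0 τ))
    (hU : IsMild P τ x (fun s => F (U s)) U) (hV : IsMild P τ x (fun s => F (V s)) V) :
    ∀ t ∈ Icc 0 τ, U t = V t := by
  have hFc : Continuous F := (LipschitzWith.of_dist_le_mul (K := ⟨K, hK⟩) fun u v => by
    rw [dist_eq_norm, dist_eq_norm]; exact hF u v).continuous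
  intro t ht
  have hsub : Icc 0 t ⊆ Icc 0 τ := Icc_subset_Icc le_rfl ht.2
  have hint : ∀ {W : ℝ → E}, ContinuousOn W (Icc 0 τ) → ∀ r ∈ Icc 0 t,
      IntervalIntegrable (fun s => P (r - s) (F (W s))) volume 0 r := by
    intro W hW r hr
    refine (hP.comp_continuousOn (by fun_prop) (hFc.comp_continuousOn (hW.mono ?_))).intervalIntegrable
    rw [uIcc_of_le hr.1]; exact Icc_subset_Icc le_rfl (hr.2.trans ht.2)
  have hdc : ContinuousOn (fun s => ‖U s - V s‖) (Icc 0 t) := ((hUc.sub hVc).mono hsub).norm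
  have := le_mul_exp_of_le_integral (a := fun s => ‖U s - V s‖) (ε := 0) ht.1 hK hdc
    (fun r hr => by
      have hr' := hsub hr
      rw [hU r hr', hV r hr', add_sub_add_left_eq_sub,
        ← intervalIntegral.integral_sub (hint hUc r hr) (hint hVc r hr), zero_add,
        ← intervalIntegral.integral_const_mul]
      refine intervalIntegral.norm_integral_le_of_norm_le hr.1 ?_ ?_
      · refine ae_of_all _ fun s _ => ?_
        rw [← map_sub]
        exact (hP.norm_le _ _).trans (hF _ _)
      · refine ((hdc.mono ?_).intervalIntegrable).const_mul K
        rw [uIcc_of_le hr.1]; exact Icc_subset_Icc le_rfl hr.2)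
  rw [zero_mul] at this
  exact sub_eq_zero.1 (norm_le_zero_iff.1 this)

/-- Existence of mild solutions on a short time interval, by the contraction principle. -/
lemma exists_mild [CompleteSpace E] {τ K : ℝ} (hτ : 0 ≤ τ) (hK0 : 0 ≤ K) (hKτ : K * τ ≤ 1 / 2)
    {Φ : ℝ → E → E} (hΦ : Continuous fun p : ℝ × E => Φ p.1 p.2)
    (hK : ∀ s u v, ‖Φ s u - Φ s v‖ ≤ K * ‖u - v‖) (x : E) :
    ∃ U : ℝ → E, Continuous U ∧ IsMild P τ x (fun s => Φ s (U s)) U := by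
  let ext : C(Icc (0 : ℝ) τ, E) → ℝ → E := fun u => IccExtend hτ u
  have hext : ∀ u, Continuous (ext u) := fun u => u.continuous.Icc_extend'
  have hΦc : ∀ u, Continuous fun s => Φ s (ext u s) := fun u =>
    hΦ.comp (continuous_id.prodMk (hext u))
  let T : C(Icc (0 : ℝ) τ, E) → C(Icc (0 : ℝ) τ, E) := fun u =>
    ⟨fun t => P t x + ∫ s in (0 : ℝ)..t, P (t - s) (Φ s (ext u s)),
      ((hP.continuous x).add (hP.continuous_duhamel (hΦc u))).comp continuous_subtype_val⟩
  have hT : ContractingWith (1 / 2) T := by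
    refine ⟨by rw [← NNReal.coe_lt_coe]; norm_num, LipschitzWith.of_dist_le_mul fun u v => ?_⟩
    rw [ContinuousMap.dist_le (by positivity)]
    intro t
    have ht0 : 0 ≤ (t : ℝ) := t.2.1
    have hint : ∀ u, IntervalIntegrable (fun s => P (t - s) (Φ s (ext u s))) volume 0 t :=
      fun u => (hP.comp_continuous (by fun_prop) (hΦc u)).intervalIntegrable _ _
    have hb : ‖∫ s in (0 : ℝ)..t, (P (t - s) (Φ s (ext u s)) - P (t - s) (Φ s (ext v s)))‖ ≤
        (K * dist u v) * |(t : ℝ) - 0| := by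
      refine intervalIntegral.norm_integral_le_of_norm_le_const fun s hs => ?_
      rw [← map_sub]
      have h1 : ‖ext u s - ext v s‖ ≤ dist u v := by
        rw [← dist_eq_norm]; exact ContinuousMap.dist_apply_le_dist _
      refine (hP.norm_le _ _).trans ((hK s _ _).trans ?_)
      gcongr
    have ht1 : K * (t : ℝ) ≤ 1 / 2 := (mul_le_mul_of_nonneg_left t.2.2 hK0).trans hKτ
    rw [dist_eq_norm]
    change ‖(P t x + ∫ s in (0 : ℝ)..t, P (t - s) (Φ s (ext u s))) -
      (P t x + ∫ s in (0 : ℝ)..t, P (t - s) (Φ s (ext v s)))‖ ≤ _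
    rw [add_sub_add_left_eq_sub, ← intervalIntegral.integral_sub (hint u) (hint v)]
    refine hb.trans ?_
    rw [sub_zero, abs_of_nonneg ht0]
    have := mul_le_mul_of_nonneg_right ht1 (dist_nonneg (x := u) (y := v))
    push_cast
    linarith
  let u := hT.fixedPoint T
  have hu : T u = u := hT.fixedPoint_isFixedPt
  refine ⟨ext u, hext u, fun t ht => ?_⟩
  have h1 : ext u t = u ⟨t, ht⟩ := IccExtend_of_mem _ _ ht
  rw [h1]
  exact (DFunLike.congr_fun hu ⟨t, ht⟩).symm

/-- A mild solution of `U' = A U + F(U)` whose initial value lies in the domain of the generator is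
continuously differentiable. The map `F` need not be differentiable: it is enough that its
increments are `N(u,w)(u - w)` with a strongly continuous and bounded family `N` of operators. The
derivative is found as the mild solution of the linearized equation. -/
lemma mild_eq_integral [CompleteSpace E] {τ K : ℝ} (hτ : 0 ≤ τ) (hK0 : 0 ≤ K)
    (hKτ : K * τ ≤ 1 / 2) {F : E → E} {N : E → E → E →L[ℝ] E}
    (hFN : ∀ u w, F u - F w = N u w (u - w))
    (hNc : Continuous fun p : E × E × E => N p.1 p.2.1 p.2.2)
    (hNK : ∀ u w v, ‖N u w v‖ ≤ K * ‖v‖) {U : ℝ → E} (hUc : Continuous U) {x y : E}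
    (hU : IsMild P τ x (fun s => F (U s)) U)
    (hy : Tendsto (fun h : ℝ => h⁻¹ • (P h x - x)) (𝓝[>] 0) (𝓝 y)) :
    ∃ V : ℝ → E, Continuous V ∧ ∀ t ∈ Icc 0 τ, U t = x + ∫ s in (0 : ℝ)..t, V s := by
  have hFK : ∀ u v, ‖F u - F v‖ ≤ K * ‖u - v‖ := fun u v => by rw [hFN]; exact hNK _ _ _
  have hFc : Continuous F := (LipschitzWith.of_dist_le_mul (K := ⟨K, hK0⟩) fun u v => by
    rw [dist_eq_norm, dist_eq_norm]; exact hFK u v).continuous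
  have hgc : Continuous fun s => F (U s) := hFc.comp hUc
  have hN : ∀ {X : Type} [TopologicalSpace X] {a b c : X → E}, Continuous a → Continuous b →
      Continuous c → Continuous fun s => N (a s) (b s) (c s) := fun ha hb hc =>
    hNc.comp (ha.prodMk (hb.prodMk hc))
  have hU0 : U 0 = x := by
    have := hU 0 ⟨le_rfl, hτ⟩
    simpa [hP.apply_zero] using this
  obtain ⟨V, hVc, hV⟩ := hP.exists_mild hτ hK0 hKτ (Φ := fun s v => N (U s) (U s) v)
    (hNc.comp ((hUc.comp continuous_fst).prodMk
      ((hUc.comp continuous_fst).prodMk continuous_snd)))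
    (fun s u v => by rw [← map_sub]; exact hNK _ _ _) (y + F x)
  refine ⟨V, hVc, ?_⟩
  -- The right derivative of `U` is `V`.
  have hder : ∀ t ∈ Ico 0 τ, HasDerivWithinAt U (V t) (Ici t) t := by
    intro t ht
    have h0 : Tendsto (fun h : ℝ => h⁻¹ • (U h - x)) (𝓝[>] 0) (𝓝 (y + F x)) := by
      have h1 := hy.add (hP.tendsto_duhamel_div hgc)
      rw [hU0] at h1
      refine h1.congr' ?_
      have h3 : ∀ᶠ h in 𝓝[>] (0 : ℝ), h < τ :=
        nhdsWithin_le_nhds (Iio_mem_nhds (by linarith [ht.1, ht.2]))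
      filter_upwards [self_mem_nhdsWithin, h3] with h hh hhτ
      rw [hU h ⟨le_of_lt hh, hhτ.le⟩, ← smul_add]
      congr 1; abel
    -- `ρ h` bounds the error made in replacing the slope of `F` between `U (s + h)` and `U s` by
    -- its derivative at `U s`.
    let ρ : ℝ → ℝ := fun h => ∫ s in (0 : ℝ)..t,
      ‖N (U (s + h)) (U s) (V s) - N (U s) (U s) (V s)‖
    have hρ : Tendsto ρ (𝓝[>] 0) (𝓝 0) := by
      have h1 : Continuous ρ := by
        refine intervalIntegral.continuous_parametric_intervalIntegral_of_continuous'
          (f := fun h s => ‖N (U (s + h)) (U s) (V s) - N (U s) (U s) (V s)‖) ?_ 0 t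
        exact ((hN (hUc.comp (continuous_snd.add continuous_fst)) (hUc.comp continuous_snd)
          (hVc.comp continuous_snd)).sub (hN (hUc.comp continuous_snd) (hUc.comp continuous_snd)
          (hVc.comp continuous_snd))).norm
      exact (h1.tendsto' 0 0 (by simp [ρ])).mono_left nhdsWithin_le_nhds
    let ε : ℝ → ℝ := fun h => ‖h⁻¹ • (U h - x) - (y + F x)‖ + ρ h
    have hε : Tendsto (fun h => ε h * Real.exp (K * t)) (𝓝[>] 0) (𝓝 0) := by
      have h1 := (tendsto_iff_norm_sub_tendsto_zero.1 h0).add hρ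
      simpa using h1.mul_const (Real.exp (K * t))
    have hlim : Tendsto (fun h : ℝ => h⁻¹ • (U (t + h) - U t)) (𝓝[>] 0) (𝓝 (V t)) := by
      rw [tendsto_iff_norm_sub_tendsto_zero]
      refine squeeze_zero' (Eventually.of_forall fun _ => norm_nonneg _) ?_ hε
      have h3 : ∀ᶠ h in 𝓝[>] (0 : ℝ), h < τ - t :=
        nhdsWithin_le_nhds (Iio_mem_nhds (by linarith [ht.2]))
      filter_upwards [self_mem_nhdsWithin, h3] with h hh hhτ
      have hh' : 0 < h := hh
      -- Gronwall's inequality for the error `w` of the difference quotient on `[0,t]`.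
      let w : ℝ → E := fun s => h⁻¹ • (U (s + h) - U s) - V s
      have hUh : Continuous fun s => U (s + h) := hUc.comp (by fun_prop)
      have hwc : Continuous w := by fun_prop
      refine le_mul_exp_of_le_integral (a := fun s => ‖w s‖) ht.1 hK0 hwc.norm.continuousOn ?_
      intro s hs
      have hsτ : s + h ≤ τ := by linarith [hs.2]
      have hA : U (s + h) = P s (U h) + ∫ σ in (0 : ℝ)..s, P (s - σ) (F (U (σ + h))) :=
        hP.mild_restart hgc.continuousOn hU hh'.le hs.1 hsτ
      have hB := hU s ⟨hs.1, by linarith⟩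
      have hC := hV s ⟨hs.1, by linarith⟩
      have i1 : IntervalIntegrable (fun σ => P (s - σ) (F (U (σ + h)))) volume 0 s :=
        (hP.comp_continuous (by fun_prop) (hFc.comp hUh)).intervalIntegrable _ _
      have i2 : IntervalIntegrable (fun σ => P (s - σ) (F (U σ))) volume 0 s :=
        (hP.comp_continuous (by fun_prop) hgc).intervalIntegrable _ _
      have i3 : IntervalIntegrable (fun σ => P (s - σ) (N (U σ) (U σ) (V σ))) volume 0 s :=
        (hP.comp_continuous (by fun_prop) (hN hUc hUc hVc)).intervalIntegrable _ _
      have hw : w s = P s (h⁻¹ • (U h - x) - (y + F x)) + ∫ σ in (0 : ℝ)..s,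
          (h⁻¹ • (P (s - σ) (F (U (σ + h))) - P (s - σ) (F (U σ))) -
            P (s - σ) (N (U σ) (U σ) (V σ))) := by
        have i4 : IntervalIntegrable (fun σ => h⁻¹ • (P (s - σ) (F (U (σ + h))) -
            P (s - σ) (F (U σ)))) volume 0 s := (i1.sub i2).smul _
        rw [intervalIntegral.integral_sub i4 i3, intervalIntegral.integral_smul,
          intervalIntegral.integral_sub i1 i2]
        simp only [w]
        rw [hA, hC, hB, map_sub, map_smul, map_sub, smul_sub, smul_sub, smul_sub, smul_add,
          smul_add]
        abel
      rw [hw]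
      refine (norm_add_le _ _).trans ?_
      have j1 : Continuous fun σ => ‖N (U (σ + h)) (U σ) (V σ) - N (U σ) (U σ) (V σ)‖ :=
        ((hN hUh hUc hVc).sub (hN hUc hUc hVc)).norm
      have hI : ‖∫ σ in (0 : ℝ)..s, (h⁻¹ • (P (s - σ) (F (U (σ + h))) - P (s - σ) (F (U σ))) -
            P (s - σ) (N (U σ) (U σ) (V σ)))‖ ≤ ∫ σ in (0 : ℝ)..s,
            (‖N (U (σ + h)) (U σ) (V σ) - N (U σ) (U σ) (V σ)‖ + K * ‖w σ‖) := by
        refine intervalIntegral.norm_integral_le_of_norm_le hs.1 (ae_of_all _ fun σ _ => ?_)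
          ((j1.add (hwc.norm.const_mul K)).intervalIntegrable _ _)
        have e1 : h⁻¹ • (P (s - σ) (F (U (σ + h))) - P (s - σ) (F (U σ))) -
            P (s - σ) (N (U σ) (U σ) (V σ)) =
            P (s - σ) ((N (U (σ + h)) (U σ) (V σ) - N (U σ) (U σ) (V σ)) +
              N (U (σ + h)) (U σ) (w σ)) := by
          rw [← map_sub, hFN, ← map_smul, ← map_smul, ← map_sub]
          congr 1
          simp only [w, map_sub]
          abel
        rw [e1]
        exact (hP.norm_le _ _).trans ((norm_add_le _ _).trans (by gcongr; exact hNK _ _ _))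
      rw [intervalIntegral.integral_add (j1.intervalIntegrable _ _)
        ((hwc.norm.const_mul K).intervalIntegrable _ _),
        intervalIntegral.integral_const_mul] at hI
      have hρs : ∫ σ in (0 : ℝ)..s, ‖N (U (σ + h)) (U σ) (V σ) - N (U σ) (U σ) (V σ)‖ ≤ ρ h := by
        refine intervalIntegral.integral_mono_interval le_rfl hs.1 hs.2
          (ae_of_all _ fun _ => norm_nonneg _) (j1.intervalIntegrable _ _)
      have := hP.norm_le s (h⁻¹ • (U h - x) - (y + F x))
      simp only [ε]
      linarith
    rw [hasDerivWithinAt_iff_tendsto_slope]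
    have h3 : Tendsto (fun r : ℝ => r - t) (𝓝[Ici t \ {t}] t) (𝓝[>] 0) := by
      refine tendsto_nhdsWithin_iff.2 ⟨?_, ?_⟩
      · exact ((continuous_id.sub continuous_const).tendsto' t 0 (by simp)).mono_left
          nhdsWithin_le_nhds
      · filter_upwards [self_mem_nhdsWithin] with r hr
        exact sub_pos.2 (lt_of_le_of_ne hr.1 (Ne.symm hr.2))
    refine (hlim.comp h3).congr fun r => ?_
    simp [slope_def_module]
  intro t ht
  have hz := constant_of_has_deriv_right_zero
    (f := fun t => U t - ∫ s in (0 : ℝ)..t, V s) (a := 0) (b := τ)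
    (hUc.sub (intervalIntegral.continuous_primitive (fun _ _ => hVc.intervalIntegrable _ _)
      0)).continuousOn
    (fun r hr => by
      simpa [Pi.sub_def] using (hder r hr).sub
        ((hVc.integral_hasStrictDerivAt 0 r).hasDerivAt.hasDerivWithinAt (s := Ici r))) t ht
  simp only [intervalIntegral.integral_same, sub_zero, hU0] at hz
  rw [← hz]; abel

end IsContractionSemigroup
end Semigroup

/-! ### Translations and averages of translates in `L¹` -/

/-- The Banach space `L¹(ℝ^N)`. -/
abbrev L1 (d : ℕ) : Type := Lp ℝ 1 (volume : Measure (Space d))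

variable {d : ℕ}

/-- The translate `x ↦ f(y + x)` of an integrable function. -/
def translate (y : Space d) (f : L1 d) : L1 d := DomAddAct.mk y +ᵥ f

lemma coeFn_translate (y : Space d) (f : L1 d) : translate y f =ᵐ[volume] fun x => f (y + x) :=
  DomAddAct.vadd_Lp_ae_eq (DomAddAct.mk y) f

lemma norm_translate (y : Space d) (f : L1 d) : ‖translate y f‖ = ‖f‖ :=
  DomAddAct.norm_vadd_Lp _ f

lemma translate_add (y : Space d) (f g : L1 d) :
    translate y (f + g) = translate y f + translate y g :=
  DomAddAct.vadd_Lp_add _ f g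

lemma translate_smul (y : Space d) (c : ℝ) (f : L1 d) :
    translate y (c • f) = c • translate y f := by
  ext1
  have h1 := (measurePreserving_add_left (volume : Measure (Space d)) y).quasiMeasurePreserving.ae_eq_comp
    (Lp.coeFn_smul c f)
  filter_upwards [coeFn_translate y (c • f), Lp.coeFn_smul c (translate y f), coeFn_translate y f,
    h1] with x h2 h3 h4 h5
  rw [h2, h3, Pi.smul_apply, h4]
  exact h5

lemma continuous_translate (f : L1 d) : Continuous fun y => translate y f := by
  unfold translate
  have : Fact ((1 : ℝ≥0∞) ≠ ⊤) := ⟨ENNReal.one_ne_top⟩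
  have : Continuous fun y : Space d => DomAddAct.mk y := DomAddAct.continuous_mk
  exact this.vadd continuous_const

lemma translate_zero (f : L1 d) : translate 0 f = f := by
  ext1
  filter_upwards [coeFn_translate 0 f] with x hx
  rw [hx, zero_add]

/-- The average of the translates of `f` with respect to a probability measure `μ`, that is, the
convolution of `f` with the reflection of `μ`. -/
def average (μ : ProbabilityMeasure (Space d)) : L1 d →L[ℝ] L1 d :=
  LinearMap.mkContinuous
    { toFun := fun f => ∫ y, translate y f ∂(μ : Measure (Space d))
      map_add' := fun f g => by
        simp_rw [translate_add]
        have h : ∀ f : L1 d, Integrable (fun y => translate y f) (μ : Measure (Space d)) :=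
          fun f => Integrable.of_bound (continuous_translate f).aestronglyMeasurable ‖f‖
            (ae_of_all _ fun y => (norm_translate y f).le)
        exact integral_add (h f) (h g)
      map_smul' := fun c f => by
        simp_rw [translate_smul, integral_smul, RingHom.id_apply] }
    1 fun f => by
      have := norm_integral_le_of_norm_le_const (μ := (μ : Measure (Space d)))
        (ae_of_all _ fun y => (norm_translate y f).le)
      simpa using this

lemma average_apply (μ : ProbabilityMeasure (Space d)) (f : L1 d) :
    average μ f = ∫ y, translate y f ∂(μ : Measure (Space d)) := rfl

lemma integrable_translate (μ : ProbabilityMeasure (Space d)) (f : L1 d) :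
    Integrable (fun y => translate y f) (μ : Measure (Space d)) :=
  Integrable.of_bound (continuous_translate f).aestronglyMeasurable ‖f‖
    (ae_of_all _ fun y => (norm_translate y f).le)

lemma norm_average_le (μ : ProbabilityMeasure (Space d)) (f : L1 d) : ‖average μ f‖ ≤ ‖f‖ := by
  have := norm_integral_le_of_norm_le_const (μ := (μ : Measure (Space d)))
    (ae_of_all _ fun y => (norm_translate y f).le)
  simpa [average_apply] using this

/-! ### The pairing of integrable and bounded continuous functions -/

lemma integrable_mul_bcf (f : L1 d) (φ : Space d →ᵇ ℝ) : Integrable fun x => f x * φ x :=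
  (L1.integrable_coeFn f).mul_bdd (c := ‖φ‖) φ.continuous.aestronglyMeasurable
    (ae_of_all _ fun x => φ.norm_coe_le_norm x)

/-- The pairing `⟨f, φ⟩ = ∫ f φ` of `f ∈ L¹` and `φ ∈ C_b`. -/
def pair : L1 d →L[ℝ] (Space d →ᵇ ℝ) →L[ℝ] ℝ :=
  LinearMap.mkContinuous₂
    (LinearMap.mk₂ ℝ (fun (f : L1 d) (φ : Space d →ᵇ ℝ) => ∫ x, f x * φ x)
      (fun f g φ => by
        rw [← integral_add (integrable_mul_bcf f φ) (integrable_mul_bcf g φ)]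
        refine integral_congr_ae ?_
        filter_upwards [Lp.coeFn_add f g] with x hx
        rw [hx, Pi.add_apply, add_mul])
      (fun c f φ => by
        rw [← integral_smul]
        refine integral_congr_ae ?_
        filter_upwards [Lp.coeFn_smul c f] with x hx
        rw [hx, Pi.smul_apply, smul_mul_assoc])
      (fun f φ ψ => by
        rw [← integral_add (integrable_mul_bcf f φ) (integrable_mul_bcf f ψ)]
        simp [mul_add])
      (fun c f φ => by
        rw [← integral_smul]
        simp [mul_left_comm]))
    1 fun f φ => by
      rw [one_mul, L1.norm_eq_integral_norm, ← integral_mul_const]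
      refine norm_integral_le_of_norm_le ((L1.integrable_coeFn f).norm.mul_const _)
        (ae_of_all _ fun x => ?_)
      rw [norm_mul]
      gcongr
      exact φ.norm_coe_le_norm x

lemma pair_apply (f : L1 d) (φ : Space d →ᵇ ℝ) : pair f φ = ∫ x, f x * φ x := rfl

/-- Schwartz functions separate the points of `L¹`. -/
lemma eq_of_pair_schwartz {f g : L1 d}
    (h : ∀ ψ : 𝓢(Space d, ℝ), pair f ψ.toBoundedContinuousFunction =
      pair g ψ.toBoundedContinuousFunction) : f = g := by
  ext1
  refine ae_eq_of_integral_contDiff_smul_eq (L1.integrable_coeFn f).locallyIntegrable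
    (L1.integrable_coeFn g).locallyIntegrable fun ψ hψ hc => ?_
  have := h (hc.toSchwartzMap hψ)
  simp only [pair_apply] at this
  simp only [smul_eq_mul, mul_comm (ψ _)]
  exact this

/-- The translate `x ↦ φ(x - y)` of a bounded continuous function. -/
def shift (y : Space d) (φ : Space d →ᵇ ℝ) : Space d →ᵇ ℝ :=
  φ.compContinuous ⟨fun x => x - y, by fun_prop⟩

lemma shift_apply (y : Space d) (φ : Space d →ᵇ ℝ) (x : Space d) : shift y φ x = φ (x - y) := rfl

lemma pair_translate (y : Space d) (f : L1 d) (φ : Space d →ᵇ ℝ) :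
    pair (translate y f) φ = pair f (shift y φ) := by
  rw [pair_apply, pair_apply, ← integral_add_left_eq_self (fun x => f x * shift y φ x) y]
  refine integral_congr_ae ?_
  filter_upwards [coeFn_translate y f] with x hx
  rw [hx, shift_apply, add_sub_cancel_left]

/-- The convolution `x ↦ ∫ φ(x - y) dμ(y)` of a bounded continuous function with `μ`. -/
def bcfConv (μ : ProbabilityMeasure (Space d)) (φ : Space d →ᵇ ℝ) : Space d →ᵇ ℝ :=
  BoundedContinuousFunction.ofNormedAddCommGroup
    (fun x => ∫ y, φ (x - y) ∂(μ : Measure (Space d)))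
    (continuous_of_dominated (bound := fun _ => ‖φ‖)
      (fun x => (φ.continuous.comp (by fun_prop)).aestronglyMeasurable)
      (fun x => ae_of_all _ fun y => φ.norm_coe_le_norm _) (integrable_const _)
      (ae_of_all _ fun y => φ.continuous.comp (by fun_prop)))
    ‖φ‖ fun x => by
      have := norm_integral_le_of_norm_le_const (μ := (μ : Measure (Space d)))
        (ae_of_all _ fun y => φ.norm_coe_le_norm (x - y))
      simpa using this

lemma bcfConv_apply (μ : ProbabilityMeasure (Space d)) (φ : Space d →ᵇ ℝ) (x : Space d) :
    bcfConv μ φ x = ∫ y, φ (x - y) ∂(μ : Measure (Space d)) := rfl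

lemma norm_bcfConv_apply_le (μ : ProbabilityMeasure (Space d)) (φ : Space d →ᵇ ℝ) (x : Space d) :
    ‖bcfConv μ φ x‖ ≤ ‖φ‖ := by
  have := norm_integral_le_of_norm_le_const (μ := (μ : Measure (Space d)))
    (ae_of_all _ fun y => φ.norm_coe_le_norm (x - y))
  simpa [bcfConv_apply] using this

lemma pair_average (μ : ProbabilityMeasure (Space d)) (f : L1 d) (φ : Space d →ᵇ ℝ) :
    pair (average μ f) φ = pair f (bcfConv μ φ) := by
  have h1 : pair (average μ f) φ = ∫ y, pair (translate y f) φ ∂(μ : Measure (Space d)) := by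
    have := (pair.flip φ).integral_comp_comm (integrable_translate μ f)
    simpa [average_apply] using this.symm
  rw [h1, pair_apply]
  simp_rw [pair_translate, pair_apply, shift_apply, bcfConv_apply, ← integral_const_mul]
  refine integral_integral_swap ?_
  have h2 : Integrable (fun p : Space d × Space d => f p.2)
      ((μ : Measure (Space d)).prod volume) :=
    (L1.integrable_coeFn f).comp_snd _
  refine h2.mul_bdd (c := ‖φ‖) ?_ (ae_of_all _ fun p => φ.norm_coe_le_norm _)
  exact (φ.continuous.comp (by fun_prop)).aestronglyMeasurable

/-! ### Bounded elements of `L¹` -/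

/-- The integrable functions bounded by `M`. -/
def boundedBy (d : ℕ) (M : ℝ) : Set (L1 d) := {f | ∀ᵐ x, |f x| ≤ M}

lemma isClosed_boundedBy (M : ℝ) : IsClosed (boundedBy d M) := by
  refine isClosed_of_closure_subset fun f hf => ?_
  obtain ⟨u, hu, hlim⟩ := mem_closure_iff_seq_limit.1 hf
  obtain ⟨ns, -, hns⟩ := (tendstoInMeasure_of_tendsto_Lp hlim).exists_seq_tendsto_ae
  have h1 : ∀ᵐ x, ∀ n, |u n x| ≤ M := ae_all_iff.2 hu
  filter_upwards [hns, h1] with x h2 h3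
  exact le_of_tendsto' h2.abs fun n => h3 _

lemma convex_boundedBy (M : ℝ) : Convex ℝ (boundedBy d M) := by
  intro f hf g hg a b ha hb hab
  filter_upwards [hf, hg, Lp.coeFn_add (a • f) (b • g), Lp.coeFn_smul a f, Lp.coeFn_smul b g]
    with x h1 h2 h3 h4 h5
  rw [h3, Pi.add_apply, h4, h5, Pi.smul_apply, Pi.smul_apply, smul_eq_mul, smul_eq_mul]
  calc |a * f x + b * g x| ≤ a * |f x| + b * |g x| := by
        refine (abs_add_le _ _).trans_eq ?_
        rw [abs_mul, abs_mul, abs_of_nonneg ha, abs_of_nonneg hb]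
    _ ≤ a * M + b * M := by gcongr
    _ = M := by rw [← add_mul, hab, one_mul]

lemma translate_mem_boundedBy {M : ℝ} {f : L1 d} (hf : f ∈ boundedBy d M) (y : Space d) :
    translate y f ∈ boundedBy d M := by
  have h1 : ∀ᵐ x, |f (y + x)| ≤ M :=
    (measurePreserving_add_left (volume : Measure (Space d)) y).quasiMeasurePreserving.ae hf
  filter_upwards [coeFn_translate y f, h1] with x h2 h3
  rwa [h2]

lemma average_mem_boundedBy (μ : ProbabilityMeasure (Space d)) {M : ℝ} {f : L1 d}
    (hf : f ∈ boundedBy d M) : average μ f ∈ boundedBy d M :=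
  (convex_boundedBy M).integral_mem (isClosed_boundedBy M)
    (ae_of_all _ fun y => translate_mem_boundedBy hf y) (integrable_translate μ f)

lemma add_mem_boundedBy {M M' : ℝ} {f g : L1 d} (hf : f ∈ boundedBy d M)
    (hg : g ∈ boundedBy d M') : f + g ∈ boundedBy d (M + M') := by
  filter_upwards [hf, hg, Lp.coeFn_add f g] with x h1 h2 h3
  rw [h3]
  exact (abs_add_le _ _).trans (add_le_add h1 h2)

lemma smul_mem_boundedBy {M c : ℝ} (hc : 0 ≤ c) {f : L1 d} (hf : f ∈ boundedBy d M) :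
    c • f ∈ boundedBy d (c * M) := by
  filter_upwards [hf, Lp.coeFn_smul c f] with x h1 h3
  rw [h3, Pi.smul_apply, smul_eq_mul, abs_mul, abs_of_nonneg hc]
  gcongr

lemma boundedBy_mono {M M' : ℝ} (h : M ≤ M') : boundedBy d M ⊆ boundedBy d M' :=
  fun f (hf : ∀ᵐ x, |f x| ≤ M) => hf.mono fun _ hx => hx.trans h

lemma integral_mem_boundedBy {M t : ℝ} (ht : 0 ≤ t) {g : ℝ → L1 d} (hg : Continuous g)
    (hM : ∀ s, g s ∈ boundedBy d M) : ∫ s in (0 : ℝ)..t, g s ∈ boundedBy d (t * M) := by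
  have h1 := intervalIntegral.smul_integral_comp_mul_left (a := 0) (b := 1) g t
  rw [mul_zero, mul_one] at h1
  rw [← h1]
  refine smul_mem_boundedBy ht ?_
  rw [intervalIntegral.integral_of_le zero_le_one]
  have : IsProbabilityMeasure (volume.restrict (Ioc (0 : ℝ) 1)) := ⟨by simp⟩
  refine (convex_boundedBy M).integral_mem (isClosed_boundedBy M) (ae_of_all _ fun s => hM _) ?_
  exact (((hg.comp (by fun_prop)).integrableOn_Icc (a := 0) (b := 1)).mono_set Ioc_subset_Icc_self)

/-! ### The reflection in the last coordinate -/

/-- The reflection `flipLast` as a linear isometry. -/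
def flipLastIsometry (d : ℕ) : Space d ≃ₗᵢ[ℝ] Space d :=
  LinearIsometryEquiv.piLpCongrRight 2 fun i =>
    if i = Fin.last d then LinearIsometryEquiv.neg ℝ else LinearIsometryEquiv.refl ℝ ℝ

lemma flipLastIsometry_apply (x : Space d) : flipLastIsometry d x = flipLast x := by
  ext i
  simp only [flipLastIsometry, flipLast, LinearIsometryEquiv.piLpCongrRight_apply]
  split_ifs <;> simp

lemma coe_flipLastIsometry : ⇑(flipLastIsometry d) = flipLast := funext flipLastIsometry_apply

lemma continuous_flipLast : Continuous (flipLast (d := d)) :=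
  coe_flipLastIsometry (d := d) ▸ (flipLastIsometry d).continuous

lemma measurePreserving_flipLast :
    MeasurePreserving (flipLast (d := d)) (volume : Measure (Space d)) volume :=
  coe_flipLastIsometry (d := d) ▸ (flipLastIsometry d).measurePreserving

lemma flipLast_flipLast (x : Space d) : flipLast (flipLast x) = x := by
  ext i
  simp only [flipLast]
  split_ifs <;> simp

lemma flipLast_add (x y : Space d) : flipLast (x + y) = flipLast x + flipLast y := by
  simp only [← flipLastIsometry_apply, map_add]

lemma lastCoord_flipLast (x : Space d) : lastCoord (flipLast x) = -lastCoord x := by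
  simp [lastCoord, flipLast]

lemma continuous_lastCoord : Continuous (lastCoord (d := d)) := by
  unfold lastCoord; fun_prop

/-- The operator `f ↦ f ∘ flipLast` on `L¹`. -/
def reflect (d : ℕ) : L1 d →L[ℝ] L1 d :=
  (Lp.compMeasurePreservingₗᵢ ℝ flipLast measurePreserving_flipLast).toContinuousLinearMap

lemma coeFn_reflect (f : L1 d) : reflect d f =ᵐ[volume] fun x => f (flipLast x) :=
  Lp.coeFn_compMeasurePreserving f measurePreserving_flipLast

lemma reflect_translate (y : Space d) (f : L1 d) :
    reflect d (translate y f) = translate (flipLast y) (reflect d f) := by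
  ext1
  have h1 := measurePreserving_flipLast.quasiMeasurePreserving.ae_eq_comp (coeFn_translate y f)
  have h2 := (measurePreserving_add_left (volume : Measure (Space d))
    (flipLast y)).quasiMeasurePreserving.ae_eq_comp (coeFn_reflect f)
  filter_upwards [coeFn_reflect (translate y f), coeFn_translate (flipLast y) (reflect d f), h1, h2]
    with x h3 h4 h5 h6
  rw [h3, h4]
  simp only [Function.comp_apply] at h5 h6
  rw [h5, h6, flipLast_add, flipLast_flipLast]

lemma reflect_average {μ : ProbabilityMeasure (Space d)}
    (hμ : (μ : Measure (Space d)).map flipLast = μ) (f : L1 d) :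
    reflect d (average μ f) = average μ (reflect d f) := by
  rw [average_apply, average_apply, ← ContinuousLinearMap.integral_comp_comm _
    (integrable_translate μ f)]
  conv_rhs => rw [← hμ]
  rw [integral_map continuous_flipLast.aemeasurable
    (continuous_translate _).aestronglyMeasurable]
  simp_rw [reflect_translate]

/-! ### The diffusion semigroup and its generator -/

lemma flipLast_flipFirst (x : Space d) : flipLast (flipFirst x) = -x := by
  ext i
  simp only [flipLast, flipFirst, PiLp.neg_apply]
  split_ifs <;> simp

lemma flipFirst_flipFirst (x : Space d) : flipFirst (flipFirst x) = x := by
  ext i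
  simp only [flipFirst]
  split_ifs <;> simp

lemma flipFirst_eq (x : Space d) : flipFirst x = -flipLast x := by
  rw [← flipLast_flipLast (flipFirst x), flipLast_flipFirst, ← flipLastIsometry_apply, map_neg,
    flipLastIsometry_apply]

lemma continuous_flipFirst : Continuous (flipFirst (d := d)) := by
  rw [funext (flipFirst_eq (d := d))]
  exact continuous_flipLast.neg

lemma IsEvenMeasure.map_eq {σ : Space d → Space d} (hσ : Continuous σ) (hσσ : ∀ x, σ (σ x) = x)
    {μ : Measure (Space d)} [IsFiniteMeasure μ] (hμ : IsEvenMeasure σ μ) : μ.map σ = μ := by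
  refine ext_of_forall_integral_eq_of_IsFiniteMeasure fun φ => ?_
  rw [integral_map hσ.aemeasurable φ.continuous.aestronglyMeasurable]
  let φσ : Space d →ᵇ ℝ := φ.compContinuous ⟨σ, hσ⟩
  have h := hμ (φ - φσ) fun x => by simp [φσ, hσσ]
  have h2 : ∫ x, (φ - φσ) x ∂μ = ∫ x, φ x ∂μ - ∫ x, φσ x ∂μ :=
    integral_sub (φ.integrable μ) (φσ.integrable μ)
  rw [h2] at h
  exact (sub_eq_zero.1 h).symm

section Kernel

variable {J₀ : Space d → ℝ} {G : ℝ → ProbabilityMeasure (Space d)}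

lemma IsKernel.map_flipLast (hG : IsKernel J₀ G) {t : ℝ} (ht : 0 < t) :
    (G t : Measure (Space d)).map flipLast = G t :=
  (hG.even_last t ht).map_eq continuous_flipLast flipLast_flipLast

lemma IsKernel.map_neg (hG : IsKernel J₀ G) {t : ℝ} (ht : 0 < t) :
    (G t : Measure (Space d)).map Neg.neg = G t := by
  have h1 : (Neg.neg : Space d → Space d) = flipLast ∘ flipFirst :=
    funext fun x => (flipLast_flipFirst x).symm
  rw [h1, ← Measure.map_map continuous_flipLast.measurable continuous_flipFirst.measurable,
    (hG.even_first t ht).map_eq continuous_flipFirst flipFirst_flipFirst, hG.map_flipLast ht]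

lemma IsKernel.integral_add_eq (hG : IsKernel J₀ G) {t : ℝ} (ht : 0 < t) (φ : Space d →ᵇ ℝ)
    (z : Space d) : ∫ y, φ (y + z) ∂(G t : Measure (Space d)) = bcfConv (G t) φ z := by
  rw [bcfConv_apply]
  conv_lhs => rw [← hG.map_neg ht]
  have h : Continuous fun y => φ (y + z) := φ.continuous.comp (by fun_prop)
  rw [integral_map continuous_neg.aemeasurable h.aestronglyMeasurable]
  simp_rw [neg_add_eq_sub]

lemma IsKernel.charFun_eq (hG : IsKernel J₀ G) {t : ℝ} (ht : 0 < t) (ξ : Space d) :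
    charFun (G t : Measure (Space d)) ξ = Complex.exp (((t * (J₀ (-ξ) - 1) : ℝ) : ℂ)) := by
  rw [← hG.fourier t ht (-ξ), charFun_apply]
  congr 1
  ext x
  simp [mul_comm]

/-- The measures `G(t)` form a convolution semigroup, because their characteristic functions
multiply. -/
lemma IsKernel.conv_eq (hG : IsKernel J₀ G) {s t : ℝ} (hs : 0 < s) (ht : 0 < t) :
    (G s : Measure (Space d)).conv (G t : Measure (Space d)) = G (s + t) := by
  refine Measure.ext_of_charFun (funext fun ξ => ?_)
  rw [charFun_conv, hG.charFun_eq hs, hG.charFun_eq ht, hG.charFun_eq (add_pos hs ht),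
    ← Complex.exp_add]
  push_cast
  ring_nf

lemma IsKernel.bcfConv_bcfConv (hG : IsKernel J₀ G) {s t : ℝ} (hs : 0 < s) (ht : 0 < t)
    (φ : Space d →ᵇ ℝ) : bcfConv (G s) (bcfConv (G t) φ) = bcfConv (G (s + t)) φ := by
  ext x
  simp only [bcfConv_apply]
  rw [← hG.conv_eq hs ht, integral_conv]
  · simp_rw [sub_sub]
  · exact Integrable.of_bound (φ.continuous.comp (by fun_prop)).aestronglyMeasurable ‖φ‖
      (ae_of_all _ fun y => φ.norm_coe_le_norm _)

/-- The diffusion semigroup on `L¹`. -/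
def semigroup (G : ℝ → ProbabilityMeasure (Space d)) (t : ℝ) : L1 d →L[ℝ] L1 d :=
  if 0 < t then average (G t) else ContinuousLinearMap.id ℝ _

/-- The diffusion semigroup on bounded continuous functions. -/
def bcfSemigroup (G : ℝ → ProbabilityMeasure (Space d)) (t : ℝ) (φ : Space d →ᵇ ℝ) :
    Space d →ᵇ ℝ :=
  if 0 < t then bcfConv (G t) φ else φ

lemma semigroup_of_pos {t : ℝ} (ht : 0 < t) : semigroup G t = average (G t) := if_pos ht

lemma semigroup_of_nonpos {t : ℝ} (ht : t ≤ 0) (f : L1 d) : semigroup G t f = f := by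
  rw [semigroup, if_neg (not_lt.2 ht)]; rfl

lemma bcfSemigroup_of_pos {t : ℝ} (ht : 0 < t) (φ : Space d →ᵇ ℝ) :
    bcfSemigroup G t φ = bcfConv (G t) φ := if_pos ht

lemma bcfSemigroup_of_nonpos {t : ℝ} (ht : t ≤ 0) (φ : Space d →ᵇ ℝ) : bcfSemigroup G t φ = φ :=
  if_neg (not_lt.2 ht)

lemma pair_semigroup (t : ℝ) (f : L1 d) (φ : Space d →ᵇ ℝ) :
    pair (semigroup G t f) φ = pair f (bcfSemigroup G t φ) := by
  by_cases ht : 0 < t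
  · rw [semigroup_of_pos ht, bcfSemigroup_of_pos ht, pair_average]
  · rw [semigroup_of_nonpos (not_lt.1 ht), bcfSemigroup_of_nonpos (not_lt.1 ht)]

lemma norm_bcfSemigroup_apply_le (t : ℝ) (φ : Space d →ᵇ ℝ) (x : Space d) :
    ‖bcfSemigroup G t φ x‖ ≤ ‖φ‖ := by
  by_cases ht : 0 < t
  · rw [bcfSemigroup_of_pos ht]; exact norm_bcfConv_apply_le _ _ _
  · rw [bcfSemigroup_of_nonpos (not_lt.1 ht)]; exact φ.norm_coe_le_norm x

lemma bcfSemigroup_shift (t : ℝ) (y : Space d) (φ : Space d →ᵇ ℝ) :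
    bcfSemigroup G t (shift y φ) = shift y (bcfSemigroup G t φ) := by
  by_cases ht : 0 < t
  · rw [bcfSemigroup_of_pos ht, bcfSemigroup_of_pos ht]
    ext x
    simp only [bcfConv_apply, shift_apply]
    simp_rw [sub_right_comm]
  · rw [bcfSemigroup_of_nonpos (not_lt.1 ht), bcfSemigroup_of_nonpos (not_lt.1 ht)]

lemma semigroup_mem_boundedBy (t : ℝ) {M : ℝ} {f : L1 d} (hf : f ∈ boundedBy d M) :
    semigroup G t f ∈ boundedBy d M := by
  by_cases ht : 0 < t
  · rw [semigroup_of_pos ht]; exact average_mem_boundedBy _ hf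
  · rwa [semigroup_of_nonpos (not_lt.1 ht)]

lemma IsKernel.reflect_semigroup (hG : IsKernel J₀ G) (t : ℝ) (f : L1 d) :
    reflect d (semigroup G t f) = semigroup G t (reflect d f) := by
  by_cases ht : 0 < t
  · rw [semigroup_of_pos ht]; exact reflect_average (hG.map_flipLast ht) f
  · rw [semigroup_of_nonpos (not_lt.1 ht), semigroup_of_nonpos (not_lt.1 ht)]

lemma isTestFunction_const (S : ℝ) (ψ : 𝓢(Space d, ℝ)) :
    IsTestFunction S (fun _ => ψ) (fun _ => 0) where
  deriv t _ := by
    have : slope (fun _ : ℝ => ψ) t = fun _ => 0 := by ext1 s; simp [slope_def_module]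
    rw [this]; exact tendsto_const_nhds
  continuousOn := continuousOn_const

variable {A : 𝓢(Space d, ℝ) →ₗ[ℝ] (Space d →ᵇ ℝ)}

/-- The bounded measure `δ_z`. -/
def diracSigned (z : Space d) : SignedMeasure (Space d) := (Measure.dirac z).toSignedMeasure

lemma toJordanDecomposition_toSignedMeasure (μ : Measure (Space d)) [IsFiniteMeasure μ] :
    μ.toSignedMeasure.toJordanDecomposition =
      { posPart := μ
        negPart := 0
        mutuallySingular := Measure.MutuallySingular.zero_right } := by
  have h : μ.toSignedMeasure = JordanDecomposition.toSignedMeasure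
      { posPart := μ
        negPart := 0
        mutuallySingular := Measure.MutuallySingular.zero_right } := by
    simp [JordanDecomposition.toSignedMeasure]
  conv_lhs => rw [h]
  exact JordanDecomposition.toJordanDecomposition_toSignedMeasure _

lemma convSigned_dirac (μ : ProbabilityMeasure (Space d)) (z : Space d) :
    convSigned μ (diracSigned z) =
      ((μ : Measure (Space d)).conv (Measure.dirac z)).toSignedMeasure := by
  have h1 : (diracSigned z).toJordanDecomposition.posPart = Measure.dirac z := by
    rw [diracSigned, toJordanDecomposition_toSignedMeasure]
  have h2 : (diracSigned z).toJordanDecomposition.negPart = 0 := by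
    rw [diracSigned, toJordanDecomposition_toSignedMeasure]
  unfold convSigned
  simp only [h1, h2, Measure.conv_zero, Measure.toSignedMeasure_zero, sub_zero]

lemma IsDiffusionOperator.isLinearSolution_dirac (hA : IsDiffusionOperator G A) (z : Space d) :
    IsLinearSolution A (diracSigned z)
      (fun t => if 0 < t then convSigned (G t) (diracSigned z) else diracSigned z) :=
  (hA _ _).2 ⟨if_neg (lt_irrefl 0), fun _ ht => if_pos ht⟩

lemma integral_dirac_solution (hG : IsKernel J₀ G) (z : Space d) (φ : Space d →ᵇ ℝ) (t : ℝ) :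
    ∫ᵛ x, φ x ∂<•(if 0 < t then convSigned (G t) (diracSigned z) else diracSigned z) =
      bcfSemigroup G t φ z := by
  by_cases ht : 0 < t
  · rw [if_pos ht, convSigned_dirac, VectorMeasure.integral_toSignedMeasure,
      bcfSemigroup_of_pos ht, ← hG.integral_add_eq ht, integral_conv (φ.integrable _)]
    simp
  · rw [if_neg ht, bcfSemigroup_of_nonpos (not_lt.1 ht), diracSigned,
      VectorMeasure.integral_toSignedMeasure, integral_dirac]

lemma continuous_bcfSemigroup_apply (hG : IsKernel J₀ G) (hA : IsDiffusionOperator G A)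
    (φ : Space d →ᵇ ℝ) (z : Space d) : Continuous fun t => bcfSemigroup G t φ z := by
  have h1 := (hA.isLinearSolution_dirac z).continuousOn φ
  simp only [integral_dirac_solution hG] at h1
  have h2 : (fun t => bcfSemigroup G t φ z) = (fun t => bcfSemigroup G (max t 0) φ z) := by
    ext t
    rcases le_total t 0 with ht | ht
    · rw [max_eq_right ht, bcfSemigroup_of_nonpos ht, bcfSemigroup_of_nonpos le_rfl]
    · rw [max_eq_left ht]
  rw [h2]
  exact h1.comp_continuous (by fun_prop) fun t => mem_Ici.2 (le_max_right _ _)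

/-- On test functions, `G(t) * ψ - ψ` is the time integral of `G(s) * Aψ`: this is the weak
equation for the solution issued from `δ_z`, tested against a time-independent function. -/
lemma integral_bcfSemigroup (hG : IsKernel J₀ G) (hA : IsDiffusionOperator G A)
    (ψ : 𝓢(Space d, ℝ)) (z : Space d) {S : ℝ} (hS : 0 < S) :
    ∫ t in (0 : ℝ)..S, bcfSemigroup G t (A ψ) z =
      bcfSemigroup G S ψ.toBoundedContinuousFunction z - ψ z := by
  have h1 := (hA.isLinearSolution_dirac z).weak S hS _ _ (isTestFunction_const S ψ)
  simp only [zero_apply, zero_add, integral_dirac_solution hG] at h1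
  rw [h1]
  congr 1
  · exact integral_dirac_solution hG z ψ.toBoundedContinuousFunction S
  · rw [diracSigned, VectorMeasure.integral_toSignedMeasure, integral_dirac]

lemma tendsto_bcfSemigroup_div (hG : IsKernel J₀ G) (hA : IsDiffusionOperator G A)
    (ψ : 𝓢(Space d, ℝ)) (z : Space d) :
    Tendsto (fun h : ℝ => h⁻¹ * (bcfSemigroup G h ψ.toBoundedContinuousFunction z - ψ z)) (𝓝[>] 0)
      (𝓝 (A ψ z)) := by
  have h1 := ((continuous_bcfSemigroup_apply hG hA (A ψ) z).integral_hasStrictDerivAt 0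
    0).hasDerivAt
  rw [bcfSemigroup_of_nonpos le_rfl, hasDerivAt_iff_tendsto_slope] at h1
  refine (h1.mono_left (nhdsWithin_mono 0 fun x hx => ne_of_gt hx)).congr' ?_
  filter_upwards [self_mem_nhdsWithin] with h hh
  rw [← integral_bcfSemigroup hG hA ψ z hh]
  simp [slope_def_module]

/-- The operator `A` commutes with translations, since its values are the derivatives at `t = 0` of
the evolution, which commutes with translations. -/
lemma diffusion_shift (hG : IsKernel J₀ G) (hA : IsDiffusionOperator G A)
    (ψ : 𝓢(Space d, ℝ)) (y : Space d) : A (ψ.compSubConstCLM ℝ y) = shift y (A ψ) := by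
  ext z
  have h1 := tendsto_bcfSemigroup_div hG hA (ψ.compSubConstCLM ℝ y) z
  have h2 := tendsto_bcfSemigroup_div hG hA ψ (z - y)
  refine tendsto_nhds_unique h1 (h2.congr fun h => ?_)
  have h3 : (ψ.compSubConstCLM ℝ y).toBoundedContinuousFunction =
      shift y ψ.toBoundedContinuousFunction := rfl
  rw [h3, bcfSemigroup_shift]
  rfl

lemma tendsto_integral_kernel (hG : IsKernel J₀ G) (hA : IsDiffusionOperator G A)
    (φ : Space d →ᵇ ℝ) :
    Tendsto (fun t => ∫ y, φ y ∂(G t : Measure (Space d))) (𝓝[>] 0) (𝓝 (φ 0)) := by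
  have h1 := ((continuous_bcfSemigroup_apply hG hA φ 0).tendsto 0).mono_left
    (nhdsWithin_le_nhds (s := Ioi 0))
  rw [bcfSemigroup_of_nonpos le_rfl] at h1
  refine h1.congr' ?_
  filter_upwards [self_mem_nhdsWithin] with t ht
  rw [bcfSemigroup_of_pos ht, ← hG.integral_add_eq ht]
  simp

/-- Strong continuity at `0`: the norm of `G(t) * f - f` is at most the integral with respect to
`G(t)` of the bounded continuous function `y ↦ ‖f(· + y) - f‖`, which vanishes at `0`. -/
lemma tendsto_semigroup_zero (hG : IsKernel J₀ G) (hA : IsDiffusionOperator G A) (f : L1 d) :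
    Tendsto (fun t => ‖semigroup G t f - f‖) (𝓝 0) (𝓝 0) := by
  let φ : Space d →ᵇ ℝ := BoundedContinuousFunction.ofNormedAddCommGroup
    (fun y => ‖translate y f - f‖) ((continuous_translate f).sub continuous_const).norm (‖f‖ + ‖f‖)
    fun y => by
      rw [norm_norm]
      exact (norm_sub_le _ _).trans_eq (by rw [norm_translate])
  have h1 : Tendsto (fun t => ‖semigroup G t f - f‖) (𝓝[>] 0) (𝓝 0) := by
    have h2 := tendsto_integral_kernel hG hA φ
    have h3 : φ 0 = 0 := by
      change ‖translate 0 f - f‖ = 0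
      rw [translate_zero, sub_self, norm_zero]
    rw [h3] at h2
    refine squeeze_zero' (Eventually.of_forall fun _ => norm_nonneg _) ?_ h2
    filter_upwards [self_mem_nhdsWithin] with t ht
    rw [semigroup_of_pos ht, average_apply]
    have h4 : ∫ y, translate y f ∂(G t : Measure (Space d)) - f =
        ∫ y, (translate y f - f) ∂(G t : Measure (Space d)) := by
      rw [integral_sub (integrable_translate _ f) (integrable_const _)]
      simp
    rw [h4]
    exact norm_integral_le_integral_norm _
  have h2 : Tendsto (fun t => ‖semigroup G t f - f‖) (𝓝[≤] 0) (𝓝 0) := by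
    refine tendsto_const_nhds.congr' ?_
    filter_upwards [self_mem_nhdsWithin] with t ht
    rw [semigroup_of_nonpos ht, sub_self, norm_zero]
  have := h2.sup h1
  rwa [← nhdsWithin_union, Iic_union_Ioi, nhdsWithin_univ] at this

theorem isContractionSemigroup (hG : IsKernel J₀ G) (hA : IsDiffusionOperator G A) :
    IsContractionSemigroup (semigroup G) := by
  have hadd : ∀ s t, 0 ≤ s → 0 ≤ t → ∀ f : L1 d,
      semigroup G (s + t) f = semigroup G s (semigroup G t f) := by
    intro s t hs ht f
    rcases hs.eq_or_lt with rfl | hs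
    · rw [zero_add, semigroup_of_nonpos (t := 0) le_rfl]
    rcases ht.eq_or_lt with rfl | ht
    · rw [add_zero, semigroup_of_nonpos (t := 0) le_rfl]
    refine eq_of_pair_schwartz fun ψ => ?_
    rw [pair_semigroup, pair_semigroup, pair_semigroup, bcfSemigroup_of_pos hs,
      bcfSemigroup_of_pos ht, bcfSemigroup_of_pos (add_pos hs ht), hG.bcfConv_bcfConv ht hs,
      add_comm t s]
  have hnorm : ∀ t (f : L1 d), ‖semigroup G t f‖ ≤ ‖f‖ := by
    intro t f
    by_cases ht : 0 < t
    · rw [semigroup_of_pos ht]; exact norm_average_le _ _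
    · rw [semigroup_of_nonpos (not_lt.1 ht)]
  refine ⟨fun t ht f => semigroup_of_nonpos ht f, hnorm, hadd, fun f => ?_⟩
  have hmax : ∀ t, semigroup G t f = semigroup G (max t 0) f := by
    intro t
    rcases le_total t 0 with ht | ht
    · rw [max_eq_right ht, semigroup_of_nonpos ht, semigroup_of_nonpos le_rfl]
    · rw [max_eq_left ht]
  have hmono : ∀ s t, 0 ≤ s → s ≤ t →
      ‖semigroup G t f - semigroup G s f‖ ≤ ‖semigroup G (t - s) f - f‖ := by
    intro s t hs hst
    have := hadd s (t - s) hs (sub_nonneg.2 hst) f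
    rw [add_sub_cancel] at this
    rw [this, ← map_sub]
    exact hnorm _ _
  -- Continuity at `s` reduces to continuity at `0` by the contraction property.
  have hbound : ∀ s t, ‖semigroup G t f - semigroup G s f‖ ≤
      ‖semigroup G |max t 0 - max s 0| f - f‖ := by
    intro s t
    rw [hmax t, hmax s]
    rcases le_total (max s 0) (max t 0) with h | h
    · rw [abs_of_nonneg (sub_nonneg.2 h)]
      exact hmono _ _ (le_max_right _ _) h
    · rw [abs_sub_comm, abs_of_nonneg (sub_nonneg.2 h), norm_sub_rev]
      exact hmono _ _ (le_max_right _ _) h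
  rw [continuous_iff_continuousAt]
  intro s
  rw [ContinuousAt, tendsto_iff_norm_sub_tendsto_zero]
  refine squeeze_zero (fun _ => norm_nonneg _) (hbound s) ?_
  have h1 : Tendsto (fun t => |max t 0 - max s 0|) (𝓝 s) (𝓝 0) := by
    have : Continuous fun t => |max t 0 - max s 0| := by fun_prop
    exact this.tendsto' s 0 (by simp)
  exact (tendsto_semigroup_zero hG hA f).comp h1

/-- The pairing with a Schwartz function turns the generator of the semigroup into `A`. -/
lemma tendsto_pair_semigroup_div (hG : IsKernel J₀ G) (hA : IsDiffusionOperator G A)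
    (f : L1 d) (ψ : 𝓢(Space d, ℝ)) :
    Tendsto (fun h : ℝ => h⁻¹ * (pair (semigroup G h f) ψ.toBoundedContinuousFunction -
      pair f ψ.toBoundedContinuousFunction)) (𝓝[>] 0) (𝓝 (pair f (A ψ))) := by
  have h1 : Tendsto (fun h : ℝ => ∫ x, f x *
      (h⁻¹ * (bcfSemigroup G h ψ.toBoundedContinuousFunction x - ψ x))) (𝓝[>] 0)
      (𝓝 (∫ x, f x * A ψ x)) := by
    refine tendsto_integral_filter_of_dominated_convergence (fun x => ‖f x‖ * ‖A ψ‖) ?_ ?_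
      ((L1.integrable_coeFn f).norm.mul_const _) (ae_of_all _ fun x =>
        (tendsto_bcfSemigroup_div hG hA ψ x).const_mul (f x))
    · refine Eventually.of_forall fun h => ?_
      refine (L1.integrable_coeFn f).aestronglyMeasurable.mul ?_
      exact (continuous_const.mul ((BoundedContinuousFunction.continuous _).sub
        ψ.continuous)).aestronglyMeasurable
    · filter_upwards [self_mem_nhdsWithin] with h hh
      refine ae_of_all _ fun x => ?_
      have hh' : 0 < h := hh
      rw [norm_mul, ← integral_bcfSemigroup hG hA ψ x hh, norm_mul, norm_inv,
        Real.norm_of_nonneg hh'.le]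
      have := intervalIntegral.norm_integral_le_of_norm_le_const (a := 0) (b := h)
        fun t _ => norm_bcfSemigroup_apply_le (G := G) t (A ψ) x
      rw [sub_zero, abs_of_pos hh'] at this
      gcongr
      rw [inv_mul_le_iff₀ hh', mul_comm]
      exact this
  refine h1.congr fun h => ?_
  rw [pair_semigroup, pair_apply, pair_apply,
    ← integral_sub (integrable_mul_bcf _ _) (integrable_mul_bcf _ _), ← integral_const_mul]
  refine integral_congr_ae (ae_of_all _ fun x => ?_)
  simp only [SchwartzMap.toBoundedContinuousFunction_apply]
  ring

/-- `(x, y)` is in the weak generator: `y = A x` when tested against Schwartz functions. -/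
def IsWeakGenerator (A : 𝓢(Space d, ℝ) →ₗ[ℝ] (Space d →ᵇ ℝ)) (x y : L1 d) : Prop :=
  ∀ ψ : 𝓢(Space d, ℝ), pair y ψ.toBoundedContinuousFunction = pair x (A ψ)

lemma IsWeakGenerator.map_semigroup (hG : IsKernel J₀ G) (hA : IsDiffusionOperator G A) {x y : L1 d}
    (hxy : IsWeakGenerator A x y) (t : ℝ) :
    IsWeakGenerator A (semigroup G t x) (semigroup G t y) := by
  intro ψ
  by_cases ht : 0 < t
  · have h1 : ∀ (f : L1 d) (φ : Space d →ᵇ ℝ), pair (average (G t) f) φ =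
        ∫ w, pair f (shift w φ) ∂(G t : Measure (Space d)) := by
      intro f φ
      have := (pair.flip φ).integral_comp_comm (integrable_translate (G t) f)
      rw [average_apply, ← ContinuousLinearMap.flip_apply, ← this]
      simp_rw [ContinuousLinearMap.flip_apply, pair_translate]
    rw [semigroup_of_pos ht, h1, h1]
    refine integral_congr_ae (ae_of_all _ fun w => ?_)
    change pair y (shift w ψ.toBoundedContinuousFunction) = pair x (shift w (A ψ))
    rw [← diffusion_shift hG hA]
    exact hxy (ψ.compSubConstCLM ℝ w)
  · rw [semigroup_of_nonpos (not_lt.1 ht), semigroup_of_nonpos (not_lt.1 ht)]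
    exact hxy ψ

/-- The weak generator is contained in the generator of the semigroup on `L¹`. This uses that `A`
commutes with translations, so that the weak equation is preserved by the semigroup. -/
lemma IsWeakGenerator.semigroup_sub_eq (hG : IsKernel J₀ G) (hA : IsDiffusionOperator G A)
    {x y : L1 d} (hxy : IsWeakGenerator A x y) {h : ℝ} (hh : 0 ≤ h) :
    semigroup G h x - x =
      ∫ r in (0 : ℝ)..h, semigroup G r y := by
  have hP := isContractionSemigroup hG hA
  refine eq_of_pair_schwartz fun ψ => ?_
  let ℓ : L1 d →L[ℝ] ℝ := pair.flip ψ.toBoundedContinuousFunction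
  change ℓ _ = ℓ _
  have hyc : Continuous fun r => ℓ (semigroup G r y) :=
    ℓ.continuous.comp (hP.continuous y)
  rw [← ContinuousLinearMap.intervalIntegral_comp_comm _
    ((hP.continuous y).intervalIntegrable _ _)]
  have hz := constant_of_has_deriv_right_zero
    (f := fun t => ℓ (semigroup G t x) -
      ∫ r in (0 : ℝ)..t, ℓ (semigroup G r y)) (a := 0) (b := h)
    ((ℓ.continuous.comp (hP.continuous x)).sub (intervalIntegral.continuous_primitive
      (fun _ _ => hyc.intervalIntegrable _ _) 0)).continuousOn
    (fun r hr => by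
      have h1 : HasDerivWithinAt (fun t => ℓ (semigroup G t x))
          (ℓ (semigroup G r y)) (Ici r) r := by
        rw [hasDerivWithinAt_iff_tendsto_slope]
        have h2 := tendsto_pair_semigroup_div hG hA (semigroup G r x) ψ
        rw [← hxy.map_semigroup hG hA r ψ] at h2
        have h3 : Tendsto (fun s : ℝ => s - r) (𝓝[Ici r \ {r}] r) (𝓝[>] 0) := by
          refine tendsto_nhdsWithin_iff.2 ⟨?_, ?_⟩
          · exact ((continuous_id.sub continuous_const).tendsto' r 0 (by simp)).mono_left
              nhdsWithin_le_nhds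
          · filter_upwards [self_mem_nhdsWithin] with s hs
            exact sub_pos.2 (lt_of_le_of_ne hs.1 (Ne.symm hs.2))
        refine (h2.comp h3).congr' ?_
        filter_upwards [self_mem_nhdsWithin] with s hs
        have h4 : r ≤ s := hs.1
        simp only [Function.comp_apply]
        rw [← hP.add _ _ (sub_nonneg.2 h4) hr.1, sub_add_cancel, slope_def_module, smul_eq_mul]
        rfl
      simpa [Pi.sub_def] using h1.sub
        ((hyc.integral_hasStrictDerivAt 0 r).hasDerivAt.hasDerivWithinAt (s := Ici r)))
    h ⟨hh, le_rfl⟩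
  simp only [intervalIntegral.integral_same, sub_zero, hP.apply_zero] at hz
  rw [map_sub]
  linarith

end Kernel

/-! ### The truncated nonlinearity -/

section Truncation

variable {α R : ℝ}

/-- The derivative `(α+1)|s|^α` of `|s|^α s`, multiplied by the cut-off function which equals `1`
for `|s| ≤ R`, vanishes for `|s| ≥ R + 1`, and is affine in between. -/
def truncDeriv (α R s : ℝ) : ℝ := max 0 (min 1 (R + 1 - |s|)) * ((α + 1) * |s| ^ α)

/-- The truncated nonlinearity: a bounded odd function, of class `C¹` with bounded derivative, which
equals `|r|^α r` for `|r| ≤ R`. -/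
def trunc (α R r : ℝ) : ℝ := ∫ s in (0 : ℝ)..r, truncDeriv α R s

/-- A Lipschitz constant of `trunc α R`. -/
def truncLip (α R : ℝ) : ℝ := (α + 1) * (R + 1) ^ α

/-- The slope of `trunc α R` between `s` and `r`, extended by the derivative for `r = s`. -/
def truncSlope (α R r s : ℝ) : ℝ := ∫ θ in (0 : ℝ)..1, truncDeriv α R ((r - s) * θ + s)

lemma continuous_truncDeriv (hα : 0 < α) : Continuous (truncDeriv α R) := by
  unfold truncDeriv
  have : Continuous fun s : ℝ => |s| ^ α := continuous_abs.rpow_const fun _ => Or.inr hα.le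
  fun_prop

lemma truncDeriv_nonneg (hα : 0 < α) (s : ℝ) : 0 ≤ truncDeriv α R s :=
  mul_nonneg (le_max_left _ _) (mul_nonneg (by linarith) (Real.rpow_nonneg (abs_nonneg s) α))

lemma truncLip_nonneg (hα : 0 < α) (hR : 0 ≤ R) : 0 ≤ truncLip α R :=
  mul_nonneg (by linarith) (Real.rpow_nonneg (by linarith) α)

lemma truncDeriv_eq_zero {s : ℝ} (hs : R + 1 ≤ |s|) : truncDeriv α R s = 0 := by
  rw [truncDeriv, max_eq_left, zero_mul]
  exact (min_le_right _ _).trans (by linarith)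

lemma truncDeriv_le (hα : 0 < α) (hR : 0 ≤ R) (s : ℝ) : truncDeriv α R s ≤ truncLip α R := by
  rcases le_total (R + 1) |s| with h | h
  · rw [truncDeriv_eq_zero h]; exact truncLip_nonneg hα hR
  · have h1 : max 0 (min 1 (R + 1 - |s|)) ≤ 1 := max_le zero_le_one (min_le_left _ _)
    have h2 : |s| ^ α ≤ (R + 1) ^ α := Real.rpow_le_rpow (abs_nonneg s) h hα.le
    have h3 : 0 ≤ (α + 1) * |s| ^ α :=
      mul_nonneg (by linarith) (Real.rpow_nonneg (abs_nonneg s) α)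
    calc truncDeriv α R s ≤ 1 * ((α + 1) * |s| ^ α) := by unfold truncDeriv; gcongr
      _ ≤ truncLip α R := by rw [one_mul]; unfold truncLip; gcongr

lemma trunc_neg (r : ℝ) : trunc α R (-r) = -trunc α R r := by
  have h := intervalIntegral.integral_comp_neg (a := 0) (b := r) (truncDeriv α R)
  have h2 : ∀ s, truncDeriv α R (-s) = truncDeriv α R s := fun s => by simp [truncDeriv]
  simp only [h2, neg_zero] at h
  unfold trunc
  rw [h, ← intervalIntegral.integral_symm]

lemma trunc_zero : trunc α R 0 = 0 := by simp [trunc]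

lemma trunc_of_nonneg (hα : 0 < α) {r : ℝ} (h0 : 0 ≤ r) (hr : r ≤ R) :
    trunc α R r = |r| ^ α * r := by
  have h1 : trunc α R r = ∫ s in (0 : ℝ)..r, (α + 1) * s ^ α := by
    refine intervalIntegral.integral_congr fun s hs => ?_
    rw [uIcc_of_le h0] at hs
    simp only [truncDeriv]
    rw [abs_of_nonneg hs.1, min_eq_left (by linarith [hs.2]), max_eq_right zero_le_one, one_mul]
  rw [h1, intervalIntegral.integral_const_mul, integral_rpow (Or.inl (by linarith)),
    Real.zero_rpow (by linarith), sub_zero, mul_div_cancel₀ _ (by linarith), abs_of_nonneg h0,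
    Real.rpow_add' h0 (by linarith), Real.rpow_one]

lemma trunc_eq (hα : 0 < α) {r : ℝ} (hr : |r| ≤ R) : trunc α R r = |r| ^ α * r := by
  rcases le_total 0 r with h | h
  · exact trunc_of_nonneg hα h ((le_abs_self r).trans hr)
  · have := trunc_of_nonneg (R := R) hα (r := -r) (by linarith) ((neg_le_abs r).trans hr)
    rw [trunc_neg, abs_neg] at this
    linarith

lemma abs_trunc_le (hα : 0 < α) (hR : 0 ≤ R) (r : ℝ) :
    |trunc α R r| ≤ truncLip α R * (R + 1) := by
  have hi : ∀ a b, IntervalIntegrable (truncDeriv α R) volume a b := fun a b =>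
    (continuous_truncDeriv hα).intervalIntegrable _ _
  have hL := truncLip_nonneg hα hR
  have hsmall : ∀ r, 0 ≤ r → r ≤ R + 1 → |trunc α R r| ≤ truncLip α R * (R + 1) := by
    intro r h0 h
    have := intervalIntegral.norm_integral_le_of_norm_le_const (a := 0) (b := r)
      (f := truncDeriv α R) (C := truncLip α R) fun s _ => by
        rw [Real.norm_of_nonneg (truncDeriv_nonneg hα s)]; exact truncDeriv_le hα hR s
    rw [sub_zero, abs_of_nonneg h0] at this
    exact this.trans (by gcongr)
  have hpos : ∀ r, 0 ≤ r → |trunc α R r| ≤ truncLip α R * (R + 1) := by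
    intro r h0
    rcases le_total r (R + 1) with h | h
    · exact hsmall r h0 h
    · have h1 : trunc α R r = trunc α R (R + 1) := by
        unfold trunc
        rw [← intervalIntegral.integral_add_adjacent_intervals (hi 0 (R + 1)) (hi (R + 1) r)]
        have : ∫ s in (R + 1)..r, truncDeriv α R s = ∫ s in (R + 1)..r, (0 : ℝ) := by
          refine intervalIntegral.integral_congr fun s hs => truncDeriv_eq_zero ?_
          rw [uIcc_of_le h] at hs
          exact hs.1.trans (le_abs_self s)
        rw [this]; simp
      rw [h1]
      exact hsmall (R + 1) (by linarith) le_rfl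
  rcases le_total 0 r with h | h
  · exact hpos r h
  · have := hpos (-r) (by linarith)
    rwa [trunc_neg, abs_neg] at this

lemma trunc_sub (hα : 0 < α) (r s : ℝ) :
    trunc α R r - trunc α R s = truncSlope α R r s * (r - s) := by
  have hi : ∀ a b, IntervalIntegrable (truncDeriv α R) volume a b := fun a b =>
    (continuous_truncDeriv hα).intervalIntegrable _ _
  have h := intervalIntegral.smul_integral_comp_mul_add (a := 0) (b := 1) (truncDeriv α R) (r - s) s
  rw [mul_zero, zero_add, mul_one, sub_add_cancel, smul_eq_mul] at h
  rw [truncSlope, mul_comm, h]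
  exact intervalIntegral.integral_interval_sub_left (hi _ _) (hi _ _)

lemma continuous_truncSlope (hα : 0 < α) :
    Continuous fun p : ℝ × ℝ => truncSlope α R p.1 p.2 :=
  intervalIntegral.continuous_parametric_intervalIntegral_of_continuous'
    (f := fun (p : ℝ × ℝ) (θ : ℝ) => truncDeriv α R ((p.1 - p.2) * θ + p.2))
    ((continuous_truncDeriv hα).comp (by fun_prop)) 0 1

lemma abs_truncSlope_le (hα : 0 < α) (hR : 0 ≤ R) (r s : ℝ) :
    |truncSlope α R r s| ≤ truncLip α R := by
  have := intervalIntegral.norm_integral_le_of_norm_le_const (a := 0) (b := 1)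
    (f := fun θ => truncDeriv α R ((r - s) * θ + s)) (C := truncLip α R) fun θ _ => by
      rw [Real.norm_of_nonneg (truncDeriv_nonneg hα _)]; exact truncDeriv_le hα hR _
  rw [sub_zero, abs_one, mul_one] at this
  exact this

lemma lipschitzWith_trunc (hα : 0 < α) (hR : 0 ≤ R) :
    LipschitzWith ⟨truncLip α R, truncLip_nonneg hα hR⟩ (trunc α R) :=
  LipschitzWith.of_dist_le_mul fun r s => by
    rw [Real.dist_eq, Real.dist_eq, trunc_sub hα, abs_mul]
    exact mul_le_mul_of_nonneg_right (abs_truncSlope_le hα hR r s) (abs_nonneg _)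

end Truncation

/-! ### The superposition operator in `L¹` -/

section Superposition

variable {α R : ℝ}

/-- The superposition operator `u ↦ trunc α R ∘ u` on `L¹`. -/
def nonlin (d : ℕ) (hα : 0 < α) (hR : 0 ≤ R) (u : L1 d) : L1 d :=
  (lipschitzWith_trunc hα hR).compLp trunc_zero u

lemma coeFn_nonlin (hα : 0 < α) (hR : 0 ≤ R) (u : L1 d) :
    nonlin d hα hR u =ᵐ[volume] fun x => trunc α R (u x) :=
  (lipschitzWith_trunc hα hR).coeFn_compLp trunc_zero u

lemma coeFn_nonlin_of_mem (hα : 0 < α) (hR : 0 ≤ R) {u : L1 d} (hu : u ∈ boundedBy d R) :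
    nonlin d hα hR u =ᵐ[volume] fun x => |u x| ^ α * u x := by
  filter_upwards [coeFn_nonlin hα hR u, hu] with x h1 h2
  rw [h1, trunc_eq hα h2]

lemma norm_nonlin_sub_le (hα : 0 < α) (hR : 0 ≤ R) (u v : L1 d) :
    ‖nonlin d hα hR u - nonlin d hα hR v‖ ≤ truncLip α R * ‖u - v‖ :=
  (lipschitzWith_trunc hα hR).norm_compLp_sub_le trunc_zero u v

lemma continuous_nonlin (hα : 0 < α) (hR : 0 ≤ R) : Continuous (nonlin d hα hR) :=
  (LipschitzWith.of_dist_le_mul (K := ⟨truncLip α R, truncLip_nonneg hα hR⟩) fun u v => by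
    rw [dist_eq_norm, dist_eq_norm]; exact norm_nonlin_sub_le hα hR u v).continuous

lemma nonlin_mem_boundedBy (hα : 0 < α) (hR : 0 ≤ R) (u : L1 d) :
    nonlin d hα hR u ∈ boundedBy d (truncLip α R * (R + 1)) := by
  filter_upwards [coeFn_nonlin hα hR u] with x h1
  rw [h1]; exact abs_trunc_le hα hR _

lemma nonlin_neg (hα : 0 < α) (hR : 0 ≤ R) (u : L1 d) :
    nonlin d hα hR (-u) = -nonlin d hα hR u := by
  ext1
  filter_upwards [coeFn_nonlin hα hR u, coeFn_nonlin hα hR (-u), Lp.coeFn_neg u,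
    Lp.coeFn_neg (nonlin d hα hR u)] with x h1 h2 h3 h4
  rw [h2, h3, h4, Pi.neg_apply, Pi.neg_apply, h1, trunc_neg]

lemma nonlin_reflect (hα : 0 < α) (hR : 0 ≤ R) (u : L1 d) :
    nonlin d hα hR (reflect d u) = reflect d (nonlin d hα hR u) := by
  ext1
  have h := measurePreserving_flipLast.quasiMeasurePreserving.ae_eq_comp (coeFn_nonlin hα hR u)
  filter_upwards [coeFn_nonlin hα hR (reflect d u), coeFn_reflect u,
    coeFn_reflect (nonlin d hα hR u), h] with x h1 h2 h3 h4
  rw [h1, h2, h3]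
  exact h4.symm

/-- Truncations at different levels agree on bounded functions. -/
lemma nonlin_eq_nonlin (hα : 0 < α) {R' : ℝ} (hR : 0 ≤ R) (hR' : 0 ≤ R') {u : L1 d}
    (hu : u ∈ boundedBy d R) (hu' : u ∈ boundedBy d R') :
    nonlin d hα hR u = nonlin d hα hR' u := by
  ext1
  exact (coeFn_nonlin_of_mem hα hR hu).trans (coeFn_nonlin_of_mem hα hR' hu').symm

/-- The multiplication by a bounded measurable function, as an operator on `L¹`. -/
def mulL1 (m : Space d → ℝ) (C : ℝ) (hm : AEStronglyMeasurable m) (hC : ∀ x, ‖m x‖ ≤ C) :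
    L1 d →L[ℝ] L1 d :=
  LinearMap.mkContinuous
    { toFun := fun v => ((L1.integrable_coeFn v).bdd_mul hm (ae_of_all _ hC)).toL1 _
      map_add' := fun u v => by
        ext1
        filter_upwards [Integrable.coeFn_toL1
            ((L1.integrable_coeFn (u + v)).bdd_mul hm (ae_of_all _ hC)),
          Integrable.coeFn_toL1 ((L1.integrable_coeFn u).bdd_mul hm (ae_of_all _ hC)),
          Integrable.coeFn_toL1 ((L1.integrable_coeFn v).bdd_mul hm (ae_of_all _ hC)),
          Lp.coeFn_add u v, Lp.coeFn_add
            (((L1.integrable_coeFn u).bdd_mul hm (ae_of_all _ hC)).toL1 _)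
            (((L1.integrable_coeFn v).bdd_mul hm (ae_of_all _ hC)).toL1 _)] with x h1 h2 h3 h4 h5
        rw [h1, h5, Pi.add_apply, h2, h3, h4, Pi.add_apply, mul_add]
      map_smul' := fun c v => by
        ext1
        filter_upwards [Integrable.coeFn_toL1
            ((L1.integrable_coeFn (c • v)).bdd_mul hm (ae_of_all _ hC)),
          Integrable.coeFn_toL1 ((L1.integrable_coeFn v).bdd_mul hm (ae_of_all _ hC)),
          Lp.coeFn_smul c v, Lp.coeFn_smul c
            (((L1.integrable_coeFn v).bdd_mul hm (ae_of_all _ hC)).toL1 _)] with x h1 h2 h3 h4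
        rw [h1, RingHom.id_apply, h4, Pi.smul_apply, h2, h3, Pi.smul_apply, mul_smul_comm] }
    C fun v => by
      rw [L1.norm_eq_integral_norm, L1.norm_eq_integral_norm, ← integral_const_mul]
      refine integral_mono_ae (L1.integrable_coeFn _).norm
        ((L1.integrable_coeFn v).norm.const_mul C) ?_
      filter_upwards [Integrable.coeFn_toL1
        ((L1.integrable_coeFn v).bdd_mul hm (ae_of_all _ hC))] with x h1
      change ‖(((L1.integrable_coeFn v).bdd_mul hm (ae_of_all _ hC)).toL1 _ : L1 d) x‖ ≤ C * ‖v x‖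
      rw [h1, norm_mul]
      exact mul_le_mul_of_nonneg_right (hC x) (norm_nonneg _)

lemma coeFn_mulL1 {m : Space d → ℝ} {C : ℝ} (hm : AEStronglyMeasurable m) (hC : ∀ x, ‖m x‖ ≤ C)
    (v : L1 d) : mulL1 m C hm hC v =ᵐ[volume] fun x => m x * v x :=
  Integrable.coeFn_toL1 ((L1.integrable_coeFn v).bdd_mul hm (ae_of_all _ hC))

lemma norm_mulL1_le {m : Space d → ℝ} {C : ℝ} (hm : AEStronglyMeasurable m)
    (hC : ∀ x, ‖m x‖ ≤ C) (v : L1 d) : ‖mulL1 m C hm hC v‖ ≤ C * ‖v‖ := by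
  rw [L1.norm_eq_integral_norm, L1.norm_eq_integral_norm, ← integral_const_mul]
  refine integral_mono_ae (L1.integrable_coeFn _).norm
    ((L1.integrable_coeFn v).norm.const_mul C) ?_
  filter_upwards [coeFn_mulL1 hm hC v] with x h1
  rw [h1, norm_mul]
  exact mul_le_mul_of_nonneg_right (hC x) (norm_nonneg _)

lemma aestronglyMeasurable_truncSlope (hα : 0 < α) (u w : L1 d) :
    AEStronglyMeasurable (fun x => truncSlope α R (u x) (w x)) volume := by
  have h : AEStronglyMeasurable (fun x => (u x, w x)) volume :=
    (L1.integrable_coeFn u).aestronglyMeasurable.prodMk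
      (L1.integrable_coeFn w).aestronglyMeasurable
  have h2 := (continuous_truncSlope (R := R) hα).comp_aestronglyMeasurable h
  simpa only [Function.comp_def] using h2

/-- The multiplication by the slope of the truncated nonlinearity between `w` and `u`. -/
def slopeOp (hα : 0 < α) (hR : 0 ≤ R) (u w : L1 d) : L1 d →L[ℝ] L1 d :=
  mulL1 (fun x => truncSlope α R (u x) (w x)) (truncLip α R)
    (aestronglyMeasurable_truncSlope hα u w) fun _ => abs_truncSlope_le hα hR _ _

lemma coeFn_slopeOp (hα : 0 < α) (hR : 0 ≤ R) (u w v : L1 d) :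
    slopeOp hα hR u w v =ᵐ[volume] fun x => truncSlope α R (u x) (w x) * v x :=
  coeFn_mulL1 _ _ _

lemma norm_slopeOp_le (hα : 0 < α) (hR : 0 ≤ R) (u w v : L1 d) :
    ‖slopeOp hα hR u w v‖ ≤ truncLip α R * ‖v‖ := norm_mulL1_le _ _ _

lemma nonlin_sub (hα : 0 < α) (hR : 0 ≤ R) (u w : L1 d) :
    nonlin d hα hR u - nonlin d hα hR w = slopeOp hα hR u w (u - w) := by
  ext1
  filter_upwards [coeFn_nonlin hα hR u, coeFn_nonlin hα hR w, Lp.coeFn_sub u w,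
    Lp.coeFn_sub (nonlin d hα hR u) (nonlin d hα hR w), coeFn_slopeOp hα hR u w (u - w)]
    with x h1 h2 h3 h4 h5
  rw [h4, h5, Pi.sub_apply, h1, h2, h3, Pi.sub_apply, trunc_sub hα]

lemma tendsto_slopeOp_of_ae (hα : 0 < α) (hR : 0 ≤ R) {u w : ℕ → L1 d} {u₀ w₀ : L1 d}
    (hu : ∀ᵐ x, Tendsto (fun n => u n x) atTop (𝓝 (u₀ x)))
    (hw : ∀ᵐ x, Tendsto (fun n => w n x) atTop (𝓝 (w₀ x))) (v : L1 d) :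
    Tendsto (fun n => slopeOp hα hR (u n) (w n) v) atTop (𝓝 (slopeOp hα hR u₀ w₀ v)) := by
  rw [tendsto_iff_norm_sub_tendsto_zero]
  have h1 : ∀ n, ‖slopeOp hα hR (u n) (w n) v - slopeOp hα hR u₀ w₀ v‖ =
      ∫ x, ‖(truncSlope α R (u n x) (w n x) - truncSlope α R (u₀ x) (w₀ x)) * v x‖ := by
    intro n
    rw [L1.norm_eq_integral_norm]
    refine integral_congr_ae ?_
    filter_upwards [coeFn_slopeOp hα hR (u n) (w n) v, coeFn_slopeOp hα hR u₀ w₀ v,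
      Lp.coeFn_sub (slopeOp hα hR (u n) (w n) v) (slopeOp hα hR u₀ w₀ v)] with x h1 h2 h3
    rw [h3, Pi.sub_apply, h1, h2, sub_mul]
  simp_rw [h1]
  have h2 := tendsto_integral_of_dominated_convergence
    (F := fun n x => ‖(truncSlope α R (u n x) (w n x) - truncSlope α R (u₀ x) (w₀ x)) * v x‖)
    (f := fun _ : Space d => (0 : ℝ)) (μ := volume)
    (fun x => (truncLip α R + truncLip α R) * ‖v x‖)
    (fun n => (((aestronglyMeasurable_truncSlope hα (u n) (w n)).sub
      (aestronglyMeasurable_truncSlope hα u₀ w₀)).mul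
      (L1.integrable_coeFn v).aestronglyMeasurable).norm)
    ((L1.integrable_coeFn v).norm.const_mul _)
    (fun n => ae_of_all _ fun x => by
      rw [norm_norm, norm_mul]
      refine mul_le_mul_of_nonneg_right ?_ (norm_nonneg _)
      exact (norm_sub_le _ _).trans
        (add_le_add (abs_truncSlope_le hα hR _ _) (abs_truncSlope_le hα hR _ _)))
    (by
      filter_upwards [hu, hw] with x h1 h2
      have h3 : Tendsto (fun n => truncSlope α R (u n x) (w n x)) atTop
          (𝓝 (truncSlope α R (u₀ x) (w₀ x))) := by
        have h4 := ((continuous_truncSlope (R := R) hα).tendsto (u₀ x, w₀ x)).comp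
          (h1.prodMk_nhds h2)
        simpa only [Function.comp_def] using h4
      simpa using ((h3.sub_const (truncSlope α R (u₀ x) (w₀ x))).mul_const (v x)).norm)
  simpa using h2

/-- The slope operators are strongly continuous in their parameters. They need not be
continuous in operator norm, since convergence in `L¹` is not uniform convergence. -/
lemma continuous_slopeOp (hα : 0 < α) (hR : 0 ≤ R) :
    Continuous fun p : L1 d × L1 d × L1 d => slopeOp hα hR p.1 p.2.1 p.2.2 := by
  refine SeqContinuous.continuous fun p q hpq => ?_
  have hu : Tendsto (fun n => (p n).1) atTop (𝓝 q.1) := (continuous_fst.tendsto q).comp hpq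
  have hw : Tendsto (fun n => (p n).2.1) atTop (𝓝 q.2.1) :=
    ((continuous_fst.comp continuous_snd).tendsto q).comp hpq
  have hv : Tendsto (fun n => (p n).2.2) atTop (𝓝 q.2.2) :=
    ((continuous_snd.comp continuous_snd).tendsto q).comp hpq
  have h1 : Tendsto (fun n => slopeOp hα hR (p n).1 (p n).2.1 ((p n).2.2 - q.2.2)) atTop
      (𝓝 0) := by
    rw [tendsto_zero_iff_norm_tendsto_zero]
    refine squeeze_zero (fun _ => norm_nonneg _) (fun n => norm_slopeOp_le hα hR _ _ _) ?_
    have := (tendsto_iff_norm_sub_tendsto_zero.1 hv).const_mul (truncLip α R)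
    simpa using this
  have h2 : Tendsto (fun n => slopeOp hα hR (p n).1 (p n).2.1 q.2.2) atTop
      (𝓝 (slopeOp hα hR q.1 q.2.1 q.2.2)) := by
    -- Every subsequence has a further subsequence along which the parameters converge a.e.
    refine tendsto_of_subseq_tendsto fun ns hns => ?_
    obtain ⟨m₁, hm₁, h3⟩ :=
      (tendstoInMeasure_of_tendsto_Lp (hu.comp hns)).exists_seq_tendsto_ae
    obtain ⟨m₂, hm₂, h4⟩ := (tendstoInMeasure_of_tendsto_Lp
      ((hw.comp hns).comp hm₁.tendsto_atTop)).exists_seq_tendsto_ae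
    refine ⟨fun n => m₁ (m₂ n), tendsto_slopeOp_of_ae hα hR ?_ h4 _⟩
    filter_upwards [h3] with x hx
    exact hx.comp hm₂.tendsto_atTop
  have h3 := h1.add h2
  rw [zero_add] at h3
  refine h3.congr fun n => ?_
  simp only [Function.comp_apply, map_sub, sub_add_cancel]

end Superposition

/-! ### Odd functions -/

lemma measurableSet_halfSpace : MeasurableSet (halfSpace d) :=
  (isOpen_lt continuous_const continuous_lastCoord).measurableSet

lemma oddExt_of_pos (f : Space d → ℝ) {x : Space d} (hx : 0 < lastCoord x) :
    oddExt f x = f x := if_pos hx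

lemma oddExt_flipLast (f : Space d → ℝ) (x : Space d) :
    oddExt f (flipLast x) = -oddExt f x := by
  unfold oddExt
  rw [lastCoord_flipLast, flipLast_flipLast]
  rcases lt_trichotomy (lastCoord x) 0 with h | h | h
  · rw [if_pos (by linarith), if_neg (by linarith), if_pos h, neg_neg]
  · simp [h]
  · rw [if_neg (by linarith), if_pos (by linarith), if_pos h]

lemma oddExt_of_odd {f : Space d → ℝ} (hf : ∀ x, f (flipLast x) = -f x) (x : Space d) :
    oddExt f x = f x := by
  unfold oddExt
  rcases lt_trichotomy (lastCoord x) 0 with h | h | h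
  · rw [if_neg (by linarith), if_pos h, hf, neg_neg]
  · have h1 : flipLast x = x := by
      ext i
      simp only [flipLast]
      split_ifs with hi
      · subst hi
        have : x (Fin.last d) = 0 := h
        rw [this, neg_zero]
      · rfl
    have h2 := hf x
    rw [h1] at h2
    simp only [h, lt_irrefl, if_false]
    linarith
  · rw [if_pos h]

lemma ae_of_ae_halfVolume {p : Space d → Prop} (h : ∀ᵐ x ∂halfVolume d, p x) :
    ∀ᵐ x, (0 < lastCoord x → p x) ∧ (lastCoord x < 0 → p (flipLast x)) := by
  have h1 : ∀ᵐ x : Space d, 0 < lastCoord x → p x :=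
    (ae_restrict_iff' measurableSet_halfSpace).1 h
  filter_upwards [h1, measurePreserving_flipLast.quasiMeasurePreserving.ae h1] with x h2 h3
  refine ⟨h2, fun h4 => h3 ?_⟩
  rw [lastCoord_flipLast]
  linarith

lemma abs_oddExt_le {f : Space d → ℝ} {M : ℝ} (hM : 0 ≤ M)
    (h : ∀ᵐ x ∂halfVolume d, |f x| ≤ M) : ∀ᵐ x, |oddExt f x| ≤ M := by
  filter_upwards [ae_of_ae_halfVolume h] with x hx
  unfold oddExt
  split_ifs with h1 h2
  · exact hx.1 h1
  · rw [abs_neg]; exact hx.2 h2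
  · rwa [abs_zero]

/-- The class in `L¹` of a function, or `0` if the function is not integrable. -/
def toL1 (f : Space d → ℝ) : L1 d :=
  open Classical in if h : MemLp f 1 volume then h.toLp f else 0

lemma coeFn_toL1 {f : Space d → ℝ} (hf : MemLp f 1 volume) : toL1 f =ᵐ[volume] f := by
  rw [toL1, dif_pos hf]; exact hf.coeFn_toLp

lemma reflect_eq_neg {f : L1 d} {g : Space d → ℝ} (hfg : f =ᵐ[volume] g)
    (hg : ∀ x, g (flipLast x) = -g x) : reflect d f = -f := by
  ext1
  filter_upwards [coeFn_reflect f, hfg, Lp.coeFn_neg f,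
    measurePreserving_flipLast.quasiMeasurePreserving.ae_eq_comp hfg] with x h1 h2 h3 h4
  rw [h1, h3, Pi.neg_apply, h2, ← hg x]
  exact h4

lemma oddExt_ae_eq {f : L1 d} (hf : reflect d f = -f) : oddExt f =ᵐ[volume] f := by
  have h0 : ∀ᵐ x, f (flipLast x) = -f x := by
    filter_upwards [coeFn_reflect f, Lp.coeFn_neg f] with x h1 h2
    rw [← h1, hf, h2, Pi.neg_apply]
  filter_upwards [h0] with x hx
  unfold oddExt
  split_ifs with h1 h2
  · rfl
  · rw [hx, neg_neg]
  · have h3 : lastCoord x = 0 := le_antisymm (not_lt.1 h1) (not_lt.1 h2)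
    have h4 : flipLast x = x := by
      ext i
      simp only [flipLast]
      split_ifs with hi
      · subst hi
        have : x (Fin.last d) = 0 := h3
        rw [this, neg_zero]
      · rfl
    rw [h4] at hx
    linarith

/-! ### Strong solutions in `L¹` -/

/-- `U` is on `[0,S]` a bounded solution of `U' = A U + |U|^α U` as a curve in `L¹`: it is of class
`C¹` in the interior, and `U(t)` belongs to the weak generator, with value `U'(t) - |U(t)|^α U(t)`.
The nonlinearity is expressed by a truncation at a level which `U` does not exceed. -/
structure IsStrongSolution (A : 𝓢(Space d, ℝ) →ₗ[ℝ] (Space d →ᵇ ℝ)) {α : ℝ} (hα : 0 < α) (S : ℝ)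
    (U : ℝ → L1 d) : Prop where
  continuousOn : ContinuousOn U (Icc 0 S)
  contDiffOn : ContDiffOn ℝ 1 U (Ioo 0 S)
  equation : ∃ R : ℝ, ∃ hR : 0 ≤ R, (∀ t ∈ Icc 0 S, U t ∈ boundedBy d R) ∧
    ∀ t ∈ Ioo 0 S, IsWeakGenerator A (U t) (deriv U t - nonlin d hα hR (U t))

section Solutions

variable {J₀ : Space d → ℝ} {G : ℝ → ProbabilityMeasure (Space d)}
  {A : 𝓢(Space d, ℝ) →ₗ[ℝ] (Space d →ᵇ ℝ)} {α : ℝ} {u₀ : Space d → ℝ}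

lemma IsStrongSolution.hasDerivAt {hα : 0 < α} {S : ℝ} {U : ℝ → L1 d}
    (hU : IsStrongSolution A hα S U) {t : ℝ} (ht : t ∈ Ioo 0 S) : HasDerivAt U (deriv U t) t :=
  ((hU.contDiffOn.differentiableOn one_ne_zero).differentiableAt
    (Ioo_mem_nhds ht.1 ht.2)).hasDerivAt

lemma IsStrongSolution.continuousOn_deriv {hα : 0 < α} {S : ℝ} {U : ℝ → L1 d}
    (hU : IsStrongSolution A hα S U) : ContinuousOn (deriv U) (Ioo 0 S) :=
  hU.contDiffOn.continuousOn_deriv_of_isOpen isOpen_Ioo le_rfl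

/-- A strong solution satisfies the Duhamel formula. -/
lemma IsStrongSolution.isMild (hG : IsKernel J₀ G) (hA : IsDiffusionOperator G A) {hα : 0 < α}
    {S : ℝ} {U : ℝ → L1 d} (hU : IsStrongSolution A hα S U) {R : ℝ} (hR : 0 ≤ R)
    (hUR : ∀ t ∈ Icc 0 S, U t ∈ boundedBy d R) :
    IsMild (semigroup G) S (U 0) (fun s => nonlin d hα hR (U s)) U := by
  obtain ⟨R', hR', hb, hgen⟩ := hU.equation
  refine (isContractionSemigroup hG hA).mild_of_hasDerivAt hU.continuousOn
    (fun s hs => hU.hasDerivAt hs) ((continuous_nonlin hα hR).comp_continuousOn hU.continuousOn)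
    fun s hs h hh => ?_
  have hs' : s ∈ Icc 0 S := Ioo_subset_Icc_self hs
  rw [nonlin_eq_nonlin hα hR hR' (hUR s hs') (hb s hs')]
  exact (hgen s hs).semigroup_sub_eq hG hA hh

section OfWeak

variable {S : ℝ} {u : ℝ → Space d → ℝ}

lemma IsWeakSolution.coeFn_toL1 (hu : IsWeakSolution A α S u₀ u) {t : ℝ} (ht : t ∈ Icc 0 S) :
    toL1 (u t) =ᵐ[volume] u t :=
  HalfSpaceBlowup.coeFn_toL1 (hu.continuous_L1 t ht).1

lemma IsWeakSolution.continuousOn_toL1 (hu : IsWeakSolution A α S u₀ u) :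
    ContinuousOn (fun t => toL1 (u t)) (Icc 0 S) := by
  intro t ht
  rw [ContinuousWithinAt, tendsto_iff_edist_tendsto_0]
  refine (hu.continuous_L1 t ht).2.congr' ?_
  filter_upwards [self_mem_nhdsWithin] with s hs
  rw [Lp.edist_def]
  exact eLpNorm_congr_ae ((hu.coeFn_toL1 hs).sub (hu.coeFn_toL1 ht)).symm

lemma integrand_eq_pair {f : Space d → ℝ} {F V : L1 d} (hF : F =ᵐ[volume] f)
    (hV : V =ᵐ[volume] fun x => |f x| ^ α * f x) (ψ : 𝓢(Space d, ℝ)) (φ : Space d →ᵇ ℝ)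
    (ψ' : 𝓢(Space d, ℝ)) :
    ∫ x, (f x * (ψ' x + φ x) + |f x| ^ α * f x * ψ x) =
      pair F (ψ'.toBoundedContinuousFunction + φ) + pair V ψ.toBoundedContinuousFunction := by
  rw [pair_apply, pair_apply, ← integral_add (integrable_mul_bcf _ _) (integrable_mul_bcf _ _)]
  refine integral_congr_ae ?_
  filter_upwards [hF, hV] with x h1 h2
  rw [h1, h2]
  rfl

lemma integral_sub_eq_pair {f g : Space d → ℝ} {F V : L1 d} (hF : F =ᵐ[volume] f)
    (hV : V =ᵐ[volume] g) (ψ ψ' : 𝓢(Space d, ℝ)) :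
    ∫ x, (f x * ψ x - g x * ψ' x) =
      pair F ψ.toBoundedContinuousFunction - pair V ψ'.toBoundedContinuousFunction := by
  rw [pair_apply, pair_apply, ← integral_sub (integrable_mul_bcf _ _) (integrable_mul_bcf _ _)]
  refine integral_congr_ae ?_
  filter_upwards [hF, hV] with x h1 h2
  rw [h1, h2]
  rfl

/-- A weak solution is a strong solution. Testing with time-independent functions identifies the
time derivative. -/
lemma IsStrongSolution.of_weak (hα : 0 < α) (hS : 0 < S)
    (hu : ∀ S' ∈ Ioc 0 S, IsWeakSolution A α S' u₀ u) :
    IsStrongSolution A hα S fun t => toL1 (u t) := by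
  have huS := hu S ⟨hS, le_rfl⟩
  have hc := huS.continuousOn_toL1
  set U : ℝ → L1 d := fun t => toL1 (u t) with hUdef
  have hcd : ContDiffOn ℝ 1 U (Ioo 0 S) := by
    obtain ⟨V, hV, hVc⟩ := huS.c1
    refine hVc.congr fun t ht => ?_
    ext1
    exact (huS.coeFn_toL1 (Ioo_subset_Icc_self ht)).trans (hV t ht).symm
  obtain ⟨M, hM⟩ := huS.bounded
  have hR : 0 ≤ |M| := abs_nonneg M
  have hb : ∀ t ∈ Icc 0 S, U t ∈ boundedBy d |M| := by
    intro t ht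
    filter_upwards [hM t ht, huS.coeFn_toL1 ht] with x h1 h2
    rw [h2]
    exact h1.trans (le_abs_self M)
  refine ⟨hc, hcd, |M|, hR, hb, fun t ht ψ => ?_⟩
  have hnl : ∀ t ∈ Icc 0 S, nonlin d hα hR (U t) =ᵐ[volume] fun x => |u t x| ^ α * u t x := by
    intro t ht
    filter_upwards [coeFn_nonlin_of_mem hα hR (hb t ht), huS.coeFn_toL1 ht] with x h1 h2
    rw [h1, h2]
  let ψB := ψ.toBoundedContinuousFunction
  let I : ℝ → ℝ := fun s => pair (U s) (A ψ) + pair (nonlin d hα hR (U s)) ψB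
  have hIc : ContinuousOn I (Icc 0 S) :=
    ((pair.flip (A ψ)).continuous.comp_continuousOn hc).add
      ((pair.flip ψB).continuous.comp_continuousOn ((continuous_nonlin hα hR).comp_continuousOn hc))
  have hint : ∀ r ∈ Ioc 0 S, pair (U r) ψB = pair (U 0) ψB + ∫ s in (0 : ℝ)..r, I s := by
    intro r hr
    have h1 := (hu r hr).weak _ _ (isTestFunction_const r ψ)
    have h0 : (0 : ℝ) ∈ Icc 0 S := ⟨le_rfl, hS.le⟩
    have h2 := integral_sub_eq_pair (huS.coeFn_toL1 ⟨hr.1.le, hr.2⟩)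
      ((huS.coeFn_toL1 h0).trans huS.initial) ψ ψ
    rw [h2] at h1
    have h3 : ∫ s in (0 : ℝ)..r, I s = ∫ s in (0 : ℝ)..r, (∫ x, (u s x * ((0 : 𝓢(Space d, ℝ)) x +
        A ψ x) + |u s x| ^ α * u s x * ψ x)) := by
      refine intervalIntegral.integral_congr fun s hs => ?_
      rw [uIcc_of_le hr.1.le] at hs
      have hs' : s ∈ Icc 0 S := ⟨hs.1, hs.2.trans hr.2⟩
      beta_reduce
      rw [integrand_eq_pair (huS.coeFn_toL1 hs') (hnl s hs') ψ (A ψ) 0]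
      have h4 : (0 : 𝓢(Space d, ℝ)).toBoundedContinuousFunction + A ψ = A ψ := by
        ext x; simp
      rw [h4]
    rw [h3, h1]
    ring
  have hd1 : HasDerivAt (fun r => pair (U r) ψB) (pair (deriv U t) ψB) t :=
    (pair.flip ψB).hasFDerivAt.comp_hasDerivAt t
      ((hcd.differentiableOn one_ne_zero).differentiableAt (Ioo_mem_nhds ht.1 ht.2)).hasDerivAt
  have hd2 : HasDerivAt (fun r => pair (U 0) ψB + ∫ s in (0 : ℝ)..r, I s) (I t) t := by
    refine HasDerivAt.const_add _ ?_
    have hIo : ContinuousOn I (Ioo 0 S) := hIc.mono Ioo_subset_Icc_self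
    refine intervalIntegral.integral_hasDerivAt_right ?_
      (hIo.stronglyMeasurableAtFilter isOpen_Ioo t ht)
      (hIo.continuousAt (Ioo_mem_nhds ht.1 ht.2))
    refine (hIc.mono ?_).intervalIntegrable
    rw [uIcc_of_le ht.1.le]
    exact Icc_subset_Icc le_rfl ht.2.le
  have hd3 := hd2.congr_of_eventuallyEq (f₁ := fun r => pair (U r) ψB) (by
    filter_upwards [Ioo_mem_nhds ht.1 ht.2] with r hr
    exact hint r ⟨hr.1, hr.2.le⟩)
  have h5 := hd1.unique hd3
  change pair (deriv U t - nonlin d hα hR (U t)) ψB = pair (U t) (A ψ)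
  rw [map_sub, sub_apply, h5]
  simp only [I]
  ring

end OfWeak

end Solutions

/-! ### From strong solutions to weak solutions -/

/-- A form of the fundamental theorem of calculus on `[0,S]` in which the integrability of `H` near
`0` is not known beforehand: it follows from the identity on `[0,c]` for small `c`. Indeed, if `H`
were not integrable, these identities (with the value `0` for the integral) would say that `g` is
constant near `0`, hence `H = 0` there. -/
lemma integral_eq_sub_of_eq_near_zero {H g : ℝ → ℝ} {S c₀ : ℝ} (hc₀ : 0 < c₀) (hc₀S : c₀ ≤ S)
    (hg : ContinuousOn g (Icc 0 S)) (hd : ∀ t ∈ Ioo 0 S, HasDerivAt g (H t) t)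
    (hH : ContinuousOn H (Ioc 0 S))
    (hw : ∀ c ∈ Ioc 0 c₀, ∫ t in (0 : ℝ)..c, H t = g c - g 0) :
    ∫ t in (0 : ℝ)..S, H t = g S - g 0 := by
  have hi : ∀ a b, 0 < a → a ≤ b → b ≤ S → IntervalIntegrable H volume a b := by
    intro a b ha hab hb
    refine (hH.mono ?_).intervalIntegrable
    rw [uIcc_of_le hab]
    exact fun x hx => ⟨ha.trans_le hx.1, hx.2.trans hb⟩
  have hi0 : IntervalIntegrable H volume 0 c₀ := by
    by_contra hn
    have h1 : ∀ c ∈ Ioc 0 c₀, g c = g 0 := by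
      intro c hc
      have h2 : ¬ IntervalIntegrable H volume 0 c := fun h =>
        hn (h.trans (hi c c₀ hc.1 hc.2 hc₀S))
      have h3 := hw c hc
      rw [intervalIntegral.integral_undef h2] at h3
      linarith
    have h2 : ∀ t ∈ Ioo 0 c₀, H t = 0 := by
      intro t ht
      have h3 : HasDerivAt g 0 t := (hasDerivAt_const t (g 0)).congr_of_eventuallyEq (by
        filter_upwards [Ioo_mem_nhds ht.1 ht.2] with r hr
        exact h1 r ⟨hr.1, hr.2.le⟩)
      exact (hd t ⟨ht.1, ht.2.trans_le hc₀S⟩).unique h3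
    apply hn
    rw [intervalIntegrable_iff_integrableOn_Ioo_of_le hc₀.le]
    exact (integrableOn_zero).congr_fun (fun t ht => (h2 t ht).symm) measurableSet_Ioo
  exact intervalIntegral.integral_eq_sub_of_hasDerivAt_of_le (hc₀.le.trans hc₀S) hg hd
    (hi0.trans (hi c₀ S hc₀ hc₀S le_rfl))

lemma IsTestFunction.hasDerivWithinAt {S : ℝ} {φ φ' : ℝ → 𝓢(Space d, ℝ)}
    (h : IsTestFunction S φ φ') {t : ℝ} (ht : t ∈ Icc 0 S) :
    HasDerivWithinAt (fun t => (φ t).toBoundedContinuousFunction)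
      (φ' t).toBoundedContinuousFunction (Icc 0 S) t := by
  rw [hasDerivWithinAt_iff_tendsto_slope]
  have h1 := ((SchwartzMap.toBoundedContinuousFunctionCLM ℝ (Space d) ℝ).continuous.tendsto
    (φ' t)).comp (h.deriv t ht)
  refine h1.congr fun s => ?_
  simp only [Function.comp_apply, slope_def_module, map_smul, map_sub]
  rfl

lemma IsTestFunction.mono {S S' : ℝ} {φ φ' : ℝ → 𝓢(Space d, ℝ)} (h : IsTestFunction S φ φ')
    (hS : S' ≤ S) : IsTestFunction S' φ φ' :=
  ⟨fun t ht => (h.deriv t ⟨ht.1, ht.2.trans hS⟩).mono_left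
    (nhdsWithin_mono t (sdiff_subset_sdiff_left (Icc_subset_Icc le_rfl hS))),
    h.continuousOn.mono (Icc_subset_Icc le_rfl hS)⟩

section Solutions

variable {J₀ : Space d → ℝ} {G : ℝ → ProbabilityMeasure (Space d)}
  {A : 𝓢(Space d, ℝ) →ₗ[ℝ] (Space d →ᵇ ℝ)} {α : ℝ} {u₀ : Space d → ℝ}

/-- A strong solution satisfies the weak equation on `[0,S]`, provided it does so on `[0,c]` for
small `c`. -/
lemma IsStrongSolution.weak {hα : 0 < α} {S S₂ : ℝ} {U : ℝ → L1 d} (hS : 0 < S) (hSS₂ : S < S₂)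
    (hU : IsStrongSolution A hα S₂ U) {w : ℝ → Space d → ℝ}
    (hw : ∀ t ∈ Icc 0 S, U t =ᵐ[volume] w t) {w₀ : Space d → ℝ} (hw₀ : w 0 =ᵐ[volume] w₀)
    {φ φ' : ℝ → 𝓢(Space d, ℝ)} (hφ : IsTestFunction S φ φ') {c₀ : ℝ} (hc₀ : 0 < c₀)
    (hc₀S : c₀ ≤ S) (hweak : ∀ c ∈ Ioc 0 c₀,
      ∫ t in (0 : ℝ)..c, (∫ x, (w t x * (φ' t x + A (φ t) x) + |w t x| ^ α * w t x * φ t x)) =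
        ∫ x, (w c x * φ c x - w₀ x * φ 0 x)) :
    ∫ t in (0 : ℝ)..S, (∫ x, (w t x * (φ' t x + A (φ t) x) + |w t x| ^ α * w t x * φ t x)) =
      ∫ x, (w S x * φ S x - w₀ x * φ 0 x) := by
  obtain ⟨R, hR, hb, hgen⟩ := hU.equation
  have hsub : Icc 0 S ⊆ Icc 0 S₂ := Icc_subset_Icc le_rfl hSS₂.le
  let Φ : ℝ → (Space d →ᵇ ℝ) := fun t => (φ t).toBoundedContinuousFunction
  let Φ' : ℝ → (Space d →ᵇ ℝ) := fun t => (φ' t).toBoundedContinuousFunction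
  have hΦd : ∀ t ∈ Icc 0 S, HasDerivWithinAt Φ (Φ' t) (Icc 0 S) t := fun t ht =>
    hφ.hasDerivWithinAt ht
  have hΦc : ContinuousOn Φ (Icc 0 S) := fun t ht => (hΦd t ht).continuousWithinAt
  have hΦ'c : ContinuousOn Φ' (Icc 0 S) :=
    (SchwartzMap.toBoundedContinuousFunctionCLM ℝ (Space d) ℝ).continuous.comp_continuousOn
      hφ.continuousOn
  have hpair : ∀ {s : Set ℝ} {V : ℝ → L1 d} {Ψ : ℝ → (Space d →ᵇ ℝ)}, ContinuousOn V s →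
      ContinuousOn Ψ s → ContinuousOn (fun t => pair (V t) (Ψ t)) s := fun hV hΨ =>
    (pair.continuous.comp_continuousOn hV).clm_apply hΨ
  let g : ℝ → ℝ := fun t => pair (U t) (Φ t)
  let H : ℝ → ℝ := fun t => pair (U t) (Φ' t + A (φ t)) + pair (nonlin d hα hR (U t)) (Φ t)
  have hH : ∀ t ∈ Icc 0 S, H t =
      ∫ x, (w t x * (φ' t x + A (φ t) x) + |w t x| ^ α * w t x * φ t x) := by
    intro t ht
    refine (integrand_eq_pair (hw t ht) ?_ (φ t) (A (φ t)) (φ' t)).symm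
    filter_upwards [coeFn_nonlin_of_mem hα hR (hb t (hsub ht)), hw t ht] with x h1 h2
    rw [h1, h2]
  have hgw : ∀ t ∈ Icc 0 S, ∫ x, (w t x * φ t x - w₀ x * φ 0 x) = g t - g 0 := fun t ht =>
    integral_sub_eq_pair (hw t ht) ((hw 0 ⟨le_rfl, hS.le⟩).trans hw₀) (φ t) (φ 0)
  have hint : ∀ c ∈ Icc 0 S, ∫ t in (0 : ℝ)..c, H t = ∫ t in (0 : ℝ)..c,
      (∫ x, (w t x * (φ' t x + A (φ t) x) + |w t x| ^ α * w t x * φ t x)) := by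
    intro c hc
    refine intervalIntegral.integral_congr fun t ht => hH t ?_
    rw [uIcc_of_le hc.1] at ht
    exact ⟨ht.1, ht.2.trans hc.2⟩
  -- On solutions, `H` is the derivative of `g`, and this expression shows its continuity.
  have hH2 : ∀ t ∈ Ioc 0 S, H t = pair (U t) (Φ' t) + pair (deriv U t) (Φ t) := by
    intro t ht
    have h1 := hgen t ⟨ht.1, ht.2.trans_lt hSS₂⟩ (φ t)
    rw [map_sub, sub_apply] at h1
    simp only [H, map_add]
    change _ = pair (U t) (Φ' t) + pair (deriv U t) (φ t).toBoundedContinuousFunction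
    change pair (U t) (Φ' t) + pair (U t) (A (φ t)) +
      pair (nonlin d hα hR (U t)) (φ t).toBoundedContinuousFunction = _
    linarith
  rw [← hint S ⟨hS.le, le_rfl⟩, hgw S ⟨hS.le, le_rfl⟩]
  refine integral_eq_sub_of_eq_near_zero hc₀ hc₀S (hpair (hU.continuousOn.mono hsub) hΦc) ?_ ?_ ?_
  · intro t ht
    rw [hH2 t ⟨ht.1, ht.2.le⟩]
    have h1 : HasDerivAt U (deriv U t) t := hU.hasDerivAt ⟨ht.1, ht.2.trans hSS₂⟩
    have h2 : HasDerivAt Φ (Φ' t) t :=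
      (hΦd t (Ioo_subset_Icc_self ht)).hasDerivAt (Icc_mem_nhds ht.1 ht.2)
    exact (pair (d := d)).hasDerivAt_of_bilinear (fun _ => h1) fun _ => h2
  · have h1 : ContinuousOn (fun t => pair (U t) (Φ' t) + pair (deriv U t) (Φ t)) (Ioc 0 S) :=
      (hpair (hU.continuousOn.mono (Ioc_subset_Icc_self.trans hsub))
        (hΦ'c.mono Ioc_subset_Icc_self)).add
      (hpair (hU.continuousOn_deriv.mono fun t ht => ⟨ht.1, ht.2.trans_lt hSS₂⟩)
        (hΦc.mono Ioc_subset_Icc_self))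
    exact h1.congr hH2
  · intro c hc
    have hc' : c ∈ Icc 0 S := ⟨hc.1.le, hc.2.trans hc₀S⟩
    rw [hint c hc', hweak c hc, hgw c hc']

lemma eLpNorm_le_of_abs_le {f : Space d → ℝ} {M : ℝ} (hM : 0 ≤ M) (hα : 0 < α)
    (hf : ∀ᵐ x, |f x| ≤ M) :
    eLpNorm f (ENNReal.ofReal (α + 1)) volume ≤
      (ENNReal.ofReal (M ^ α) * eLpNorm f 1 volume) ^ (1 / (α + 1)) := by
  have hp : (ENNReal.ofReal (α + 1)).toReal = α + 1 := ENNReal.toReal_ofReal (by linarith)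
  rw [eLpNorm_eq_lintegral_rpow_enorm_toReal (by simp; linarith) ENNReal.ofReal_ne_top, hp,
    eLpNorm_one_eq_lintegral_enorm]
  refine ENNReal.rpow_le_rpow ?_ (by positivity)
  rw [← lintegral_const_mul' _ _ ENNReal.ofReal_ne_top]
  refine lintegral_mono_ae ?_
  filter_upwards [hf] with x hx
  rw [← ofReal_norm, Real.norm_eq_abs, ENNReal.ofReal_rpow_of_nonneg (abs_nonneg _)
    (by linarith), ← ENNReal.ofReal_mul (by positivity)]
  refine ENNReal.ofReal_le_ofReal ?_
  rw [Real.rpow_add' (abs_nonneg _) (by linarith), Real.rpow_one]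
  gcongr

/-- A bounded curve which is continuous in `L¹` is continuous in `L^{α+1}`. -/
lemma continuousInLp_of_bounded (hα : 0 < α) {S R : ℝ} (hR : 0 ≤ R) {U : ℝ → L1 d}
    {w : ℝ → Space d → ℝ} (hU : ContinuousOn U (Icc 0 S)) (hb : ∀ t ∈ Icc 0 S, U t ∈ boundedBy d R)
    (hw : ∀ t ∈ Icc 0 S, U t =ᵐ[volume] w t) :
    ContinuousInLp (ENNReal.ofReal (α + 1)) (Icc 0 S) w := by
  have hbw : ∀ t ∈ Icc 0 S, ∀ᵐ x, |w t x| ≤ R := by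
    intro t ht
    filter_upwards [hw t ht, hb t ht] with x h1 h2
    rwa [← h1]
  intro t ht
  constructor
  · refine ⟨(Lp.aestronglyMeasurable (U t)).congr (hw t ht), ?_⟩
    refine (eLpNorm_le_of_abs_le hR hα (hbw t ht)).trans_lt ?_
    refine ENNReal.rpow_lt_top_of_nonneg (by positivity) (ENNReal.mul_ne_top ENNReal.ofReal_ne_top ?_)
    rw [← eLpNorm_congr_ae (hw t ht)]
    exact Lp.eLpNorm_ne_top (U t)
  · have h1 : Tendsto (fun s => (ENNReal.ofReal ((R + R) ^ α) * edist (U s) (U t)) ^ (1 / (α + 1)))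
        (𝓝[Icc 0 S] t) (𝓝 0) := by
      have h2 := tendsto_iff_edist_tendsto_0.1 (hU t ht)
      have h3 := ENNReal.Tendsto.const_mul (a := ENNReal.ofReal ((R + R) ^ α)) h2
        (Or.inr ENNReal.ofReal_ne_top)
      have h4 := ((ENNReal.continuous_rpow_const (y := 1 / (α + 1))).tendsto _).comp h3
      rw [mul_zero, ENNReal.zero_rpow_of_pos (by positivity)] at h4
      exact h4
    refine tendsto_of_tendsto_of_tendsto_of_le_of_le' tendsto_const_nhds h1
      (Eventually.of_forall fun _ => zero_le) ?_
    filter_upwards [self_mem_nhdsWithin] with s hs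
    have h2 : ∀ᵐ x, |(w s - w t) x| ≤ R + R := by
      filter_upwards [hbw s hs, hbw t ht] with x h1 h2
      exact (abs_sub _ _).trans (add_le_add h1 h2)
    refine (eLpNorm_le_of_abs_le (by positivity) hα h2).trans_eq ?_
    rw [Lp.edist_def, eLpNorm_congr_ae ((hw s hs).sub (hw t ht))]

/-! ### Local existence and continuation -/

/-- Local existence of strong solutions, on a time interval which only depends on a bound of the
initial value, if the initial value is in the domain of the generator. -/
lemma exists_local_solution (hG : IsKernel J₀ G) (hA : IsDiffusionOperator G A) (hα : 0 < α)
    {M : ℝ} (hM : 0 ≤ M) : ∃ τ : ℝ, 0 < τ ∧ ∀ x z : L1 d, x ∈ boundedBy d M → reflect d x = -x →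
      (Tendsto (fun h : ℝ => h⁻¹ • (semigroup G h x - x)) (𝓝[>] 0) (𝓝 z)) →
      ∃ V : ℝ → L1 d, IsStrongSolution A hα τ V ∧ V 0 = x ∧ ∀ t ∈ Icc 0 τ, reflect d (V t) = -V t := by
  have hP := isContractionSemigroup hG hA
  have hR : 0 ≤ M + 1 := by linarith
  set K := truncLip α (M + 1) with hKdef
  have hK : 0 ≤ K := truncLip_nonneg hα hR
  -- `C` bounds the nonlinearity truncated at the level `M + 1`: for times at most `1 / C` the
  -- solution does not exceed this level. For times at most `1 / (2K)` the Duhamel map is a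
  -- contraction.
  set C := K * (M + 1 + 1) with hCdef
  have hC : 0 ≤ C := by positivity
  have hτ : 0 < min (1 / (2 * (K + 1))) (1 / (C + 1)) := by positivity
  refine ⟨min (1 / (2 * (K + 1))) (1 / (C + 1)), hτ, fun x z hx hodd hz => ?_⟩
  set τ := min (1 / (2 * (K + 1))) (1 / (C + 1)) with hτdef
  have hKτ : K * τ ≤ 1 / 2 := by
    have h1 : (K + 1) * τ ≤ (K + 1) * (1 / (2 * (K + 1))) := by gcongr; exact min_le_left _ _
    have h2 : (K + 1) * (1 / (2 * (K + 1))) = 1 / 2 := by field_simp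
    nlinarith
  have hCτ : C * τ ≤ 1 := by
    have h1 : (C + 1) * τ ≤ (C + 1) * (1 / (C + 1)) := by gcongr; exact min_le_right _ _
    have h2 : (C + 1) * (1 / (C + 1)) = 1 := by field_simp
    nlinarith
  have hF := norm_nonlin_sub_le (d := d) hα hR
  obtain ⟨V, hVc, hV⟩ := hP.exists_mild hτ.le hK hKτ (Φ := fun _ v => nonlin d hα hR v)
    ((continuous_nonlin hα hR).comp continuous_snd) (fun _ => hF) x
  have hV0 : V 0 = x := by
    have := hV 0 ⟨le_rfl, hτ.le⟩
    simpa [hP.apply_zero] using this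
  have hgc : Continuous fun s => nonlin d hα hR (V s) := (continuous_nonlin hα hR).comp hVc
  have hVb : ∀ t ∈ Icc 0 τ, V t ∈ boundedBy d (M + 1) := by
    intro t ht
    rw [hV t ht]
    have h1 := add_mem_boundedBy (semigroup_mem_boundedBy (G := G) t hx)
      (integral_mem_boundedBy ht.1 (hP.comp_continuous (continuous_const.sub continuous_id) hgc)
        fun s => semigroup_mem_boundedBy (G := G) (t - s) (nonlin_mem_boundedBy hα hR (V s)))
    refine boundedBy_mono ?_ h1
    have := mul_le_mul_of_nonneg_right ht.2 hC
    linarith [mul_comm C τ]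
  have hVodd : ∀ t ∈ Icc 0 τ, reflect d (V t) = -V t := by
    -- The function `-V ∘ flipLast` solves the same Duhamel equation.
    have h1 : IsMild (semigroup G) τ x (fun s => nonlin d hα hR (-reflect d (V s)))
        (fun t => -reflect d (V t)) := by
      intro t ht
      beta_reduce
      rw [hV t ht, map_add, ← ContinuousLinearMap.intervalIntegral_comp_comm _
        ((hP.comp_continuous (by fun_prop) hgc).intervalIntegrable _ _),
        hG.reflect_semigroup, hodd, map_neg, neg_add, neg_neg, ← intervalIntegral.integral_neg]
      congr 1
      refine intervalIntegral.integral_congr fun s _ => ?_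
      beta_reduce
      rw [hG.reflect_semigroup, ← nonlin_reflect, ← map_neg, ← nonlin_neg]
    have h2 := hP.mild_unique hK hF hVc.continuousOn
      ((reflect d).continuous.comp hVc).neg.continuousOn hV h1
    intro t ht
    have h3 := h2 t ht
    rw [← neg_eq_iff_eq_neg]
    exact h3.symm
  obtain ⟨V', hV'c, hV'⟩ := hP.mild_eq_integral hτ.le hK hKτ (nonlin_sub hα hR)
    (continuous_slopeOp hα hR) (norm_slopeOp_le hα hR) hVc hV hz
  have hd : ∀ t ∈ Ioo 0 τ, HasDerivAt V (V' t) t := by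
    intro t ht
    have h1 := ((hV'c.integral_hasStrictDerivAt 0 t).hasDerivAt).const_add x
    refine h1.congr_of_eventuallyEq ?_
    filter_upwards [Ioo_mem_nhds ht.1 ht.2] with r hr
    exact hV' r (Ioo_subset_Icc_self hr)
  refine ⟨V, ⟨hVc.continuousOn, ?_, M + 1, hR, hVb, fun t ht ψ => ?_⟩, hV0, hVodd⟩
  · have h1 : ContDiff ℝ 1 fun t => x + ∫ s in (0 : ℝ)..t, V' s := by
      rw [contDiff_one_iff_deriv]
      have h2 : ∀ t, HasDerivAt (fun t => x + ∫ s in (0 : ℝ)..t, V' s) (V' t) t := fun t =>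
        ((hV'c.integral_hasStrictDerivAt 0 t).hasDerivAt).const_add x
      refine ⟨fun t => (h2 t).differentiableAt, ?_⟩
      rw [show deriv (fun t => x + ∫ s in (0 : ℝ)..t, V' s) = V' from funext fun t => (h2 t).deriv]
      exact hV'c
    exact h1.contDiffOn.congr fun t ht => hV' t (Ioo_subset_Icc_self ht)
  · have h1 := hP.tendsto_generator_of_mild hgc hV ht.1.le ht.2 (hd t ht).hasDerivWithinAt
    have h2 := ((pair.flip ψ.toBoundedContinuousFunction).continuous.tendsto _).comp h1
    have h3 := tendsto_pair_semigroup_div hG hA (V t) ψ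
    rw [(hd t ht).deriv]
    refine tendsto_nhds_unique h2 (h3.congr fun h => ?_)
    simp only [Function.comp_apply, map_smul, map_sub, smul_eq_mul]
    rfl

end Solutions

/-! ### Continuation and the blow-up alternative -/

section Continuation

variable {J₀ : Space d → ℝ} {G : ℝ → ProbabilityMeasure (Space d)}
  {A : 𝓢(Space d, ℝ) →ₗ[ℝ] (Space d →ᵇ ℝ)} {α : ℝ} {u₀ : Space d → ℝ}

/-- The value at an interior time of a strong solution is in the domain of the generator. -/
lemma IsStrongSolution.tendsto_generator (hG : IsKernel J₀ G) (hA : IsDiffusionOperator G A)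
    {hα : 0 < α} {S : ℝ} {U : ℝ → L1 d} (hU : IsStrongSolution A hα S U) {t : ℝ}
    (ht : t ∈ Ioo 0 S) :
    ∃ z, Tendsto (fun h : ℝ => h⁻¹ • (semigroup G h (U t) - U t)) (𝓝[>] 0) (𝓝 z) := by
  obtain ⟨R, hR, -, hgen⟩ := hU.equation
  have hP := isContractionSemigroup hG hA
  set z := deriv U t - nonlin d hα hR (U t)
  have h1 := ((hP.continuous z).integral_hasStrictDerivAt 0 0).hasDerivAt
  rw [hP.apply_zero, hasDerivAt_iff_tendsto_slope] at h1
  refine ⟨z, (h1.mono_left (nhdsWithin_mono 0 fun x hx => ne_of_gt hx)).congr' ?_⟩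
  filter_upwards [self_mem_nhdsWithin] with h hh
  rw [(hgen t ht).semigroup_sub_eq hG hA (le_of_lt hh)]
  simp only [slope_def_module, intervalIntegral.integral_same, sub_zero]
  rfl

/-- Strong solutions restarted at an interior time coincide with any other strong solution with the
same initial value. -/
lemma IsStrongSolution.eq_of_restart (hG : IsKernel J₀ G) (hA : IsDiffusionOperator G A)
    {hα : 0 < α} {S τ a : ℝ} {U V : ℝ → L1 d} (hU : IsStrongSolution A hα S U)
    (hV : IsStrongSolution A hα τ V) (ha : 0 ≤ a) (haτ : S ≤ a + τ) (h0 : V 0 = U a) :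
    ∀ t ∈ Icc a S, U t = V (t - a) := by
  intro t ht
  obtain ⟨R₁, hR₁, hb₁, -⟩ := hU.equation
  obtain ⟨R₂, hR₂, hb₂, -⟩ := hV.equation
  have hP := isContractionSemigroup hG hA
  have hR : 0 ≤ max R₁ R₂ := hR₁.trans (le_max_left _ _)
  have hUm := hU.isMild hG hA hR fun t ht => boundedBy_mono (le_max_left _ _) (hb₁ t ht)
  have hVm := hV.isMild hG hA hR fun t ht => boundedBy_mono (le_max_right _ _) (hb₂ t ht)
  have hmap : ∀ s ∈ Icc 0 (S - a), s + a ∈ Icc 0 S := fun s hs =>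
    ⟨by linarith [hs.1], by linarith [hs.2]⟩
  have hsub : Icc 0 (S - a) ⊆ Icc 0 τ := Icc_subset_Icc le_rfl (by linarith)
  have h1 := hP.mild_unique (truncLip_nonneg hα hR) (norm_nonlin_sub_le hα hR)
    (τ := S - a) (x := U a) (U := fun s => U (s + a)) (V := V)
    (hU.continuousOn.comp (by fun_prop) hmap) (hV.continuousOn.mono hsub)
    (fun s hs => hP.mild_restart ((continuous_nonlin hα hR).comp_continuousOn hU.continuousOn) hUm
      ha hs.1 (by linarith [hs.2]))
    (fun s hs => by rw [← h0]; exact hVm s (hsub hs))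
    (t - a) ⟨by linarith [ht.1], by linarith [ht.2]⟩
  simpa using h1

/-- A solution on `[0,S)` whose value at a time `t₀` is the initial value of a strong solution on
`[0,τ]`, where `t₀ + τ > S`, can be continued. -/
lemma exists_continuation (hG : IsKernel J₀ G) (hA : IsDiffusionOperator G A) (hα : 0 < α)
    {S t₀ τ : ℝ} {u : ℝ → Space d → ℝ} (hu : IsSolutionUpTo A α (S : EReal) u₀ u)
    (ht₀ : t₀ ∈ Ioo 0 S) (hτ : S < t₀ + τ) {V : ℝ → L1 d} (hV : IsStrongSolution A hα τ V)
    (hV0 : V 0 = toL1 (oddExt (u t₀))) (hVodd : ∀ t ∈ Icc 0 τ, reflect d (V t) = -V t) :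
    ∃ (T' : EReal) (w : ℝ → Space d → ℝ), (S : EReal) < T' ∧ IsSolutionUpTo A α T' u₀ w ∧
      ∀ t : ℝ, 0 ≤ t → (t : EReal) < S → w t =ᵐ[halfVolume d] u t := by
  have hweak : ∀ S', 0 < S' → S' < S → IsWeakSolution A α S' (oddExt u₀) fun t => oddExt (u t) :=
    fun S' h0 h1 => hu.2 S' h0 (by exact_mod_cast h1)
  set U : ℝ → L1 d := fun t => toL1 (oddExt (u t)) with hUdef
  have hstrong : ∀ S', 0 < S' → S' < S → IsStrongSolution A hα S' U := fun S' h0 h1 =>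
    IsStrongSolution.of_weak hα h0 fun S'' h => hweak S'' h.1 (h.2.trans_lt h1)
  have hUV : ∀ t, t₀ ≤ t → t < S → U t = V (t - t₀) := by
    intro t h1 h2
    exact (hstrong t (ht₀.1.trans_le h1) h2).eq_of_restart hG hA hV ht₀.1.le (by linarith) hV0 t
      ⟨h1, le_rfl⟩
  -- The two curves coincide on the overlap `[t₀, S)`, so that the glued curve `W` inherits its local
  -- properties from one of them.
  let W : ℝ → L1 d := fun t => if t < t₀ then U t else V (t - t₀)
  have hWU : ∀ t, t < S → W t = U t := by
    intro t ht
    simp only [W]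
    split_ifs with h
    · rfl
    · exact (hUV t (not_lt.1 h) ht).symm
  have hWV : ∀ t, t₀ ≤ t → W t = V (t - t₀) := fun t ht => if_neg (not_lt.2 ht)
  have hWUe : ∀ t, t < S → W =ᶠ[𝓝 t] U := fun t ht => by
    filter_upwards [Iio_mem_nhds ht] with s hs using hWU s hs
  have hWVe : ∀ t, t₀ < t → W =ᶠ[𝓝 t] fun s => V (s - t₀) := fun t ht => by
    filter_upwards [Ioi_mem_nhds ht] with s hs using hWV s (le_of_lt hs)
  have hWodd : ∀ t, 0 ≤ t → t ≤ t₀ + τ → reflect d (W t) = -W t := by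
    intro t h0 h1
    rcases lt_or_ge t t₀ with h | h
    · have ht : t < S := h.trans ht₀.2
      rw [hWU t ht]
      exact reflect_eq_neg ((hweak t₀ ht₀.1 ht₀.2).coeFn_toL1 ⟨h0, h.le⟩) (oddExt_flipLast _)
    · rw [hWV t h]
      exact hVodd _ ⟨by linarith, by linarith⟩
  have hWstrong : ∀ S₂, 0 < S₂ → S₂ < t₀ + τ → IsStrongSolution A hα S₂ W := by
    intro S₂ h0 h2
    refine ⟨fun t ht => ?_, fun t ht => ?_, ?_⟩
    · rcases lt_or_ge t S with h | h
      · obtain ⟨r, hr1, hr2⟩ := exists_between (max_lt h (ht₀.1.trans ht₀.2))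
        have hr3 : t < r := (le_max_left _ _).trans_lt hr1
        have hc := (hstrong r ((le_max_right _ _).trans_lt hr1) hr2).continuousOn t ⟨ht.1, hr3.le⟩
        have hc2 : ContinuousWithinAt U (Icc 0 S₂) t := by
          refine hc.mono_of_mem_nhdsWithin ?_
          filter_upwards [self_mem_nhdsWithin, nhdsWithin_le_nhds (Iio_mem_nhds hr3)]
            with s hs hs' using ⟨hs.1, le_of_lt hs'⟩
        exact hc2.congr_of_eventuallyEq (nhdsWithin_le_nhds (hWUe t h)) (hWU t h)
      · have ht' : t₀ < t := ht₀.2.trans_le h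
        have hc : ContinuousAt V (t - t₀) := hV.continuousOn.continuousAt
          (Icc_mem_nhds (by linarith) (by linarith [ht.2]))
        have hc2 : ContinuousAt (fun s => V (s - t₀)) t :=
          ContinuousAt.comp (g := V) (f := fun s => s - t₀) hc (by fun_prop)
        exact (hc2.congr (hWVe t ht').symm).continuousWithinAt
    · rcases lt_or_ge t S with h | h
      · obtain ⟨r, hr1, hr2⟩ := exists_between h
        have hc := (hstrong r (ht.1.trans hr1) hr2).contDiffOn.contDiffAt (Ioo_mem_nhds ht.1 hr1)
        exact (hc.congr_of_eventuallyEq (hWUe t h)).contDiffWithinAt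
      · have ht' : t₀ < t := ht₀.2.trans_le h
        have hc : ContDiffAt ℝ 1 V (t - t₀) := hV.contDiffOn.contDiffAt
          (Ioo_mem_nhds (by linarith) (by linarith [ht.2]))
        have hc2 : ContDiffAt ℝ 1 (fun s => V (s - t₀)) t :=
          ContDiffAt.comp (g := V) (f := fun s => s - t₀) t hc (by fun_prop)
        exact (hc2.congr_of_eventuallyEq (hWVe t ht')).contDiffWithinAt
    · obtain ⟨R₁, hR₁, hb₁, -⟩ := (hstrong t₀ ht₀.1 ht₀.2).equation
      obtain ⟨R₂, hR₂, hb₂, hgen₂⟩ := hV.equation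
      have hR : 0 ≤ max R₁ R₂ := hR₁.trans (le_max_left _ _)
      have hb : ∀ t ∈ Icc 0 S₂, W t ∈ boundedBy d (max R₁ R₂) := by
        intro t ht
        rcases lt_or_ge t t₀ with h | h
        · rw [hWU t (h.trans ht₀.2)]
          exact boundedBy_mono (le_max_left _ _) (hb₁ t ⟨ht.1, h.le⟩)
        · rw [hWV t h]
          exact boundedBy_mono (le_max_right _ _)
            (hb₂ _ ⟨by linarith, by linarith [ht.2]⟩)
      refine ⟨_, hR, hb, fun t ht => ?_⟩
      rcases lt_or_ge t S with h | h
      · obtain ⟨r, hr1, hr2⟩ := exists_between h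
        obtain ⟨R₃, hR₃, hb₃, hgen₃⟩ := (hstrong r (ht.1.trans hr1) hr2).equation
        have h3 := hb t (Ioo_subset_Icc_self ht)
        rw [(hWUe t h).deriv_eq, hWU t h]
        rw [hWU t h] at h3
        rw [nonlin_eq_nonlin hα hR hR₃ h3 (hb₃ t ⟨ht.1.le, hr1.le⟩)]
        exact hgen₃ t ⟨ht.1, hr1⟩
      · have ht' : t₀ < t := ht₀.2.trans_le h
        have h3 := hb t (Ioo_subset_Icc_self ht)
        have h4 : t - t₀ ∈ Ioo 0 τ := ⟨by linarith, by linarith [ht.2]⟩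
        rw [(hWVe t ht').deriv_eq, hWV t ht'.le, deriv_comp_sub_const]
        rw [hWV t ht'.le] at h3
        rw [nonlin_eq_nonlin hα hR hR₂ h3 (hb₂ _ (Ioo_subset_Icc_self h4))]
        exact hgen₂ _ h4
  have hWw : ∀ t, 0 ≤ t → t ≤ t₀ + τ → W t =ᵐ[volume] oddExt (W t) := fun t h0 h1 =>
    (oddExt_ae_eq (hWodd t h0 h1)).symm
  have hWu : ∀ t, 0 ≤ t → t < S → oddExt (W t) =ᵐ[volume] oddExt (u t) := by
    intro t h0 h1
    have h2 : W t =ᵐ[volume] oddExt (u t) := by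
      obtain ⟨r, hr1, hr2⟩ := exists_between (max_lt h1 (ht₀.1.trans ht₀.2))
      rw [hWU t h1]
      exact (hweak r ((le_max_right _ _).trans_lt hr1) hr2).coeFn_toL1
        ⟨h0, ((le_max_left _ _).trans_lt hr1).le⟩
    exact (hWw t h0 (by linarith)).symm.trans h2
  refine ⟨((t₀ + τ : ℝ) : EReal), fun t => W t, by exact_mod_cast hτ, ⟨?_, fun S₂ h0 h1 => ?_⟩, ?_⟩
  · exact_mod_cast (ht₀.1.trans (ht₀.2.trans hτ))
  · have h2 : S₂ < t₀ + τ := by exact_mod_cast h1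
    obtain ⟨S₃, hS₃, hS₃'⟩ := exists_between h2
    have hW := hWstrong S₂ h0 h2
    have hWt : ∀ t ∈ Icc 0 S₂, W t =ᵐ[volume] oddExt (W t) := fun t ht =>
      hWw t ht.1 (ht.2.trans h2.le)
    obtain ⟨R, hR, hb, -⟩ := hW.equation
    have hinit : oddExt (W 0) =ᵐ[volume] oddExt u₀ :=
      (hWu 0 le_rfl (ht₀.1.trans ht₀.2)).trans (hweak t₀ ht₀.1 ht₀.2).initial
    refine ⟨hinit, ⟨W, fun t ht => hWt t (Ioo_subset_Icc_self ht), hW.contDiffOn⟩,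
      fun t ht => ⟨(Lp.memLp (W t)).ae_eq (hWt t ht), ?_⟩,
      continuousInLp_of_bounded hα hR hW.continuousOn hb hWt, ⟨R, fun t ht => ?_⟩,
      fun φ φ' hφ => ?_⟩
    · refine (tendsto_iff_edist_tendsto_0.1 (hW.continuousOn t ht)).congr' ?_
      filter_upwards [self_mem_nhdsWithin] with s hs
      rw [Lp.edist_def]
      exact eLpNorm_congr_ae ((hWt s hs).sub (hWt t ht))
    · filter_upwards [hWt t ht, hb t ht] with x h3 h4
      rwa [← h3]
    · have hc₀ : 0 < min t₀ S₂ := lt_min ht₀.1 h0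
      -- On small intervals `[0,c]` the weak equation is that of `u`.
      refine (hWstrong S₃ (h0.trans hS₃) hS₃').weak h0 hS₃ hWt hinit hφ hc₀ (min_le_right _ _)
        fun c hc => ?_
      have hcS : c < S := (hc.2.trans (min_le_left _ _)).trans_lt ht₀.2
      have h3 := (hweak c hc.1 hcS).weak φ φ' (hφ.mono (hc.2.trans (min_le_right _ _)))
      rw [show ∫ x, (oddExt (W c) x * φ c x - oddExt u₀ x * φ 0 x) =
          ∫ x, (oddExt (u c) x * φ c x - oddExt u₀ x * φ 0 x) from ?_, ← h3]
      · refine intervalIntegral.integral_congr fun t ht => ?_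
        rw [uIcc_of_le hc.1.le] at ht
        refine integral_congr_ae ?_
        filter_upwards [hWu t ht.1 (ht.2.trans_lt hcS)] with x hx
        rw [hx]
      · refine integral_congr_ae ?_
        filter_upwards [hWu c hc.1.le hcS] with x hx
        rw [hx]
  · intro t h0 h1
    have h1' : t < S := by exact_mod_cast h1
    have h2 : ∀ᵐ x ∂halfVolume d, oddExt (W t) x = oddExt (u t) x :=
      ae_restrict_of_ae (hWu t h0 h1')
    filter_upwards [h2, ae_restrict_mem measurableSet_halfSpace] with x hx hx'
    rwa [oddExt_of_pos _ hx', oddExt_of_pos _ hx'] at hx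

/-- The blow-up alternative: the sup norm of a maximal solution with finite existence time tends to
infinity as the existence time is approached. Below a bound `M` a solution lasts for a time `τ`
longer, which excludes that the norm is at most `M` at times close to `S`. -/
theorem IsMaximalSolution.tendsto_eLpNorm (hG : IsKernel J₀ G) (hA : IsDiffusionOperator G A)
    (hα : 0 < α) {S : ℝ} {u : ℝ → Space d → ℝ} (hu : IsMaximalSolution A α (S : EReal) u₀ u) :
    Tendsto (fun t => eLpNorm (u t) ⊤ (halfVolume d)) (𝓝[<] S) (𝓝 ⊤) := by
  have hS : 0 < S := by exact_mod_cast hu.1.1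
  rw [ENNReal.tendsto_nhds_top_iff_nnreal]
  intro M
  by_contra hM
  rw [not_eventually] at hM
  obtain ⟨τ, hτ, hloc⟩ := exists_local_solution hG hA hα (M := M) M.2
  have hnear : ∀ᶠ t in 𝓝[<] S, t ∈ Ioo (max 0 (S - τ)) S :=
    Ioo_mem_nhdsLT (max_lt hS (by linarith))
  obtain ⟨t₀, ht₀M, ht₀⟩ := (hM.and_eventually hnear).exists
  have ht₀0 : 0 < t₀ := (le_max_left _ _).trans_lt ht₀.1
  have ht₀τ : S - τ < t₀ := (le_max_right _ _).trans_lt ht₀.1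
  obtain ⟨r, hr1, hr2⟩ := exists_between ht₀.2
  have hweak : ∀ S', 0 < S' → S' < S → IsWeakSolution A α S' (oddExt u₀) fun t => oddExt (u t) :=
    fun S' h0 h1 => hu.1.2 S' h0 (by exact_mod_cast h1)
  have hcoe := (hweak r (ht₀0.trans hr1) hr2).coeFn_toL1 ⟨ht₀0.le, hr1.le⟩
  have hstrong : IsStrongSolution A hα r fun t => toL1 (oddExt (u t)) :=
    IsStrongSolution.of_weak hα (ht₀0.trans hr1) fun S'' h => hweak S'' h.1 (h.2.trans_lt hr2)
  have hb : toL1 (oddExt (u t₀)) ∈ boundedBy d M := by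
    have h1 : ∀ᵐ x ∂halfVolume d, |u t₀ x| ≤ M := by
      have h2 := ae_le_eLpNormEssSup (f := u t₀) (μ := halfVolume d)
      rw [← eLpNorm_exponent_top] at h2
      filter_upwards [h2] with x hx
      have h3 := hx.trans (not_lt.1 ht₀M)
      rw [← ENNReal.ofReal_coe_nnreal, ← ofReal_norm] at h3
      exact (ENNReal.ofReal_le_ofReal_iff M.2).1 h3
    filter_upwards [abs_oddExt_le M.2 h1, hcoe] with x h2 h3
    rwa [h3]
  obtain ⟨z, hz⟩ := hstrong.tendsto_generator hG hA ⟨ht₀0, hr1⟩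
  obtain ⟨V, hV, hV0, hVodd⟩ := hloc _ z hb (reflect_eq_neg hcoe (oddExt_flipLast _)) hz
  exact hu.2 (exists_continuation hG hA hα hu.1 ⟨ht₀0, ht₀.2⟩ (by linarith) hV hV0 hVodd)

end Continuation

/-! ### An odd Gaussian test function -/

/-- The function `x_N e^{-|x|²/2}`. -/
def gaussOdd (x : Space d) : ℝ := lastCoord x * Real.exp (-(‖x‖ ^ 2 / 2))

lemma abs_lastCoord_le (x : Space d) : |lastCoord x| ≤ ‖x‖ := PiLp.norm_apply_le x (Fin.last d)

lemma continuous_gaussOdd : Continuous (gaussOdd (d := d)) := by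
  unfold gaussOdd
  exact continuous_lastCoord.mul (by fun_prop)

lemma norm_flipLast (x : Space d) : ‖flipLast x‖ = ‖x‖ := by
  rw [← flipLastIsometry_apply, LinearIsometryEquiv.norm_map]

lemma gaussOdd_flipLast (x : Space d) : gaussOdd (flipLast x) = -gaussOdd x := by
  rw [gaussOdd, gaussOdd, lastCoord_flipLast, norm_flipLast, neg_mul]

lemma integrable_gauss {b : ℝ} (hb : 0 < b) :
    Integrable fun x : Space d => Real.exp (-b * ‖x‖ ^ 2) := by
  have h := GaussianFourier.integrable_cexp_neg_mul_sq_norm_add (V := Space d) (b := (b : ℂ))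
    (by simpa using hb) 0 0
  refine h.norm.congr (ae_of_all _ fun x => ?_)
  simp only [zero_mul, add_zero, Complex.norm_exp]
  norm_cast

lemma sq_mul_exp_le (r : ℝ) :
    r ^ 2 * Real.exp (-(r ^ 2 / 2)) ≤ 4 * Real.exp (-(1 / 4) * r ^ 2) := by
  have h1 : r ^ 2 / 4 ≤ Real.exp (r ^ 2 / 4) := by linarith [Real.add_one_le_exp (r ^ 2 / 4)]
  have h2 : Real.exp (-(1 / 4) * r ^ 2) = Real.exp (r ^ 2 / 4) * Real.exp (-(r ^ 2 / 2)) := by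
    rw [← Real.exp_add]; congr 1; ring
  rw [h2]
  nlinarith [Real.exp_pos (-(r ^ 2 / 2))]

lemma integrable_sq_mul_gauss :
    Integrable fun x : Space d => ‖x‖ ^ 2 * Real.exp (-(‖x‖ ^ 2 / 2)) := by
  refine ((integrable_gauss (d := d) (b := 1 / 4) (by norm_num)).const_mul 4).mono'
    (by fun_prop) (ae_of_all _ fun x => ?_)
  rw [Real.norm_of_nonneg (by positivity)]
  exact sq_mul_exp_le _

lemma integrable_norm_mul_gauss :
    Integrable fun x : Space d => ‖x‖ * Real.exp (-(‖x‖ ^ 2 / 2)) := by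
  have h1 := (integrable_gauss (d := d) (b := 1 / 2) (by norm_num)).add
    (integrable_sq_mul_gauss (d := d))
  refine h1.mono' (by fun_prop) (ae_of_all _ fun x => ?_)
  rw [Real.norm_of_nonneg (by positivity)]
  have h2 : Real.exp (-(1 / 2) * ‖x‖ ^ 2) = Real.exp (-(‖x‖ ^ 2 / 2)) := by congr 1; ring
  simp only [Pi.add_apply, h2]
  have h3 : ‖x‖ ≤ 1 + ‖x‖ ^ 2 := by nlinarith [sq_nonneg (‖x‖ - 1), norm_nonneg x]
  nlinarith [Real.exp_pos (-(‖x‖ ^ 2 / 2))]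

lemma abs_gaussOdd_le (x : Space d) : |gaussOdd x| ≤ ‖x‖ * Real.exp (-(‖x‖ ^ 2 / 2)) := by
  rw [gaussOdd, abs_mul, Real.abs_exp]
  gcongr
  exact abs_lastCoord_le x

lemma abs_gaussOdd_le_one (x : Space d) : |gaussOdd x| ≤ 1 := by
  refine (abs_gaussOdd_le x).trans ?_
  have h1 : ‖x‖ ≤ Real.exp (‖x‖ ^ 2 / 2) := by
    nlinarith [Real.add_one_le_exp (‖x‖ ^ 2 / 2), sq_nonneg (‖x‖ - 1)]
  rw [Real.exp_neg, ← div_eq_mul_inv]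
  exact (div_le_one (Real.exp_pos _)).2 h1

lemma integrable_gaussOdd : Integrable (gaussOdd (d := d)) :=
  integrable_norm_mul_gauss.mono' continuous_gaussOdd.aestronglyMeasurable
    (ae_of_all _ abs_gaussOdd_le)

lemma integral_cos_mul_gauss (x : Space d) :
    ∫ η : Space d, Real.cos (inner ℝ x η) * Real.exp (-(‖η‖ ^ 2 / 2)) =
      (2 * Real.pi) ^ (((d + 1 : ℕ) : ℝ) / 2) * Real.exp (-(‖x‖ ^ 2 / 2)) := by
  have h := GaussianFourier.integral_cexp_neg_mul_sq_norm_add (V := Space d)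
    (b := ((1 / 2 : ℝ) : ℂ)) (by rw [Complex.ofReal_re]; norm_num) Complex.I x
  have hi := GaussianFourier.integrable_cexp_neg_mul_sq_norm_add (V := Space d)
    (b := ((1 / 2 : ℝ) : ℂ)) (by rw [Complex.ofReal_re]; norm_num) Complex.I x
  have h1 := congrArg Complex.re h
  have h2 : ∀ η : Space d, (Complex.exp (-((1 / 2 : ℝ) : ℂ) * (‖η‖ : ℂ) ^ 2 +
      Complex.I * ((inner ℝ x η : ℝ) : ℂ))).re =
      Real.cos (inner ℝ x η) * Real.exp (-(‖η‖ ^ 2 / 2)) := by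
    intro η
    have e1 : -((1 / 2 : ℝ) : ℂ) * (‖η‖ : ℂ) ^ 2 + Complex.I * ((inner ℝ x η : ℝ) : ℂ) =
        ((-(‖η‖ ^ 2 / 2) : ℝ) : ℂ) + ((inner ℝ x η : ℝ) : ℂ) * Complex.I := by
      push_cast; ring
    rw [e1, Complex.exp_add, ← Complex.ofReal_exp, Complex.re_ofReal_mul,
      Complex.exp_ofReal_mul_I_re, mul_comm]
  have h3 := integral_re hi
  simp only [RCLike.re_eq_complex_re] at h3
  rw [← h3] at h1
  simp only [h2] at h1
  rw [h1]
  have e2 : ((Real.pi : ℂ) / ((1 / 2 : ℝ) : ℂ)) ^ ((Module.finrank ℝ (Space d) : ℂ) / 2) =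
      (((2 * Real.pi) ^ (((d + 1 : ℕ) : ℝ) / 2) : ℝ) : ℂ) := by
    rw [finrank_euclideanSpace_fin, Complex.ofReal_cpow (by positivity)]
    congr 1
    · push_cast; ring
    · push_cast; ring
  have e3 : Complex.exp (Complex.I ^ 2 * (‖x‖ : ℂ) ^ 2 / (4 * ((1 / 2 : ℝ) : ℂ))) =
      ((Real.exp (-(‖x‖ ^ 2 / 2)) : ℝ) : ℂ) := by
    rw [Complex.ofReal_exp]
    congr 1
    rw [Complex.I_sq]
    push_cast; ring
  rw [e2, e3, ← Complex.ofReal_mul, Complex.ofReal_re]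

/-- The Fourier representation of `x_N e^{-|x|²/2}`, obtained by differentiating that of the
Gaussian. -/
lemma integral_sin_mul_gauss (x : Space d) :
    ∫ η : Space d, Real.sin (inner ℝ x η) * (lastCoord η * Real.exp (-(‖η‖ ^ 2 / 2))) =
      (2 * Real.pi) ^ (((d + 1 : ℕ) : ℝ) / 2) * gaussOdd x := by
  let e : Space d := EuclideanSpace.single (Fin.last d) (1 : ℝ)
  have he : ∀ η : Space d, inner ℝ e η = lastCoord η := fun η => by
    simp [e, lastCoord, EuclideanSpace.inner_single_left]
  have hlin : ∀ (η : Space d) (s : ℝ), inner ℝ (x + s • e) η = inner ℝ x η + s * lastCoord η := by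
    intro η s
    rw [inner_add_left, real_inner_smul_left, he]
  have hgauss : Integrable fun η : Space d => Real.exp (-(‖η‖ ^ 2 / 2)) := by
    refine (integrable_gauss (d := d) (b := 1 / 2) (by norm_num)).congr (ae_of_all _ fun η => ?_)
    simp only
    congr 1; ring
  have h1 := hasDerivAt_integral_of_dominated_loc_of_deriv_le (μ := (volume : Measure (Space d)))
    (F := fun (s : ℝ) η => Real.cos (inner ℝ (x + s • e) η) * Real.exp (-(‖η‖ ^ 2 / 2)))
    (F' := fun (s : ℝ) η => -Real.sin (inner ℝ (x + s • e) η) * lastCoord η *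
      Real.exp (-(‖η‖ ^ 2 / 2))) (x₀ := 0)
    (bound := fun η => ‖η‖ * Real.exp (-(‖η‖ ^ 2 / 2))) (s := univ) univ_mem
    (Eventually.of_forall fun s => (by fun_prop : Continuous _).aestronglyMeasurable)
    (hgauss.mono' (by fun_prop) (ae_of_all _ fun η => by
      rw [norm_mul, Real.norm_of_nonneg (Real.exp_pos _).le]
      exact mul_le_of_le_one_left (Real.exp_pos _).le (Real.abs_cos_le_one _)))
    (((by fun_prop : Continuous fun η : Space d => -Real.sin (inner ℝ (x + (0 : ℝ) • e) η)).mul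
      continuous_lastCoord).mul (by fun_prop)).aestronglyMeasurable
    (ae_of_all _ fun η s _ => by
      rw [norm_mul, norm_mul, norm_neg, Real.norm_of_nonneg (Real.exp_pos _).le]
      gcongr
      calc ‖Real.sin (inner ℝ (x + s • e) η)‖ * ‖lastCoord η‖ ≤ 1 * ‖η‖ := by
            gcongr
            · exact Real.abs_sin_le_one _
            · exact abs_lastCoord_le η
        _ = ‖η‖ := one_mul _)
    integrable_norm_mul_gauss
    (ae_of_all _ fun η s _ => by
      simp only [hlin]
      refine HasDerivAt.mul_const ?_ _
      have h2 : HasDerivAt (fun s => inner ℝ x η + s * lastCoord η) (lastCoord η) s := by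
        simpa using ((hasDerivAt_id s).mul_const (lastCoord η)).const_add (inner ℝ x η)
      exact h2.cos)
  have h2 := h1.2
  simp only [integral_cos_mul_gauss, zero_smul, add_zero] at h2
  have h3 : HasDerivAt (fun s : ℝ => (2 * Real.pi) ^ (((d + 1 : ℕ) : ℝ) / 2) *
      Real.exp (-(‖x + s • e‖ ^ 2 / 2))) ((2 * Real.pi) ^ (((d + 1 : ℕ) : ℝ) / 2) *
      (Real.exp (-(‖x‖ ^ 2 / 2)) * -lastCoord x)) 0 := by
    refine HasDerivAt.const_mul _ ?_
    have h4 : HasDerivAt (fun s : ℝ => -(‖x + s • e‖ ^ 2 / 2)) (-lastCoord x) 0 := by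
      have h5 : ∀ s : ℝ, -(‖x + s • e‖ ^ 2 / 2) =
          -(‖x‖ ^ 2 / 2) - s * lastCoord x - s ^ 2 * (‖e‖ ^ 2 / 2) := by
        intro s
        rw [norm_add_sq_real, norm_smul, real_inner_smul_right, real_inner_comm, he, mul_pow,
          Real.norm_eq_abs, sq_abs]
        ring
      simp only [h5]
      have h6 := (((hasDerivAt_id (0 : ℝ)).mul_const (lastCoord x)).const_sub
        (-(‖x‖ ^ 2 / 2))).sub (((hasDerivAt_id (0 : ℝ)).pow 2).mul_const (‖e‖ ^ 2 / 2))
      convert! h6 using 1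
      simp
    have h7 := h4.exp
    simpa using h7
  have h8 := h2.unique h3
  simp only [neg_mul, integral_neg] at h8
  rw [gaussOdd]
  have h9 : ∫ η : Space d, Real.sin (inner ℝ x η) * (lastCoord η * Real.exp (-(‖η‖ ^ 2 / 2))) =
      ∫ η : Space d, Real.sin (inner ℝ x η) * lastCoord η * Real.exp (-(‖η‖ ^ 2 / 2)) := by
    simp_rw [mul_assoc]
  rw [h9]
  linarith

/-- The test function `x_N e^{-|x|²/(2λ²)}` at the scale `λ`. -/
def scaledGauss (d : ℕ) (l : ℝ) : Space d →ᵇ ℝ :=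
  BoundedContinuousFunction.ofNormedAddCommGroup (fun x => l * gaussOdd (l⁻¹ • x))
    (continuous_const.mul (continuous_gaussOdd.comp (by fun_prop))) |l| fun x => by
      rw [norm_mul, Real.norm_eq_abs]
      exact mul_le_of_le_one_right (abs_nonneg l) (abs_gaussOdd_le_one _)

lemma scaledGauss_apply (l : ℝ) (x : Space d) : scaledGauss d l x = l * gaussOdd (l⁻¹ • x) := rfl

lemma scaledGauss_flipLast (l : ℝ) (x : Space d) :
    scaledGauss d l (flipLast x) = -scaledGauss d l x := by
  rw [scaledGauss_apply, scaledGauss_apply, ← flipLastIsometry_apply, ← map_smul,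
    flipLastIsometry_apply, gaussOdd_flipLast, mul_neg]

lemma scaledGauss_nonneg {l : ℝ} (hl : 0 < l) {x : Space d} (hx : 0 < lastCoord x) :
    0 ≤ scaledGauss d l x := by
  rw [scaledGauss_apply, gaussOdd]
  have : lastCoord (l⁻¹ • x) = l⁻¹ * lastCoord x := by simp [lastCoord]
  rw [this]
  positivity

lemma integrable_scaledGauss {l : ℝ} (hl : 0 < l) : Integrable (scaledGauss d l) :=
  ((integrable_gaussOdd (d := d)).comp_smul (inv_ne_zero hl.ne')).const_mul l

lemma integral_abs_scaledGauss {l : ℝ} (hl : 0 < l) :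
    ∫ x, |scaledGauss d l x| = l ^ (d + 2) * ∫ x : Space d, |gaussOdd x| := by
  have h1 := Measure.integral_comp_smul (volume : Measure (Space d)) (fun x => |gaussOdd x|) l⁻¹
  simp_rw [scaledGauss_apply, abs_mul, abs_of_pos hl, integral_const_mul]
  rw [h1, finrank_euclideanSpace_fin, inv_pow, inv_inv, abs_of_pos (by positivity), smul_eq_mul]
  ring

section Asymptotics

variable {J₀ : Space d → ℝ} {G : ℝ → ProbabilityMeasure (Space d)} {a β : ℝ}

lemma IsKernel.integral_sin (hG : IsKernel J₀ G) {t : ℝ} (ht : 0 < t) (x ξ : Space d) :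
    ∫ y, Real.sin (inner ℝ (x - y) ξ) ∂(G t : Measure (Space d)) =
      Real.sin (inner ℝ x ξ) * Real.exp (t * (J₀ ξ - 1)) := by
  have h1 := congrArg (fun z => (Complex.exp (((inner ℝ x ξ : ℝ) : ℂ) * Complex.I) * z).im)
    (hG.fourier t ht ξ)
  simp only [← integral_const_mul] at h1
  have hi : Integrable (fun y : Space d => Complex.exp (((inner ℝ x ξ : ℝ) : ℂ) * Complex.I) *
      Complex.exp (-(Complex.I * ((inner ℝ y ξ : ℝ) : ℂ)))) (G t : Measure (Space d)) := by
    refine Integrable.of_bound (by fun_prop) 1 (ae_of_all _ fun y => ?_)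
    rw [← Complex.exp_add, Complex.norm_exp]
    simp
  have h2 := integral_im hi
  simp only [RCLike.im_eq_complex_im] at h2
  rw [← h2, ← Complex.ofReal_exp, Complex.im_mul_ofReal, Complex.exp_ofReal_mul_I_im] at h1
  rw [← h1]
  congr 1
  ext y
  have e1 : ((inner ℝ x ξ : ℝ) : ℂ) * Complex.I + -(Complex.I * ((inner ℝ y ξ : ℝ) : ℂ)) =
      ((inner ℝ (x - y) ξ : ℝ) : ℂ) * Complex.I := by
    rw [inner_sub_left]; push_cast; ring
  rw [← Complex.exp_add, e1, Complex.exp_ofReal_mul_I_im]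

lemma IsKernel.symbol_le_one (hG : IsKernel J₀ G) (ξ : Space d) : J₀ ξ ≤ 1 := by
  have h1 := congrArg norm (hG.fourier 1 one_pos ξ)
  have h2 : ‖∫ x, Complex.exp (-(Complex.I * ((inner ℝ x ξ : ℝ) : ℂ)))
      ∂(G 1 : Measure (Space d))‖ ≤ 1 := by
    have := norm_integral_le_of_norm_le_const (μ := (G 1 : Measure (Space d))) (C := 1)
      (f := fun x => Complex.exp (-(Complex.I * ((inner ℝ x ξ : ℝ) : ℂ))))
      (ae_of_all _ fun x => by rw [Complex.norm_exp]; simp)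
    simpa using this
  rw [h1, Complex.norm_exp, Complex.ofReal_re, Real.exp_le_one_iff] at h2
  linarith

lemma abs_inner_mul_lastCoord_le (x η : Space d) :
    |inner ℝ x η| * |lastCoord η| * Real.exp (-(‖η‖ ^ 2 / 2)) ≤
      ‖x‖ * (‖η‖ ^ 2 * Real.exp (-(‖η‖ ^ 2 / 2))) := by
  have h1 : |inner ℝ x η| * |lastCoord η| ≤ (‖x‖ * ‖η‖) * ‖η‖ := by
    gcongr
    · exact abs_real_inner_le_norm x η
    · exact abs_lastCoord_le η
  calc _ ≤ (‖x‖ * ‖η‖) * ‖η‖ * Real.exp (-(‖η‖ ^ 2 / 2)) := by gcongr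
    _ = _ := by ring

/-- The Fourier representation of the evolution of the test function. -/
lemma bcfConv_scaledGauss (hG : IsKernel J₀ G) {t l : ℝ} (ht : 0 < t) (x : Space d) :
    (2 * Real.pi) ^ (((d + 1 : ℕ) : ℝ) / 2) * bcfConv (G t) (scaledGauss d l) x =
      ∫ η : Space d, l * Real.sin (inner ℝ x (l⁻¹ • η)) * Real.exp (t * (J₀ (l⁻¹ • η) - 1)) *
        (lastCoord η * Real.exp (-(‖η‖ ^ 2 / 2))) := by
  rw [bcfConv_apply, ← integral_const_mul]
  have h1 : ∀ y, (2 * Real.pi) ^ (((d + 1 : ℕ) : ℝ) / 2) * scaledGauss d l (x - y) =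
      ∫ η : Space d, l * (Real.sin (inner ℝ (x - y) (l⁻¹ • η)) *
        (lastCoord η * Real.exp (-(‖η‖ ^ 2 / 2)))) := by
    intro y
    rw [scaledGauss_apply, integral_const_mul, mul_left_comm, ← integral_sin_mul_gauss]
    simp_rw [real_inner_smul_left, real_inner_smul_right]
  simp_rw [h1]
  rw [integral_integral_swap]
  · refine integral_congr_ae (ae_of_all _ fun η => ?_)
    simp only
    rw [integral_const_mul, integral_mul_const, hG.integral_sin ht]
    ring
  · have h2 : Integrable (fun p : Space d × Space d => ‖p.2‖ * Real.exp (-(‖p.2‖ ^ 2 / 2)))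
        ((G t : Measure (Space d)).prod volume) :=
      (integrable_norm_mul_gauss (d := d)).comp_snd _
    refine (h2.mono' ?_ (ae_of_all _ fun p => ?_)).const_mul l
    · refine Continuous.aestronglyMeasurable ?_
      exact (by fun_prop : Continuous fun p : Space d × Space d =>
        Real.sin (inner ℝ (x - p.1) (l⁻¹ • p.2))).mul
        ((continuous_lastCoord.comp continuous_snd).mul (by fun_prop))
    · rw [norm_mul, norm_mul, Real.norm_of_nonneg (Real.exp_pos _).le]
      calc _ ≤ 1 * (‖p.2‖ * Real.exp (-(‖p.2‖ ^ 2 / 2))) := by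
            gcongr
            · exact Real.abs_sin_le_one _
            · exact abs_lastCoord_le _
        _ = _ := one_mul _

lemma tendsto_symbol (hJ : IsSymbol J₀ a β) (hG : IsKernel J₀ G) (η : Space d) :
    Tendsto (fun n : ℕ => ((n : ℝ) + 1) ^ β * (J₀ (((n : ℝ) + 1)⁻¹ • η) - 1)) atTop
      (𝓝 (-(a * ‖η‖ ^ β))) := by
  have hlim : Tendsto (fun n : ℕ => ((n : ℝ) + 1)⁻¹) atTop (𝓝 0) := by
    simpa using tendsto_one_div_add_atTop_nhds_zero_nat (𝕜 := ℝ)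
  have hξ : Tendsto (fun n : ℕ => ((n : ℝ) + 1)⁻¹ • η) atTop (𝓝 0) := by
    simpa using hlim.smul_const η
  have h1 : Tendsto (fun ξ : Space d => (J₀ ξ - (1 - a * ‖ξ‖ ^ β)) / ‖ξ‖ ^ β) (𝓝 0) (𝓝 0) :=
    hJ.expansion.tendsto_div_nhds_zero
  have h2 := ((h1.comp hξ).mul_const (‖η‖ ^ β)).sub_const (a * ‖η‖ ^ β)
  rw [zero_mul, zero_sub] at h2
  refine h2.congr fun n => ?_
  have hn : (0 : ℝ) < (n : ℝ) + 1 := by positivity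
  simp only [Function.comp_apply]
  have h3 : ‖((n : ℝ) + 1)⁻¹ • η‖ ^ β = (((n : ℝ) + 1) ^ β)⁻¹ * ‖η‖ ^ β := by
    rw [norm_smul, norm_inv, Real.norm_of_nonneg hn.le, Real.mul_rpow (by positivity)
      (norm_nonneg _), Real.inv_rpow hn.le]
  rw [h3]
  have h4 : 0 < ((n : ℝ) + 1) ^ β := Real.rpow_pos_of_pos hn β
  rcases eq_or_ne η 0 with rfl | hη
  · have h0 : J₀ 0 = 1 := by
      have := hG.fourier 1 one_pos 0
      simp only [inner_zero_right, Complex.ofReal_zero, mul_zero, neg_zero, Complex.exp_zero,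
        integral_const, probReal_univ, one_smul] at this
      rw [← Complex.ofReal_exp, ← Complex.ofReal_one, Complex.ofReal_inj] at this
      have h5 := (Real.exp_eq_one_iff _).1 this.symm
      linarith
    simp [h0, Real.zero_rpow hJ.β_pos.ne']
  · have h5 : 0 < ‖η‖ ^ β := Real.rpow_pos_of_pos (norm_pos_iff.2 hη) β
    field_simp
    ring

/-- The constant `∫ η_N² e^{-a|η|^β - |η|²/2} dη`. -/
def gaussConst (d : ℕ) (a β : ℝ) : ℝ :=
  ∫ η : Space d, lastCoord η ^ 2 * (Real.exp (-(a * ‖η‖ ^ β)) * Real.exp (-(‖η‖ ^ 2 / 2)))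

lemma continuous_weight (hβ : 0 < β) :
    Continuous fun η : Space d => Real.exp (-(a * ‖η‖ ^ β)) * Real.exp (-(‖η‖ ^ 2 / 2)) := by
  have : Continuous fun η : Space d => ‖η‖ ^ β := continuous_norm.rpow_const fun _ => Or.inr hβ.le
  fun_prop

lemma weight_le (ha : 0 < a) (η : Space d) :
    Real.exp (-(a * ‖η‖ ^ β)) * Real.exp (-(‖η‖ ^ 2 / 2)) ≤ Real.exp (-(‖η‖ ^ 2 / 2)) := by
  refine mul_le_of_le_one_left (Real.exp_pos _).le (Real.exp_le_one_iff.2 ?_)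
  have : 0 ≤ a * ‖η‖ ^ β := mul_nonneg ha.le (Real.rpow_nonneg (norm_nonneg _) _)
  linarith

lemma integrable_inner_mul_weight (ha : 0 < a) (hβ : 0 < β) (x : Space d) :
    Integrable fun η : Space d => inner ℝ x η * (lastCoord η *
      (Real.exp (-(a * ‖η‖ ^ β)) * Real.exp (-(‖η‖ ^ 2 / 2)))) := by
  refine ((integrable_sq_mul_gauss (d := d)).const_mul ‖x‖).mono' ?_ (ae_of_all _ fun η => ?_)
  · exact ((by fun_prop : Continuous fun η : Space d => inner ℝ x η).mul
      (continuous_lastCoord.mul (continuous_weight hβ))).aestronglyMeasurable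
  · rw [norm_mul, norm_mul, ← mul_assoc, Real.norm_of_nonneg (by positivity :
      0 ≤ Real.exp (-(a * ‖η‖ ^ β)) * Real.exp (-(‖η‖ ^ 2 / 2)))]
    refine le_trans ?_ (abs_inner_mul_lastCoord_le x η)
    rw [Real.norm_eq_abs, Real.norm_eq_abs]
    gcongr
    exact weight_le ha η

lemma inner_single_last (η : Space d) :
    inner ℝ (EuclideanSpace.single (Fin.last d) (1 : ℝ)) η = lastCoord η := by
  simp [lastCoord, EuclideanSpace.inner_single_left]

lemma gaussConst_pos (ha : 0 < a) (hβ : 0 < β) : 0 < gaussConst d a β := by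
  have hi : Integrable fun η : Space d => lastCoord η ^ 2 *
      (Real.exp (-(a * ‖η‖ ^ β)) * Real.exp (-(‖η‖ ^ 2 / 2))) := by
    refine (integrable_inner_mul_weight ha hβ
      (EuclideanSpace.single (Fin.last d) (1 : ℝ))).congr (ae_of_all _ fun η => ?_)
    simp only [inner_single_last]
    ring
  rw [gaussConst, integral_pos_iff_support_of_nonneg (fun η => by positivity) hi]
  have hopen : IsOpen (Function.support fun η : Space d => lastCoord η ^ 2 *
      (Real.exp (-(a * ‖η‖ ^ β)) * Real.exp (-(‖η‖ ^ 2 / 2)))) :=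
    ((continuous_lastCoord.pow 2).mul (continuous_weight hβ)).isOpen_support
  refine hopen.measure_pos volume ⟨EuclideanSpace.single (Fin.last d) (1 : ℝ), ?_⟩
  have : lastCoord (EuclideanSpace.single (Fin.last d) (1 : ℝ)) = 1 := by simp [lastCoord]
  rw [Function.mem_support, this]
  positivity

lemma integral_inner_mul_weight (ha : 0 < a) (hβ : 0 < β) (x : Space d) :
    ∫ η : Space d, inner ℝ x η * (lastCoord η *
      (Real.exp (-(a * ‖η‖ ^ β)) * Real.exp (-(‖η‖ ^ 2 / 2)))) =
      lastCoord x * gaussConst d a β := by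
  set f : Space d → ℝ := fun η => inner ℝ x η * (lastCoord η *
      (Real.exp (-(a * ‖η‖ ^ β)) * Real.exp (-(‖η‖ ^ 2 / 2)))) with hf
  have h1 : ∫ η, f (flipLast η) = ∫ η, f η := by
    have := (flipLastIsometry d).measurePreserving.integral_comp
      (flipLastIsometry d).toHomeomorph.measurableEmbedding f
    simpa only [flipLastIsometry_apply] using this
  have hi : Integrable f := integrable_inner_mul_weight ha hβ x
  have hi2 : Integrable fun η => f (flipLast η) := by
    have := (flipLastIsometry d).measurePreserving.integrable_comp_of_integrable hi
    simpa only [Function.comp_def, flipLastIsometry_apply] using this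
  have h2 : ∀ η, f η + f (flipLast η) = 2 * (lastCoord x * (lastCoord η ^ 2 *
      (Real.exp (-(a * ‖η‖ ^ β)) * Real.exp (-(‖η‖ ^ 2 / 2))))) := by
    intro η
    have h3 : inner ℝ x (flipLast η) = inner ℝ x η - 2 * (lastCoord x * lastCoord η) := by
      have h4 : flipLast η = η - (2 * lastCoord η) • EuclideanSpace.single (Fin.last d) (1 : ℝ) := by
        ext i
        by_cases hi : i = Fin.last d
        · subst hi
          simp only [flipLast, lastCoord, if_true, PiLp.sub_apply, PiLp.smul_apply,
            PiLp.single_apply, smul_eq_mul]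
          ring
        · simp [flipLast, hi]
      rw [h4, inner_sub_right, real_inner_smul_right, 
        real_inner_comm (EuclideanSpace.single (Fin.last d) (1 : ℝ)) x, inner_single_last]
      ring
    simp only [hf, lastCoord_flipLast, norm_flipLast, h3]
    ring
  have h3 : ∫ η, (f η + f (flipLast η)) = 2 * (lastCoord x * gaussConst d a β) := by
    simp_rw [h2, integral_const_mul]
    rfl
  rw [integral_add hi hi2, h1] at h3
  linarith

/-- Along `t = λ^β`, the evolution of the test function at scale `λ` converges pointwise to a
positive multiple of `x_N`. -/
lemma tendsto_bcfConv_scaledGauss (hJ : IsSymbol J₀ a β) (hG : IsKernel J₀ G) (x : Space d) :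
    Tendsto (fun n : ℕ => (2 * Real.pi) ^ (((d + 1 : ℕ) : ℝ) / 2) *
      bcfConv (G (((n : ℝ) + 1) ^ β)) (scaledGauss d ((n : ℝ) + 1)) x) atTop
      (𝓝 (lastCoord x * gaussConst d a β)) := by
  have ht : ∀ n : ℕ, 0 < ((n : ℝ) + 1) ^ β := fun n => Real.rpow_pos_of_pos (by positivity) β
  simp_rw [fun n : ℕ => bcfConv_scaledGauss hG (l := (n : ℝ) + 1) (ht n) x]
  rw [← integral_inner_mul_weight hJ.a_pos hJ.β_pos x]
  have hsin : ∀ (n : ℕ) (η : Space d),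
      |((n : ℝ) + 1) * Real.sin (inner ℝ x (((n : ℝ) + 1)⁻¹ • η))| ≤ |inner ℝ x η| := by
    intro n η
    have hn : (0 : ℝ) < (n : ℝ) + 1 := by positivity
    rw [abs_mul, abs_of_pos hn, real_inner_smul_right]
    calc _ ≤ ((n : ℝ) + 1) * |((n : ℝ) + 1)⁻¹ * inner ℝ x η| :=
          mul_le_mul_of_nonneg_left Real.abs_sin_le_abs hn.le
      _ = |inner ℝ x η| := by
          rw [abs_mul, abs_of_pos (inv_pos.2 hn), mul_inv_cancel_left₀ hn.ne']
  refine tendsto_integral_of_dominated_convergence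
    (fun η => ‖x‖ * (‖η‖ ^ 2 * Real.exp (-(‖η‖ ^ 2 / 2)))) (fun n => ?_)
    (integrable_sq_mul_gauss.const_mul _) (fun n => ae_of_all _ fun η => ?_)
    (ae_of_all _ fun η => ?_)
  · have hJc := hJ.continuous
    exact (((by fun_prop : Continuous fun η : Space d =>
      ((n : ℝ) + 1) * Real.sin (inner ℝ x (((n : ℝ) + 1)⁻¹ • η))).mul (by fun_prop)).mul
      (continuous_lastCoord.mul (by fun_prop))).aestronglyMeasurable
  · refine le_trans ?_ (abs_inner_mul_lastCoord_le x η)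
    have h1 : Real.exp (((n : ℝ) + 1) ^ β * (J₀ (((n : ℝ) + 1)⁻¹ • η) - 1)) ≤ 1 := by
      rw [Real.exp_le_one_iff]
      have h2 := hG.symbol_le_one (((n : ℝ) + 1)⁻¹ • η)
      exact mul_nonpos_of_nonneg_of_nonpos (ht n).le (by linarith)
    rw [norm_mul, norm_mul, norm_mul (lastCoord η), Real.norm_of_nonneg (Real.exp_pos _).le,
      Real.norm_of_nonneg (Real.exp_pos (-(‖η‖ ^ 2 / 2))).le, ← mul_assoc]
    gcongr
    · exact mul_le_of_le_one_right (norm_nonneg _) h1 |>.trans (hsin n η)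
    · exact le_rfl
  · have h1 : Tendsto (fun n : ℕ => ((n : ℝ) + 1) * Real.sin (inner ℝ x (((n : ℝ) + 1)⁻¹ • η)))
        atTop (𝓝 (inner ℝ x η)) := by
      have hd : HasDerivAt (fun s : ℝ => Real.sin (s * inner ℝ x η)) (inner ℝ x η) 0 := by
        have := ((hasDerivAt_id (0 : ℝ)).mul_const (inner ℝ x η)).sin
        simpa using this
      rw [hasDerivAt_iff_tendsto_slope] at hd
      have hlim : Tendsto (fun n : ℕ => ((n : ℝ) + 1)⁻¹) atTop (𝓝[≠] 0) := by
        refine tendsto_nhdsWithin_iff.2 ⟨by simpa using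
          tendsto_one_div_add_atTop_nhds_zero_nat (𝕜 := ℝ), Eventually.of_forall fun n => ?_⟩
        exact inv_ne_zero (by positivity)
      refine (hd.comp hlim).congr fun n => ?_
      simp [slope_def_module, real_inner_smul_right]
    have h2 := (Real.continuous_exp.tendsto _).comp (tendsto_symbol hJ hG η)
    have h3 := (h1.mul h2).mul_const (lastCoord η * Real.exp (-(‖η‖ ^ 2 / 2)))
    refine (h3.congr fun n => rfl).trans (le_of_eq ?_)
    congr 1
    ring

end Asymptotics

/-! ### Nonnegativity -/

lemma isHalfSpaceSolution_zero (A : 𝓢(Space d, ℝ) →ₗ[ℝ] (Space d →ᵇ ℝ)) {α : ℝ} (S : ℝ) :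
    IsHalfSpaceSolution A α S 0 0 := by
  have h0 : oddExt (0 : Space d → ℝ) = 0 := by
    ext x
    simp [oddExt]
  have h1 : (fun t : ℝ => oddExt ((0 : ℝ → Space d → ℝ) t)) = fun _ => 0 := funext fun t => h0
  have hc : ∀ p : ℝ≥0∞, ContinuousInLp p (Icc 0 S) fun _ => (0 : Space d → ℝ) := fun p t _ =>
    ⟨MemLp.zero', by simpa using tendsto_const_nhds⟩
  rw [IsHalfSpaceSolution, h0, h1]
  refine ⟨EventuallyEq.rfl, ⟨fun _ => 0, fun t _ => ?_, contDiffOn_const⟩, hc _, hc _,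
    ⟨0, by simp⟩, by simp⟩
  exact Lp.coeFn_zero ℝ 1 (volume : Measure (Space d))

section Sign

variable {J₀ : Space d → ℝ} {G : ℝ → ProbabilityMeasure (Space d)}
  {A : 𝓢(Space d, ℝ) →ₗ[ℝ] (Space d →ᵇ ℝ)} {α : ℝ}

lemma ComparisonPrinciple.solution_nonneg (hcomp : ComparisonPrinciple G A α) {S : ℝ} (hS : 0 < S)
    {u₀ : Space d → ℝ} (hu₀ : IsInitialDatum u₀) {u : ℝ → Space d → ℝ}
    (hu : IsHalfSpaceSolution A α S u₀ u) {t : ℝ} (ht : t ∈ Icc 0 S) :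
    ∀ᵐ x ∂halfVolume d, 0 ≤ u t x :=
  hcomp.semilinear S 0 u₀ 0 u hS MemLp.zero' MemLp.zero' hu₀.memLp_one hu₀.memLp_top hu₀.nonneg
    (isHalfSpaceSolution_zero A S) hu t ht

lemma IsKernel.bcfSemigroup_flipLast (hG : IsKernel J₀ G) {ψ : Space d →ᵇ ℝ}
    (hψ : ∀ x, ψ (flipLast x) = -ψ x) (t : ℝ) (x : Space d) :
    bcfSemigroup G t ψ (flipLast x) = -bcfSemigroup G t ψ x := by
  by_cases ht : 0 < t
  · rw [bcfSemigroup_of_pos ht, bcfConv_apply, bcfConv_apply, ← integral_neg]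
    conv_lhs => rw [← hG.map_flipLast ht]
    have hc : Continuous fun y => ψ (flipLast x - y) := ψ.continuous.comp (by fun_prop)
    rw [integral_map continuous_flipLast.aemeasurable hc.aestronglyMeasurable]
    refine integral_congr_ae (ae_of_all _ fun y => ?_)
    simp only
    rw [← hψ, ← flipLastIsometry_apply, ← flipLastIsometry_apply, ← flipLastIsometry_apply,
      map_sub (flipLastIsometry d)]
  · rw [bcfSemigroup_of_nonpos (not_lt.1 ht), hψ]

/-- The evolution of an odd function that is nonnegative on the half-space is nonnegative there. -/
lemma ComparisonPrinciple.bcfSemigroup_nonneg (hcomp : ComparisonPrinciple G A α) {ψ : Space d →ᵇ ℝ}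
    (hψ : ∀ x, ψ (flipLast x) = -ψ x) (hint : Integrable ψ)
    (hpos : ∀ x, 0 < lastCoord x → 0 ≤ ψ x) (t : ℝ) :
    ∀ᵐ x ∂halfVolume d, 0 ≤ bcfSemigroup G t ψ x := by
  by_cases ht : 0 < t
  · have h1 := hcomp.linear 0 ψ MemLp.zero' MemLp.zero'
      (memLp_one_iff_integrable.2 hint.restrict)
      (memLp_top_of_bound ψ.continuous.aestronglyMeasurable ‖ψ‖
        (ae_of_all _ fun x => ψ.norm_coe_le_norm x))
      ((ae_restrict_mem measurableSet_halfSpace).mono fun x hx => hpos x hx) t ht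
    filter_upwards [h1] with x hx
    rw [bcfSemigroup_of_pos ht, bcfConv_apply]
    have h0 : oddExt (0 : Space d → ℝ) = 0 := by
      ext x
      simp [oddExt]
    simpa [linearHalfSpaceFlow, oddExt_of_odd hψ, h0] using hx
  · rw [bcfSemigroup_of_nonpos (not_lt.1 ht)]
    exact (ae_restrict_mem measurableSet_halfSpace).mono fun x hx => hpos x hx

lemma oddExt_mul_nonneg {f g : Space d → ℝ} (hf : ∀ᵐ x ∂halfVolume d, 0 ≤ f x)
    (hg : ∀ᵐ x ∂halfVolume d, 0 ≤ g x) (hodd : ∀ x, g (flipLast x) = -g x) :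
    ∀ᵐ x, 0 ≤ oddExt f x * g x := by
  filter_upwards [ae_of_ae_halfVolume hf, ae_of_ae_halfVolume hg] with x h1 h2
  unfold oddExt
  split_ifs with h3 h4
  · exact mul_nonneg (h1.1 h3) (h2.1 h3)
  · have h5 := h2.2 h4
    rw [hodd] at h5
    have := mul_nonneg (h1.2 h4) h5
    linarith
  · rw [zero_mul]

end Sign

/-! ### The mass of convolutions -/

lemma integrable_comp_sub (μ : ProbabilityMeasure (Space d)) {φ : Space d →ᵇ ℝ}
    (hφ : Integrable φ) :
    Integrable (fun p : Space d × Space d => φ (p.1 - p.2)) (volume.prod (μ : Measure (Space d))) := by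
  have hc : Continuous fun p : Space d × Space d => φ (p.1 - p.2) :=
    φ.continuous.comp (by fun_prop)
  rw [integrable_prod_iff' hc.aestronglyMeasurable]
  refine ⟨ae_of_all _ fun y => hφ.comp_sub_right y, ?_⟩
  have hsub : ∀ y, ∫ x, ‖φ (x - y)‖ = ∫ x, ‖φ x‖ := fun y =>
    integral_sub_right_eq_self (μ := volume) (fun x => ‖φ x‖) y
  simp only [hsub]
  exact integrable_const _

lemma integrable_bcfConv (μ : ProbabilityMeasure (Space d)) {φ : Space d →ᵇ ℝ}
    (hφ : Integrable φ) : Integrable (bcfConv μ φ) :=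
  (integrable_comp_sub μ hφ).integral_prod_left.congr (ae_of_all _ fun x => by
    simp only [bcfConv_apply])

lemma integral_abs_bcfConv_le (μ : ProbabilityMeasure (Space d)) {φ : Space d →ᵇ ℝ}
    (hφ : Integrable φ) : ∫ x, |bcfConv μ φ x| ≤ ∫ x, |φ x| := by
  have h1 := (integrable_comp_sub μ hφ).norm
  calc ∫ x, |bcfConv μ φ x| ≤ ∫ x, ∫ y, ‖φ (x - y)‖ ∂(μ : Measure (Space d)) := by
        refine integral_mono (integrable_bcfConv μ hφ).abs h1.integral_prod_left fun x => ?_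
        simp only [bcfConv_apply]
        exact norm_integral_le_integral_norm fun y => φ (x - y)
    _ = ∫ y, (∫ x, ‖φ (x - y)‖) ∂(μ : Measure (Space d)) := integral_integral_swap h1
    _ = ∫ x, |φ x| := by
        have hsub : ∀ y, ∫ x, ‖φ (x - y)‖ = ∫ x, ‖φ x‖ := fun y =>
          integral_sub_right_eq_self (μ := volume) (fun x => ‖φ x‖) y
        simp only [hsub]
        simp

lemma integrable_bcfSemigroup (G : ℝ → ProbabilityMeasure (Space d)) (t : ℝ) {φ : Space d →ᵇ ℝ}
    (hφ : Integrable φ) : Integrable (bcfSemigroup G t φ) := by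
  unfold bcfSemigroup
  split_ifs
  exacts [integrable_bcfConv _ hφ, hφ]

lemma integral_abs_bcfSemigroup_le (G : ℝ → ProbabilityMeasure (Space d)) (t : ℝ)
    {φ : Space d →ᵇ ℝ} (hφ : Integrable φ) : ∫ x, |bcfSemigroup G t φ x| ≤ ∫ x, |φ x| := by
  unfold bcfSemigroup
  split_ifs
  exacts [integral_abs_bcfConv_le _ hφ, le_rfl]

/-! ### Kaplan's inequality -/

/-- The tangent line inequality for the convex function `v ↦ v^{1+α}` at `k`. -/
lemma tangent_le_rpow {α : ℝ} (hα : 0 < α) {k v : ℝ} (hk : 0 ≤ k) (hv : 0 ≤ v) :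
    (1 + α) * k ^ α * v - α * k ^ α * k ≤ v ^ α * v := by
  rcases hk.eq_or_lt with rfl | hk
  · rw [Real.zero_rpow hα.ne']
    have := mul_nonneg (Real.rpow_nonneg hv α) hv
    linarith
  · have h1 := one_add_mul_self_le_rpow_one_add (s := v / k - 1) (p := 1 + α)
      (by linarith [div_nonneg hv hk.le]) (by linarith)
    rw [add_sub_cancel, Real.rpow_add_of_nonneg (div_nonneg hv hk.le) zero_le_one hα.le,
      Real.rpow_one, Real.div_rpow hv hk.le] at h1
    have h2 : 0 < k ^ α := Real.rpow_pos_of_pos hk α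
    have h3 := mul_le_mul_of_nonneg_left h1 (mul_pos h2 hk).le
    have h4 : k ^ α * k * (1 + (1 + α) * (v / k - 1)) =
        (1 + α) * k ^ α * v - α * k ^ α * k := by
      field_simp; ring
    have h5 : k ^ α * k * (v / k * (v ^ α / k ^ α)) = v ^ α * v := by
      field_simp
    rwa [h4, h5] at h3

/-- A function with `y^{1+α} ≤ K y'` on an interval of length `S` satisfies `α S y(0)^α ≤ K`. -/
lemma rpow_le_of_rpow_le_deriv {α K S : ℝ} (hα : 0 < α) (hK : 0 < K) (hS : 0 < S) {y y' : ℝ → ℝ}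
    (hc : ContinuousOn y (Icc 0 S)) (hd : ∀ s ∈ Ioo 0 S, HasDerivAt y (y' s) s)
    (hy : ∀ s ∈ Icc 0 S, 0 ≤ y s) (h : ∀ s ∈ Ioo 0 S, y s ^ α * y s ≤ K * y' s) :
    α * S * y 0 ^ α ≤ K := by
  have h0 : (0 : ℝ) ∈ Icc 0 S := ⟨le_rfl, hS.le⟩
  rcases (hy 0 h0).eq_or_lt with h1 | hpos
  · rw [← h1, Real.zero_rpow hα.ne', mul_zero]
    exact hK.le
  have hmono : MonotoneOn y (Icc 0 S) := by
    refine monotoneOn_of_hasDerivWithinAt_nonneg (convex_Icc 0 S) hc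
      (fun s hs => (hd s (by rwa [interior_Icc] at hs)).hasDerivWithinAt) fun s hs => ?_
    rw [interior_Icc] at hs
    have h2 : 0 ≤ K * y' s := (mul_nonneg (Real.rpow_nonneg (hy s (Ioo_subset_Icc_self hs)) α)
      (hy s (Ioo_subset_Icc_self hs))).trans (h s hs)
    exact nonneg_of_mul_nonneg_right h2 hK
  have hypos : ∀ s ∈ Icc 0 S, 0 < y s := fun s hs => hpos.trans_le (hmono h0 hs hs.1)
  -- The function `K y^{-α} + α s` is nonincreasing.
  have hanti : AntitoneOn (fun s => K * y s ^ (-α) + α * s) (Icc 0 S) := by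
    refine antitoneOn_of_hasDerivWithinAt_nonpos
      (f' := fun s => K * (y' s * (-α) * y s ^ (-α - 1)) + α) (convex_Icc 0 S) ?_
      (fun s hs => ?_) fun s hs => ?_
    · exact (continuousOn_const.mul (hc.rpow_const fun s hs => Or.inl (hypos s hs).ne')).add
        (by fun_prop)
    · rw [interior_Icc] at hs
      have h2 := ((hd s hs).rpow_const (p := -α)
        (Or.inl (hypos s (Ioo_subset_Icc_self hs)).ne')).const_mul K
      have h3 : HasDerivAt (fun s => α * s) α s := by
        simpa using (hasDerivAt_id s).const_mul α
      exact (h2.add h3).hasDerivWithinAt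
    · rw [interior_Icc] at hs
      have hys := hypos s (Ioo_subset_Icc_self hs)
      have h2 : y s ^ α * y s * y s ^ (-α - 1) = 1 := by
        rw [Real.rpow_sub hys, Real.rpow_neg hys.le, Real.rpow_one]
        have := (Real.rpow_pos_of_pos hys α).ne'
        field_simp
      have h3 := mul_le_mul_of_nonneg_right (h s hs) (Real.rpow_nonneg hys.le (-α - 1))
      rw [h2] at h3
      nlinarith
  have h2 := hanti h0 ⟨hS.le, le_rfl⟩ hS.le
  simp only [mul_zero, add_zero] at h2
  have h3 : α * S ≤ K * y 0 ^ (-α) := by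
    have := mul_nonneg hK.le (Real.rpow_nonneg (hy S ⟨hS.le, le_rfl⟩) (-α))
    linarith
  have h4 := mul_le_mul_of_nonneg_right h3 (Real.rpow_nonneg hpos.le α)
  rwa [mul_assoc K, ← Real.rpow_add hpos, neg_add_cancel, Real.rpow_zero, mul_one] at h4

section Kaplan

variable {J₀ : Space d → ℝ} {G : ℝ → ProbabilityMeasure (Space d)}
  {A : 𝓢(Space d, ℝ) →ₗ[ℝ] (Space d →ᵇ ℝ)} {α : ℝ}

/-- Jensen's inequality for `v ↦ v^{1+α}` and a weight of mass at most `m`. -/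
lemma rpow_pair_le {hα : 0 < α} {R : ℝ} {hR : 0 ≤ R} {f : L1 d} (hf : f ∈ boundedBy d R)
    {φ : Space d →ᵇ ℝ} (hφ : Integrable φ) {m : ℝ} (hm : 0 < m) (hφm : ∫ x, |φ x| ≤ m)
    (hpos : ∀ᵐ x, 0 ≤ f x * φ x) :
    pair f φ ^ α * pair f φ ≤ m ^ α * pair (nonlin d hα hR f) φ := by
  have hy : 0 ≤ pair f φ := integral_nonneg_of_ae hpos
  set k := pair f φ / m with hk
  have hk0 : 0 ≤ k := div_nonneg hy hm.le
  have hi := integrable_mul_bcf f φ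
  have h1 : (1 + α) * k ^ α * pair f φ - α * k ^ α * k * ∫ x, |φ x| ≤
      pair (nonlin d hα hR f) φ := by
    rw [pair_apply, pair_apply, ← integral_const_mul, ← integral_const_mul,
      ← integral_sub (hi.const_mul _) (hφ.abs.const_mul _)]
    refine integral_mono_ae ((hi.const_mul _).sub (hφ.abs.const_mul _)) (integrable_mul_bcf _ φ) ?_
    filter_upwards [coeFn_nonlin_of_mem hα hR hf, hpos] with x hx hx'
    simp only [hx]
    have h2 : f x * φ x = |f x| * |φ x| := by rw [← abs_mul, abs_of_nonneg hx']
    rw [mul_assoc (|f x| ^ α), h2]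
    have h3 := mul_le_mul_of_nonneg_right (tangent_le_rpow hα hk0 (abs_nonneg (f x)))
      (abs_nonneg (φ x))
    linarith
  have hyk : pair f φ = k * m := by rw [hk]; field_simp
  have hka : 0 ≤ k ^ α := Real.rpow_nonneg hk0 α
  have hma : 0 ≤ m ^ α := Real.rpow_nonneg hm.le α
  have h2 : α * k ^ α * k * ∫ x, |φ x| ≤ α * k ^ α * k * m := by gcongr
  have h3 : k ^ α * (k * m) ≤ pair (nonlin d hα hR f) φ := by
    rw [hyk] at h1
    linarith
  calc pair f φ ^ α * pair f φ = m ^ α * (k ^ α * (k * m)) := by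
        rw [hyk, Real.mul_rpow hk0 hm.le]; ring
    _ ≤ _ := by gcongr

/-- Kaplan's inequality: on `[0,S]` the function `s ↦ ⟨U(s), G(S-s) * ψ⟩` satisfies
`y^{1+α} ≤ m^α y'`, which bounds its initial value. -/
lemma IsStrongSolution.kaplan (hG : IsKernel J₀ G) (hA : IsDiffusionOperator G A) {hα : 0 < α}
    {S : ℝ} (hS : 0 < S) {U : ℝ → L1 d} (hU : IsStrongSolution A hα S U) {ψ : Space d →ᵇ ℝ}
    (hψ : Integrable ψ) {m : ℝ} (hm : 0 < m) (hψm : ∫ x, |ψ x| ≤ m)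
    (hpos : ∀ s ∈ Icc 0 S, ∀ r, ∀ᵐ x, 0 ≤ U s x * bcfSemigroup G r ψ x) :
    α * S * pair (U 0) (bcfSemigroup G S ψ) ^ α ≤ m ^ α := by
  obtain ⟨R, hR, hb, hgen⟩ := hU.equation
  have hP := isContractionSemigroup hG hA
  let ℓ : L1 d →L[ℝ] ℝ := pair.flip ψ
  have hℓ : ∀ t f, ℓ (semigroup G t f) = pair f (bcfSemigroup G t ψ) := 
    fun t f => pair_semigroup t f ψ
  have h1 := rpow_le_of_rpow_le_deriv hα (Real.rpow_pos_of_pos hm α) hS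
    (y := fun s => ℓ (semigroup G (S - s) (U s)))
    (y' := fun s => ℓ (semigroup G (S - s) (nonlin d hα hR (U s))))
    (ℓ.continuous.comp_continuousOn (hP.comp_continuousOn (by fun_prop) hU.continuousOn))
    (fun s hs => by
      have h2 := hP.hasDerivAt_duhamel hs.2 (hU.hasDerivAt hs)
        fun h hh => (hgen s hs).semigroup_sub_eq hG hA hh
      rw [sub_sub_cancel] at h2
      exact ℓ.hasFDerivAt.comp_hasDerivAt s h2)
    (fun s hs => by
      simp only [hℓ]
      exact integral_nonneg_of_ae (hpos s hs _))
    (fun s hs => by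
      have hs' := Ioo_subset_Icc_self hs
      simp only [hℓ]
      exact rpow_pair_le (hb s hs') (integrable_bcfSemigroup G _ hψ) hm
        ((integral_abs_bcfSemigroup_le G _ hψ).trans hψm) (hpos s hs' _))
  simpa only [hℓ, sub_zero] using h1

end Kaplan

/-! ### Nonexistence of global solutions -/

/-- If `λ^β c(λ)^α` is at most a constant times `λ^{pα}` along the integers, where `p α < β`, then
`c(λ) → 0`. -/
lemma tendsto_zero_of_rpow_le {α β C p : ℝ} (hα : 0 < α) (hαβ : p * α < β) {c : ℕ → ℝ}
    (hc : ∀ n, 0 ≤ c n)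
    (h : ∀ n : ℕ, α * ((n : ℝ) + 1) ^ β * c n ^ α ≤ C * ((n : ℝ) + 1) ^ (p * α)) :
    Tendsto c atTop (𝓝 0) := by
  have h1 : Tendsto (fun n : ℕ => C / α * ((n : ℝ) + 1) ^ (-(β - p * α))) atTop (𝓝 0) := by
    have h2 := (tendsto_rpow_neg_atTop (y := β - p * α) (by linarith)).comp
      (tendsto_atTop_add_const_right atTop 1 (tendsto_natCast_atTop_atTop (R := ℝ)))
    simpa using h2.const_mul (C / α)
  have h2 : Tendsto (fun n => c n ^ α) atTop (𝓝 0) := by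
    refine squeeze_zero (fun n => Real.rpow_nonneg (hc n) α) (fun n => ?_) h1
    have hn : (0 : ℝ) < (n : ℝ) + 1 := by positivity
    have hb : 0 < ((n : ℝ) + 1) ^ β := Real.rpow_pos_of_pos hn β
    rw [neg_sub, Real.rpow_sub hn, div_mul_div_comm, le_div_iff₀ (mul_pos hα hb)]
    linarith [h n]
  have h3 := h2.rpow_const (p := α⁻¹) (Or.inr (inv_pos.2 hα).le)
  rw [Real.zero_rpow (inv_pos.2 hα).ne'] at h3
  refine h3.congr fun n => ?_
  rw [← Real.rpow_mul (hc n), mul_inv_cancel₀ hα.ne', Real.rpow_one]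

section Global

variable {J₀ : Space d → ℝ} {G : ℝ → ProbabilityMeasure (Space d)} {a β α : ℝ}
  {A : 𝓢(Space d, ℝ) →ₗ[ℝ] (Space d →ᵇ ℝ)} {u₀ : Space d → ℝ}

/-- There is no global solution. -/
lemma not_isSolutionUpTo_top (hJ : IsSymbol J₀ a β) (hG : IsKernel J₀ G)
    (hA : IsDiffusionOperator G A) (hcomp : ComparisonPrinciple G A α) (hα : 0 < α)
    (hαβ : α < β / (((d + 1 : ℕ) : ℝ) + 1)) (hu₀ : IsInitialDatum u₀) (u : ℝ → Space d → ℝ) :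
    ¬ IsSolutionUpTo A α ⊤ u₀ u := by
  intro hu
  have hsol : ∀ S, 0 < S → IsHalfSpaceSolution A α S u₀ u := fun S hS =>
    hu.2 S hS (EReal.coe_lt_top S)
  set U : ℝ → L1 d := fun t => toL1 (oddExt (u t))
  have hU : ∀ t, 0 ≤ t → U t =ᵐ[volume] oddExt (u t) := fun t ht =>
    IsWeakSolution.coeFn_toL1 (hsol (t + 1) (by linarith)) ⟨ht, by linarith⟩
  have hl : ∀ n : ℕ, (0 : ℝ) < (n : ℝ) + 1 := fun n => by positivity
  have ht : ∀ n : ℕ, 0 < ((n : ℝ) + 1) ^ β := fun n => Real.rpow_pos_of_pos (hl n) β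
  have hpos : ∀ (n : ℕ) (s : ℝ), 0 ≤ s → ∀ r, ∀ᵐ x,
      0 ≤ U s x * bcfSemigroup G r (scaledGauss d ((n : ℝ) + 1)) x := by
    intro n s hs r
    filter_upwards [hU s hs, oddExt_mul_nonneg
      (hcomp.solution_nonneg (by linarith : 0 < s + 1) hu₀ (hsol _ (by linarith)) ⟨hs, by linarith⟩)
      (hcomp.bcfSemigroup_nonneg (scaledGauss_flipLast _) (integrable_scaledGauss (hl n))
        (fun x hx => scaledGauss_nonneg (hl n) hx) r)
      (hG.bcfSemigroup_flipLast (scaledGauss_flipLast _) r)] with x h1 h2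
    rwa [h1]
  set c : ℕ → ℝ := fun n =>
    pair (U 0) (bcfSemigroup G (((n : ℝ) + 1) ^ β) (scaledGauss d ((n : ℝ) + 1))) with hc
  have hc0 : ∀ n, 0 ≤ c n := fun n => integral_nonneg_of_ae (hpos n 0 le_rfl _)
  set K := (∫ x : Space d, |gaussOdd x|) + 1
  have hK : 0 < K := add_pos_of_nonneg_of_pos (integral_nonneg fun x => abs_nonneg _) one_pos
  -- The mass of the test function at scale `λ` is a multiple of `λ^{N+1}`.
  have hctend : Tendsto c atTop (𝓝 0) := by
    refine tendsto_zero_of_rpow_le (C := K ^ α) (p := ((d + 2 : ℕ) : ℝ)) (β := β) hα ?_ hc0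
      fun n => ?_
    · rw [lt_div_iff₀ (by positivity)] at hαβ
      push_cast at hαβ ⊢
      linarith
    · have h1 := (IsStrongSolution.of_weak hα (ht n) fun S' hS' => hsol S' hS'.1).kaplan hG hA
        (ht n) (integrable_scaledGauss (hl n)) (m := K * ((n : ℝ) + 1) ^ (d + 2))
        (mul_pos hK (pow_pos (hl n) _)) (by
          rw [integral_abs_scaledGauss (hl n), mul_comm]
          have := pow_pos (hl n) (d + 2)
          gcongr
          simp [K])
        fun s hs => hpos n s hs.1
      rwa [Real.mul_rpow hK.le (pow_pos (hl n) _).le, ← Real.rpow_natCast, ← Real.rpow_mul (hl n).le]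
        at h1
  -- By Fatou's lemma the pointwise limit of `U(0) (G(t) * ψ)` vanishes.
  have hb : 0 < (2 * Real.pi) ^ (((d + 1 : ℕ) : ℝ) / 2) := by positivity
  set b := (2 * Real.pi) ^ (((d + 1 : ℕ) : ℝ) / 2)
  have hfatou : ∫⁻ x, ENNReal.ofReal (U 0 x * (lastCoord x * gaussConst d a β)) ≤ 0 := by
    set g : ℕ → Space d → ℝ≥0∞ := fun n x => ENNReal.ofReal
      (b * (U 0 x * bcfSemigroup G (((n : ℝ) + 1) ^ β) (scaledGauss d ((n : ℝ) + 1)) x))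
    have hlim : ∀ x, Tendsto (fun n => g n x) atTop
        (𝓝 (ENNReal.ofReal (U 0 x * (lastCoord x * gaussConst d a β)))) := by
      intro x
      refine (ENNReal.continuous_ofReal.tendsto _).comp ?_
      refine ((tendsto_bcfConv_scaledGauss hJ hG x).const_mul (U 0 x)).congr fun n => ?_
      rw [bcfSemigroup_of_pos (ht n)]
      ring
    have hg : ∀ n, ∫⁻ x, g n x = ENNReal.ofReal (b * c n) := by
      intro n
      rw [hc]
      simp only [pair_apply]
      rw [← integral_const_mul, ofReal_integral_eq_lintegral_ofReal
        ((integrable_mul_bcf _ _).const_mul b)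
        ((hpos n 0 le_rfl _).mono fun x hx => mul_nonneg hb.le hx)]
    have hgt : Tendsto (fun n => ∫⁻ x, g n x) atTop (𝓝 0) := by
      simp_rw [hg]
      have := (ENNReal.continuous_ofReal.tendsto _).comp (hctend.const_mul b)
      rwa [mul_zero, ENNReal.ofReal_zero] at this
    calc ∫⁻ x, ENNReal.ofReal (U 0 x * (lastCoord x * gaussConst d a β))
        = ∫⁻ x, liminf (fun n => g n x) atTop :=
          lintegral_congr fun x => (hlim x).liminf_eq.symm
      _ ≤ liminf (fun n => ∫⁻ x, g n x) atTop := lintegral_liminf_le' fun n =>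
          ((integrable_mul_bcf _ _).const_mul b).aestronglyMeasurable.aemeasurable.ennreal_ofReal
      _ = 0 := hgt.liminf_eq
  have hmeas : AEMeasurable fun x =>
      ENNReal.ofReal (U 0 x * (lastCoord x * gaussConst d a β)) :=
    ((Lp.aestronglyMeasurable (U 0)).aemeasurable.mul
      (continuous_lastCoord.measurable.mul_const _).aemeasurable).ennreal_ofReal
  have hzero := (lintegral_eq_zero_iff' hmeas).1 (le_antisymm hfatou zero_le)
  refine hu₀.nontrivial ?_
  have hU0 : U 0 =ᵐ[volume] oddExt u₀ := (hU 0 le_rfl).trans (hsol 1 one_pos).initial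
  filter_upwards [hu₀.nonneg, ae_restrict_of_ae (s := halfSpace d) hzero,
    ae_restrict_of_ae (s := halfSpace d) hU0, ae_restrict_mem measurableSet_halfSpace]
    with x h1 h2 h3 h4
  rw [Pi.zero_apply, ENNReal.ofReal_eq_zero, h3, oddExt_of_pos _ h4] at h2
  have h5 : 0 < lastCoord x * gaussConst d a β := mul_pos h4 (gaussConst_pos hJ.a_pos hJ.β_pos)
  exact le_antisymm (nonpos_of_mul_nonpos_left h2 h5) h1

end Global

end HalfSpaceBlowup

end

theorem theorem2p1 (d : ℕ) (J₀ : HalfSpaceBlowup.Space d → ℝ) (a β α : ℝ)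
    (G : ℝ → ProbabilityMeasure (HalfSpaceBlowup.Space d))
    (A : 𝓢(HalfSpaceBlowup.Space d, ℝ) →ₗ[ℝ] (HalfSpaceBlowup.Space d →ᵇ ℝ))
    (hJ₀ : HalfSpaceBlowup.IsSymbol J₀ a β)
    (hG : HalfSpaceBlowup.IsKernel J₀ G)
    (hA : HalfSpaceBlowup.IsDiffusionOperator G A)
    (hcomp : HalfSpaceBlowup.ComparisonPrinciple G A α)
    (hα : 0 < α) (hαβ : α < β / (((d + 1 : ℕ) : ℝ) + 1))
    (u₀ : HalfSpaceBlowup.Space d → ℝ) (hu₀ : HalfSpaceBlowup.IsInitialDatum u₀)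
    (T : EReal) (u : ℝ → HalfSpaceBlowup.Space d → ℝ)
    (hu : HalfSpaceBlowup.IsMaximalSolution A α T u₀ u) :
    HalfSpaceBlowup.BlowsUpInFiniteTime T u := by
  induction T with
  | bot => exact absurd hu.1.1 (by simp)
  | top => exact absurd hu.1 (HalfSpaceBlowup.not_isSolutionUpTo_top hJ₀ hG hA hcomp hα hαβ hu₀ u)
  | coe S => exact ⟨S, rfl, hu.tendsto_eLpNorm hG hA hα⟩
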